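/- Let $\Gamma$ be a right-angled Coxeter group with finite set of generators $S$: all $s\in S$ are involutions, and the only other relations say that certain pairs of generators commute. Its defining diagram is the graph on $S$ in which two distinct generators are joined when they commute. Assume that * the diagram is super-flexible: for all $s\ne t$ in $S$ that do not commute there are $u\in S\setminus\{s,t\}$ commuting with neither $s$ nor $t$ and a graph automorphism $\phi$ of the diagram such that either $\phi$ fixes $s$ and all neighbours of $s$ and exchanges $t$ and $u$, or $\phi$ fixes $t$ and all neighbours of $t$ and exchanges $s$ and $u$; * there are three distinct pairwise non-commuting generators, each of which commutes with all the other elements of $S$. Let $\lambda$ be the left regular representation on $\ell^2(\Gamma)$, $P=\lambda(\mathbf 1_S)=\sum_{s\in S}\lambda(s)$, $R^z=(P-z)^{-1}$, $\operatorname{Im}R^z=(R^z-(R^z)^*)/(2i)$, $Q(x,y)=\langle\delta_x,Q\delta_y\rangle$, and let $|g|$ be the word length with respect to $S$. For $p=\sum_g p_g g\in\mathbb C[\Gamma]$ and a finite generating set $S'$ let $\operatorname{diam}_{S'}(p)$ be the maximum of $1$ and the diameter of the support of $p$ in the (left) Cayley graph. The group $\Gamma$ has rapid decay with exponent $C_1>0$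 if for some finite generating set $S'$ and some $C>0$, $\|\lambda(p)\|\le C\operatorname{diam}_{S'}(p)^{C_1}\|p\|_2$ for all $p\in\mathbb C[\Gamma]$. Then the following holds. 1. $\Gamma$ has rapid decay with some exponent $C_1>0$. 2. There are integers $N_1<N_2<\cdots$ and homomorphisms $\rho_{N_k}:\Gamma\to S_{N_k}$ converging in distribution to $\lambda$, i.e. $\frac1{N_k}\operatorname{Tr}\rho_{N_k}(g)\to0$ for every $g\neq e$ (permutations are identified with their permutation matrices). 3. There is a finite set $D\subset\mathbb R$ such that $\sigma(P)\setminus D$ is open in $\mathbb R$ and, for every interval $I_0=[a,b]\subset\sigma(P)\setminus D$ with $a<b$: * (AC) there is $C_0\ge1$ such that $\operatorname{Im}R^{E+i\eta}(e,e)\le C_0$ for all $E\in I_0$, $\eta>0$, and $\operatorname{Im}R^{E+i\eta}(e,e)\ge C_0^{-1}$ for all $E\in I_0$, $0<\eta\le1$; * (fourth-moment condition) for every exponent $C_1>0$ of rapid decay of $\Gamma$ there is $C_1'>2C_1+1$ such that $$\lim_{\eta\to0^+}\ \sup_{E\in I_0}\ \sum_{g\in\Gamma}\eta^2\,|(\operatorname{Im}R^{E+i\eta})(e,g)|^4\,|g|^{C_1'}=0;$$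 * (quantum ergodicity and mixing) let $\rho_N:\Gamma\to S_N$, along any sequence of integers $N\to\infty$, converge in distribution to $\lambda$, write $g.x=\rho_N(g)(x)$, let $I=[c,d]$ with $c<d$ be contained in the interior of $I_0$, and let $(\varphi_\alpha)$ be, for each $N$, an orthonormal basis of eigenvectors of $\rho_N(\mathbf 1_S)$ in $\mathbb C^N$, with eigenvalues $(\lambda_\alpha)$. Then for every finite $T\subset\Gamma$ there are subspaces $H_N\subset\mathbb C^N$ with $\dim H_N=o(N)$ such that for every sequence of matrices $K_N\in M_N(\mathbb C)$ with $K_N(x,y)=0$ unless $x=g.y$ for some $g\in T$, with $|K_N(x,y)|\le1$ for all $x,y$, and with $(K_N(t.x,x))_{x}\in H_N^\perp$ for all $t\in T$, one has, with $\Lambda_J=\{\alpha:\lambda_\alpha\in J\}$, $J_E^\eta=[E-\eta,E+\eta]$ and $\langle K_N\rangle=\sum_{g\in T}\bigl(\frac1N\sum_xK_N(g.x,x)\bigr)\rho_N(g)$, $$\lim_{N\to\infty}\frac1{|\Lambda_I|}\sum_{\alpha\in\Lambda_I}\bigl|\langle\varphi_\alpha,K_N\varphi_\alpha\rangle-\langle\varphi_\alpha,\langle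 K_N\rangle\varphi_\alpha\rangle\bigr|^2=0,$$ and for all $E_1,E_2$ in the interior of $I$, $$\lim_{\eta\to0^+}\limsup_{N\to\infty}\frac1{|\Lambda_{J_{E_1}^\eta}|}\sum_{\alpha\in\Lambda_{J_{E_1}^\eta}}\ \sum_{\beta\in\Lambda_{J_{E_2}^\eta}}\bigl|\langle\varphi_\beta,K_N\varphi_\alpha\rangle-\langle\varphi_\beta,\langle K_N\rangle\varphi_\alpha\rangle\bigr|^2=0$$ (averages over an empty index set are $0$). -/

import Mathlib

open Filter Topology
open scoped ENNReal

noncomputable section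

namespace SchreierQE

section GroupAlgebra

variable {Γ : Type*} [Group Γ]

/-- The Hilbert space `ℓ²(Γ)`. -/
abbrev EllTwo (Γ : Type*) : Type _ := lp (fun _ : Γ => ℂ) 2

theorem memℓp_translate (g : Γ) (f : EllTwo Γ) : Memℓp (fun v => f (g⁻¹ * v)) 2 := by
  have h := lp.memℓp f
  rw [memℓp_gen_iff (by norm_num)] at h ⊢
  exact h.comp_injective (mul_right_injective g⁻¹)

/-- Left translation `(λ(g) f)(v) = f(g⁻¹ v)`, so that `λ(g) δ_v = δ_{gv}`. -/
def translate (g : Γ) : EllTwo Γ →ₗ[ℂ] EllTwo Γ where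
  toFun f := ⟨fun v => f (g⁻¹ * v), memℓp_translate g f⟩
  map_add' _ _ := rfl
  map_smul' _ _ := rfl

theorem norm_translate (g : Γ) (f : EllTwo Γ) : ‖translate g f‖ = ‖f‖ := by
  have h2 : 0 < (2 : ℝ≥0∞).toReal := by norm_num
  rw [lp.norm_eq_tsum_rpow h2, lp.norm_eq_tsum_rpow h2]
  congr 1
  exact (Equiv.mulLeft g⁻¹).tsum_eq fun v => ‖f v‖ ^ (2 : ℝ≥0∞).toReal

/-- The left regular representation `λ(g)` as a bounded operator on `ℓ²(Γ)`. -/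
def leftReg (g : Γ) : EllTwo Γ →L[ℂ] EllTwo Γ :=
  (translate g).mkContinuous 1 fun f => by rw [norm_translate, one_mul]

/-- `λ(p) = ∑ p_g λ(g)` for `p` in the group algebra `ℂ[Γ]`. -/
def leftRegAlg (p : MonoidAlgebra ℂ Γ) : EllTwo Γ →L[ℂ] EllTwo Γ :=
  ∑ g ∈ p.coeff.support, p.coeff g • leftReg g

/-- The element `1_S = ∑_{g ∈ S} g` of the group algebra. -/
def indicatorElt (S : Finset Γ) : MonoidAlgebra ℂ Γ :=
  ∑ g ∈ S, MonoidAlgebra.single g 1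

/-- The Dirac function `δ_g` in `ℓ²(Γ)`. -/
def delta (g : Γ) : EllTwo Γ := by
  classical exact lp.single 2 g (1 : ℂ)

/-- The matrix entry `Q(x,y) = ⟨δ_x, Q δ_y⟩`. -/
def kernel (Q : EllTwo Γ →L[ℂ] EllTwo Γ) (x y : Γ) : ℂ :=
  inner ℂ (delta x) (Q (delta y))

/-- The resolvent `R^z = (P - z)⁻¹` (meaningful for `z` outside the spectrum of `P`). -/
def resolv (P : EllTwo Γ →L[ℂ] EllTwo Γ) (z : ℂ) : EllTwo Γ →L[ℂ] EllTwo Γ :=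
  Ring.inverse (P - z • ContinuousLinearMap.id ℂ (EllTwo Γ))

/-- `Im R^z = (R^z - (R^z)^*) / (2i)`. -/
def imResolv (P : EllTwo Γ →L[ℂ] EllTwo Γ) (z : ℂ) : EllTwo Γ →L[ℂ] EllTwo Γ :=
  (2 * Complex.I)⁻¹ • (resolv P z - ContinuousLinearMap.adjoint (resolv P z))

/-- The real points of the spectrum (all of the spectrum when `P` is self-adjoint). -/
def realSpectrum (P : EllTwo Γ →L[ℂ] EllTwo Γ) : Set ℝ :=
  {E : ℝ | (E : ℂ) ∈ spectrum ℂ P}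

/-- The absolute continuity condition on `I₀`: uniformly in `E ∈ I₀`, the diagonal entry
`Im R^{E + iη}(e,e)` is bounded above for all `η > 0`, and bounded away from zero for
`0 < η ≤ 1`. (It is at most `1/η`, so a lower bound for all `η > 0` is impossible.) -/
def ACCondition (P : EllTwo Γ →L[ℂ] EllTwo Γ) (I₀ : Set ℝ) : Prop :=
  ∃ C₀ : ℝ, 1 ≤ C₀ ∧ ∀ E ∈ I₀, ∀ η : ℝ, 0 < η →
    (kernel (imResolv P (E + η * Complex.I)) 1 1).re ≤ C₀ ∧
    (η ≤ 1 → C₀⁻¹ ≤ (kernel (imResolv P (E + η * Complex.I)) 1 1).re)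

/-- The word length of `g` with respect to `S`: the least length of a word in
`S ∪ S⁻¹` with product `g`. -/
def wordLength (S : Set Γ) (g : Γ) : ℕ :=
  sInf {n : ℕ | ∃ w : List Γ, w.length = n ∧ (∀ s ∈ w, s ∈ S ∨ s⁻¹ ∈ S) ∧ w.prod = g}

/-- The fourth-moment condition with exponent `C'` on `I₀`:
`sup_{E ∈ I₀} ∑_g η² |(Im R^{E+iη})(e,g)|⁴ |g|^{C'} → 0` as `η → 0⁺`. -/
def FourthMomentCondition (S : Set Γ) (P : EllTwo Γ →L[ℂ] EllTwo Γ) (I₀ : Set ℝ)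
    (C' : ℝ) : Prop :=
  Tendsto (fun η : ℝ => ⨆ E ∈ I₀, ∑' g : Γ, ENNReal.ofReal
      (η ^ 2 * ‖kernel (imResolv P ((E : ℝ) + η * Complex.I)) 1 g‖ ^ 4
        * (wordLength S g : ℝ) ^ C'))
    (𝓝[>] 0) (𝓝 0)

/-- The maximum of one and the diameter of the support of `p` in the left Cayley graph of
`(Γ, S)`, where the distance of `g` and `h` is the word length of `g h⁻¹`. -/
def suppDiam (S : Set Γ) (p : MonoidAlgebra ℂ Γ) : ℕ :=
  max 1 ((p.coeff.support ×ˢ p.coeff.support).sup fun x => wordLength S (x.1 * x.2⁻¹))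

variable (Γ) in
/-- Rapid decay with exponent `C₁`:
`‖λ(p)‖ ≤ C (diam p)^{C₁} ‖p‖₂` for all `p`, for some finite generating set. -/
def RapidDecay (C₁ : ℝ) : Prop :=
  ∃ S : Finset Γ, Subgroup.closure (S : Set Γ) = ⊤ ∧ ∃ C : ℝ, 0 < C ∧
    ∀ p : MonoidAlgebra ℂ Γ,
      ‖leftRegAlg p‖ ≤ C * (suppDiam (S : Set Γ) p : ℝ) ^ C₁ *
        Real.sqrt (∑ g ∈ p.coeff.support, ‖p.coeff g‖ ^ 2)

end GroupAlgebra

section Schreier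

variable {Γ : Type*} [Group Γ]

/-- The permutation matrix of `g`: the entry `(x,y)` is `1` if `x = g.y` and `0` otherwise. -/
def permMat {N : ℕ} (ρ : Γ →* Equiv.Perm (Fin N)) (g : Γ) : Matrix (Fin N) (Fin N) ℂ :=
  Matrix.of fun x y => if x = ρ g y then 1 else 0

/-- `ρ(p) = ∑ p_g ρ(g)`. -/
def permAlg {N : ℕ} (ρ : Γ →* Equiv.Perm (Fin N)) (p : MonoidAlgebra ℂ Γ) :
    Matrix (Fin N) (Fin N) ℂ :=
  ∑ g ∈ p.coeff.support, p.coeff g • permMat ρ g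

/-- Convergence in distribution of permutation representations to the regular
representation: the normalized trace of every `g ≠ e` tends to zero. -/
def ConvergesInDistribution {N : ℕ → ℕ} (ρ : ∀ k, Γ →* Equiv.Perm (Fin (N k))) : Prop :=
  ∀ g : Γ, g ≠ 1 →
    Tendsto (fun k => (permMat (ρ k) g).trace / (N k : ℂ)) atTop (𝓝 0)

/-- `K` is `T`-local: `K(x,y) = 0` unless `x = g.y` for some `g ∈ T`. -/
def IsLocal {N : ℕ} (ρ : Γ →* Equiv.Perm (Fin N)) (T : Finset Γ)
    (K : Matrix (Fin N) (Fin N) ℂ) : Prop :=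
  ∀ x y, (¬ ∃ g ∈ T, x = ρ g y) → K x y = 0

/-- The average `⟨K⟩ = ρ(k)` of a `T`-local matrix, with `k = ∑_{g ∈ T} k_g g` and
`k_g = N⁻¹ ∑_x K(g.x, x)`. -/
def average {N : ℕ} (ρ : Γ →* Equiv.Perm (Fin N)) (T : Finset Γ)
    (K : Matrix (Fin N) (Fin N) ℂ) : Matrix (Fin N) (Fin N) ℂ :=
  permAlg ρ (∑ g ∈ T, MonoidAlgebra.single g ((∑ x, K (ρ g x) x) / (N : ℂ)))

/-- `φ` is a basis of eigenvectors of the matrix `A`, with eigenvalues `ev`. -/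
def IsEigenbasis {N : ℕ} (A : Matrix (Fin N) (Fin N) ℂ)
    (φ : OrthonormalBasis (Fin N) ℂ (EuclideanSpace ℂ (Fin N))) (ev : Fin N → ℝ) : Prop :=
  ∀ α, Matrix.toEuclideanLin A (φ α) = (ev α : ℂ) • φ α

open Classical in
/-- The set `Λ_J` of the indices of the eigenvalues in `J`. -/
def eigIndices {N : ℕ} (ev : Fin N → ℝ) (J : Set ℝ) : Finset (Fin N) :=
  Finset.univ.filter fun α => ev α ∈ J

/-- `|⟨φ_β, K φ_α⟩ - ⟨φ_β, ⟨K⟩ φ_α⟩|²`. -/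
def centeredCorr {N : ℕ} (ρ : Γ →* Equiv.Perm (Fin N)) (T : Finset Γ)
    (φ : OrthonormalBasis (Fin N) ℂ (EuclideanSpace ℂ (Fin N)))
    (K : Matrix (Fin N) (Fin N) ℂ) (β α : Fin N) : ℝ :=
  ‖inner ℂ (φ β) (Matrix.toEuclideanLin K (φ α))
    - inner ℂ (φ β) (Matrix.toEuclideanLin (average ρ T K) (φ α))‖ ^ 2

/-- Quantum ergodicity on `I`. -/
def QuantumErgodic {N : ℕ → ℕ} (ρ : ∀ k, Γ →* Equiv.Perm (Fin (N k))) (T : Finset Γ)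
    (φ : ∀ k, OrthonormalBasis (Fin (N k)) ℂ (EuclideanSpace ℂ (Fin (N k))))
    (ev : ∀ k, Fin (N k) → ℝ) (K : ∀ k, Matrix (Fin (N k)) (Fin (N k)) ℂ)
    (I : Set ℝ) : Prop :=
  Tendsto (fun k => (∑ α ∈ eigIndices (ev k) I, centeredCorr (ρ k) T (φ k) (K k) α α) /
      ((eigIndices (ev k) I).card : ℝ))
    atTop (𝓝 0)

/-- Small-scale quantum weak mixing on `I`: for all `E₁, E₂` in the interior of `I`, the
limit as `η → 0⁺` of the upper limit over the sequence vanishes. (The averages are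
non-negative; they are regarded in `[0,∞]` so that the upper limit always exists.) -/
def QuantumMixing {N : ℕ → ℕ} (ρ : ∀ k, Γ →* Equiv.Perm (Fin (N k))) (T : Finset Γ)
    (φ : ∀ k, OrthonormalBasis (Fin (N k)) ℂ (EuclideanSpace ℂ (Fin (N k))))
    (ev : ∀ k, Fin (N k) → ℝ) (K : ∀ k, Matrix (Fin (N k)) (Fin (N k)) ℂ)
    (I : Set ℝ) : Prop :=
  ∀ E₁ ∈ interior I, ∀ E₂ ∈ interior I,
    Tendsto (fun η : ℝ => limsup (fun k => ENNReal.ofReal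
        ((∑ α ∈ eigIndices (ev k) (Set.Icc (E₁ - η) (E₁ + η)),
            ∑ β ∈ eigIndices (ev k) (Set.Icc (E₂ - η) (E₂ + η)),
              centeredCorr (ρ k) T (φ k) (K k) β α) /
          ((eigIndices (ev k) (Set.Icc (E₁ - η) (E₁ + η))).card : ℝ))) atTop)
      (𝓝[>] 0) (𝓝 0)

end Schreier

section Coxeter

variable {B : Type*}

/-- A Coxeter matrix is right-angled if its off-diagonal entries are `2` or `∞`
(Mathlib encodes `∞` by `0`). -/
def IsRightAngled (M : CoxeterMatrix B) : Prop :=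
  ∀ i j, i ≠ j → M i j = 2 ∨ M i j = 0

/-- The defining diagram: an edge between `i` and `j` when `m_{ij} = 2`, that is, when the
two generators are distinct and commute. -/
def definingDiagram (M : CoxeterMatrix B) : SimpleGraph B where
  Adj i j := M i j = 2
  symm := ⟨fun i j h => by rw [M.symmetric]; exact h⟩
  loopless := ⟨fun i h => by simp at h⟩

/-- Super-flexible diagrams: for all non-commuting `s, t` there are `u` commuting with
neither of them, and an automorphism which either fixes `s` and its neighbours
and exchanges `t` and `u`, or fixes `t` and its neighbours and exchanges `s` and `u`. -/
def SuperFlexible (G : SimpleGraph B) : Prop :=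
  ∀ s t : B, s ≠ t → ¬ G.Adj s t →
    ∃ u : B, u ≠ s ∧ u ≠ t ∧ ¬ G.Adj u s ∧ ¬ G.Adj u t ∧ ∃ φ : G ≃g G,
      (φ s = s ∧ (∀ x, G.Adj s x → φ x = x) ∧ φ t = u ∧ φ u = t) ∨
      (φ t = t ∧ (∀ x, G.Adj t x → φ x = x) ∧ φ s = u ∧ φ u = s)

/-- There are three distinct, pairwise non-adjacent vertices, each of them adjacent to
every other vertex of the diagram. -/
def HasCentralTriple (G : SimpleGraph B) : Prop :=
  ∃ a b c : B, a ≠ b ∧ a ≠ c ∧ b ≠ c ∧ ¬ G.Adj a b ∧ ¬ G.Adj a c ∧ ¬ G.Adj b c ∧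
    ∀ x, x ≠ a → x ≠ b → x ≠ c → G.Adj x a ∧ G.Adj x b ∧ G.Adj x c

/-- The finite set `S ⊂ Γ` of Coxeter generators. -/
def generators [Finite B] {Γ : Type*} [Group Γ] {M : CoxeterMatrix B}
    (cs : CoxeterSystem M Γ) : Finset Γ :=
  (Set.finite_range cs.simple).toFinset

end Coxeter

end SchreierQE

end

open SchreierQE

/-! The three central generators generate a free product of three groups of order two, whose Cayley
graph is the 3-regular tree, and every other generator commutes with them. Hence `P` is the sum of
two commuting elements: the adjacency operator of the tree and the sum of the remaining generators.
Their powers are independent under the trace (`coeff_treeElt_pow_mul_restElt_pow`), so the spectral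
measure of `P` at the identity is the convolution of the Kesten–McKay measure on `[-2√2, 2√2]` with
the spectral measure `μ'` of the rest (`integral_eq_integral_kmIntegral`). The Kesten–McKay density
is bounded and is positive inside its interval. Poisson integrals are therefore bounded everywhere,
and bounded below near every point at distance less than `2√2` from the support of `μ'`. A spectral
point without this property lies at distance exactly `2√2` from that support, at the edge of a gap
of `μ'` of length `4√2`; a bounded spectrum contains finitely many such points
(`exists_exceptional_set`). This gives the set `D` and (AC).

The fourth-moment condition rests on symmetry. The entries `A(e,g)` of an operator commuting with
the commutant of `P` are invariant under the automorphisms of the unlabelled Cayley graph that fix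
the identity. In a super-flexible diagram many such automorphisms exist: a diagram automorphism
fixing the star of `s` can be applied beyond a single wall of type `s`. Each use of it doubles the
orbit, so the orbit of `g` is exponentially large in `|g|` (`exists_large_orbit`), and
square-summability forces exponential decay of the entries (`sq_mul_two_pow_le`). Together with the
bound of the entries of `Im R` by its diagonal, this beats every power of `|g|`.

Both rapid decay and residual finiteness come from the combinatorics of reduced words, which is
derived from an action of the group on piles of pieces. Reduced words of one element are
permutations of each other, so a prefix is determined by its letter counts; there are polynomially
many prefixes, and Cauchy–Schwarz along reduced decompositions gives rapid decay
(`norm_leftRegAlg_le`). The elements with at most `n` occurrences of each letter carry a finite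
action that detects all elements of length at most `n` (`exists_finite_quotient`).

For quantum ergodicity and mixing, let `r₁`, `r₂` be polynomials close to square roots of Poisson
kernels of width `η`, and `b` a centered symbol of `K` along `t`. The correlations between two
spectral windows are controlled by `η²` times the squared Hilbert–Schmidt norm of `r₂(P) ρ(t)
diag(b) r₁(P)`. Up to fixed points of nontrivial elements, of which there are `o(N)`, this norm is
`⟨b, ρ(k) b⟩` for an explicit `k` in the group algebra (`norm_trace_sub_inner_le`). Rapid decay and
exponential decay of coefficients give `‖λ(k)‖ = O(η^{-3/4})` (`exists_norm_twistElt_le`).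
Convergence in distribution transfers this bound to `ρ(k)` outside a subspace of dimension `o(N)`
(`exists_small_subspace`). A pair of windows thus contributes `O(η^{5/4} N)` in the limit, while a
window contains at least a constant times `η N` eigenvalues (`exists_card_lower_bound`); the
quotient tends to zero with `η`. -/

noncomputable section

namespace SchreierQE

/-! ### The word problem in right-angled Coxeter groups, by piles of pieces. -/

section Piles

variable {B : Type*}

open Classical in
/-- Put `s` on a pile: `true` on the stack of `s`, `false` on the stacks of the generators that do
not commute with `s`. -/
def pushPile (M : CoxeterMatrix B) (s : B) (x : B → List Bool) : B → List Bool := fun u =>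
  if u = s then true :: x u else if M s u = 2 then x u else false :: x u

open Classical in
/-- Remove `s` from the top of a pile. -/
def popPile (M : CoxeterMatrix B) (s : B) (x : B → List Bool) : B → List Bool := fun u =>
  if u = s then (x u).tail else if M s u = 2 then x u else (x u).tail

/-- The piles of the words in which no generator is cancelled. -/
inductive IsPile (M : CoxeterMatrix B) : (B → List Bool) → Prop
  | empty : IsPile M fun _ => []
  | push (s : B) (x : B → List Bool) : IsPile M x → (x s).head? ≠ some true →
      IsPile M (pushPile M s x)

theorem popPile_pushPile (M : CoxeterMatrix B) (s : B) (x : B → List Bool) :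
    popPile M s (pushPile M s x) = x := by
  funext u
  simp only [popPile, pushPile]
  split_ifs <;> simp_all

theorem pushPile_comm {M : CoxeterMatrix B} {s t : B} (hst : M s t = 2) (x : B → List Bool) :
    pushPile M s (pushPile M t x) = pushPile M t (pushPile M s x) := by
  have hts : M t s = 2 := by rw [M.symmetric]; exact hst
  have hne : s ≠ t := by rintro rfl; simp at hst
  funext u
  simp only [pushPile]
  by_cases h1 : u = s
  · subst h1; simp [hne, hts]
  · by_cases h2 : u = t
    · subst h2; simp [h1, hst]
    · simp only [h1, h2, if_false]; split_ifs <;> rfl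

theorem pushPile_self (M : CoxeterMatrix B) (s : B) (x : B → List Bool) :
    pushPile M s x s = true :: x s := by simp [pushPile]

theorem pushPile_of_comm {M : CoxeterMatrix B} {s t : B} (hst : M s t = 2) (x : B → List Bool) :
    pushPile M s x t = x t := by
  have hne : t ≠ s := by rintro rfl; simp at hst
  simp [pushPile, hne, hst]

theorem popPile_of_comm {M : CoxeterMatrix B} {s t : B} (hst : M s t = 2) (x : B → List Bool) :
    popPile M s x t = x t := by
  have hne : t ≠ s := by rintro rfl; simp at hst
  simp [popPile, hne, hst]

/-- Pushing `t` puts `false` on every stack of a letter that does not commute with `t`, so a visible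
`true` is either the new one or lies on a stack left untouched. -/
theorem eq_or_comm_of_head_pushPile {M : CoxeterMatrix B} {s t : B} {x : B → List Bool}
    (h : (pushPile M t x s).head? = some true) : s = t ∨ (M t s = 2 ∧ (x s).head? = some true) := by
  simp only [pushPile] at h
  split_ifs at h <;> simp_all

/-- The last letter pushed is either `s` itself or commutes with `s`; in the second case removing
`s` passes below it. The last clause, that no second `s` is exposed, makes `togglePile` an
involution. -/
theorem IsPile.pop {M : CoxeterMatrix B} {s : B} {x : B → List Bool} (hx : IsPile M x)
    (h : (x s).head? = some true) :
    IsPile M (popPile M s x) ∧ pushPile M s (popPile M s x) = x ∧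
      (popPile M s x s).head? ≠ some true := by
  induction hx with
  | empty => simp at h
  | push t y hy hyt ih =>
    rcases eq_or_comm_of_head_pushPile h with rfl | ⟨hts, hys⟩
    · rw [popPile_pushPile]; exact ⟨hy, rfl, hyt⟩
    · have hst : M s t = 2 := by rw [M.symmetric]; exact hts
      obtain ⟨h1, h2, h3⟩ := ih hys
      have key : popPile M s (pushPile M t y) = pushPile M t (popPile M s y) := by
        conv_lhs => rw [← h2, pushPile_comm hts, popPile_pushPile]
      refine ⟨?_, ?_, ?_⟩
      · rw [key]
        exact IsPile.push _ _ h1 (by rwa [popPile_of_comm hst])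
      · rw [key, pushPile_comm hst, h2]
      · rw [key, pushPile_of_comm hts]; exact h3

open Classical in
/-- Multiplication of a pile by a generator. -/
def togglePile (M : CoxeterMatrix B) (s : B) (x : B → List Bool) : B → List Bool :=
  if (x s).head? = some true then popPile M s x else pushPile M s x

theorem IsPile.toggle {M : CoxeterMatrix B} {x : B → List Bool} (hx : IsPile M x) (s : B) :
    IsPile M (togglePile M s x) := by
  unfold togglePile
  split_ifs with h
  · exact (hx.pop h).1
  · exact IsPile.push _ _ hx h

theorem IsPile.toggle_toggle {M : CoxeterMatrix B} {x : B → List Bool} (hx : IsPile M x) (s : B) :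
    togglePile M s (togglePile M s x) = x := by
  by_cases h : (x s).head? = some true
  · have := hx.pop h
    simp only [togglePile, h, if_true, this.2.2, if_false, this.2.1]
  · simp only [togglePile, h, if_false, pushPile_self, List.head?_cons, if_true, popPile_pushPile]

theorem IsPile.toggle_comm {M : CoxeterMatrix B} {x : B → List Bool} (hx : IsPile M x) {s t : B}
    (hst : M s t = 2) :
    togglePile M s (togglePile M t x) = togglePile M t (togglePile M s x) := by
  have hts : M t s = 2 := by rw [M.symmetric]; exact hst
  have pp : ∀ {s t : B} {x : B → List Bool}, IsPile M x → M s t = 2 →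
      (x s).head? = some true →
      popPile M s (pushPile M t x) = pushPile M t (popPile M s x) := by
    intro s t x hx hst h
    conv_lhs => rw [← (hx.pop h).2.1, ← pushPile_comm hst, popPile_pushPile]
  by_cases h1 : (x s).head? = some true <;> by_cases h2 : (x t).head? = some true
  · simp only [togglePile, h1, h2, if_true, popPile_of_comm hst, popPile_of_comm hts]
    have h3 := (hx.pop h1).1.pop (s := t) (by rwa [popPile_of_comm hst])
    conv_lhs => rw [← (hx.pop h1).2.1, ← h3.2.1, pushPile_comm hst, popPile_pushPile,
      popPile_pushPile]
  · simp only [togglePile, h1, h2, if_true, if_false, popPile_of_comm hst, pushPile_of_comm hts]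
    exact pp hx hst h1
  · simp only [togglePile, h1, h2, if_true, if_false, popPile_of_comm hts, pushPile_of_comm hst]
    exact (pp hx hts h2).symm
  · simp only [togglePile, h1, h2, if_false, pushPile_of_comm hst, pushPile_of_comm hts]
    exact pushPile_comm hst x

/-- The permutation of the piles given by a generator. -/
def pilePerm (M : CoxeterMatrix B) (s : B) : Equiv.Perm {x : B → List Bool // IsPile M x} where
  toFun x := ⟨togglePile M s x.1, x.2.toggle s⟩
  invFun x := ⟨togglePile M s x.1, x.2.toggle s⟩
  left_inv x := Subtype.ext (x.2.toggle_toggle s)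
  right_inv x := Subtype.ext (x.2.toggle_toggle s)

/-- Lifting of commuting involutions to a right-angled Coxeter group. -/
theorem isLiftable_of_involutions {M : CoxeterMatrix B} (hM : IsRightAngled M) {G : Type*}
    [Monoid G] (f : B → G) (h1 : ∀ s, f s * f s = 1)
    (h2 : ∀ s t, M s t = 2 → f s * f t = f t * f s) : M.IsLiftable f := by
  intro s t
  by_cases hst : s = t
  · subst hst; simp [h1]
  · rcases hM s t hst with h | h
    · rw [h, pow_two]
      calc f s * f t * (f s * f t) = f s * (f t * f s) * f t := by simp only [mul_assoc]
        _ = f s * (f s * f t) * f t := by rw [h2 s t h]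
        _ = (f s * f s) * (f t * f t) := by simp only [mul_assoc]
        _ = 1 := by rw [h1, h1, one_mul]
    · rw [h, pow_zero]

variable {Γ : Type*} [Group Γ] {M : CoxeterMatrix B} (cs : CoxeterSystem M Γ)

/-- The action of a right-angled Coxeter group on piles. -/
def pileHom (hM : IsRightAngled M) : Γ →* Equiv.Perm {x : B → List Bool // IsPile M x} :=
  cs.lift ⟨pilePerm M, isLiftable_of_involutions hM _
    (fun s => Equiv.ext fun x => Subtype.ext (x.2.toggle_toggle s))
    (fun _ _ hst => Equiv.ext fun x => Subtype.ext (x.2.toggle_comm hst))⟩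

/-- The pile of a group element. -/
def pile (hM : IsRightAngled M) (w : Γ) : B → List Bool :=
  (pileHom cs hM w ⟨fun _ => [], IsPile.empty⟩).1

theorem pile_one (hM : IsRightAngled M) : pile cs hM 1 = fun _ => [] := by
  simp [pile]

theorem pile_simple_mul (hM : IsRightAngled M) (s : B) (w : Γ) :
    pile cs hM (cs.simple s * w) = togglePile M s (pile cs hM w) := by
  simp only [pile, map_mul, pileHom, Equiv.Perm.mul_apply]
  rw [cs.lift_apply_simple]
  rfl

/-- A word whose letters are all pushed when its pile is built. -/
def PileReduced (hM : IsRightAngled M) : List B → Prop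
  | [] => True
  | s :: ω => PileReduced hM ω ∧ (pile cs hM (cs.wordProd ω) s).head? ≠ some true

theorem simple_comm {s t : B} (hst : M s t = 2) :
    cs.simple s * cs.simple t = cs.simple t * cs.simple s := by
  have h := cs.simple_mul_simple_pow s t
  rw [hst, pow_two] at h
  have h' := mul_eq_one_iff_eq_inv.mp h
  rw [h', mul_inv_rev, cs.inv_simple, cs.inv_simple]

theorem simple_comm_wordProd {s : B} {ω : List B} (h : ∀ r ∈ ω, M s r = 2) :
    cs.simple s * cs.wordProd ω = cs.wordProd ω * cs.simple s := by
  induction ω with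
  | nil => simp
  | cons r ω ih =>
    rw [cs.wordProd_cons, ← mul_assoc, simple_comm cs (h r (by simp)), mul_assoc,
      ih fun q hq => h q (by simp [hq]), mul_assoc]

theorem wordProd_of_comm {s : B} {ω₁ ω₂ : List B} (h : ∀ r ∈ ω₁, M s r = 2) :
    cs.wordProd (ω₁ ++ s :: ω₂) = cs.simple s * cs.wordProd (ω₁ ++ ω₂) := by
  rw [cs.wordProd_append, cs.wordProd_cons, cs.wordProd_append, ← mul_assoc, ← mul_assoc,
    simple_comm_wordProd cs h]

variable {cs}

/-- An `s` on top of its stack was pushed by some letter of the word, and every letter pushed later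
must commute with `s`, since otherwise it would cover it. -/
theorem PileReduced.factor {hM : IsRightAngled M} {ω : List B} (hω : PileReduced cs hM ω) {s : B}
    (h : (pile cs hM (cs.wordProd ω) s).head? = some true) :
    ∃ ω₁ ω₂, ω = ω₁ ++ s :: ω₂ ∧ (∀ r ∈ ω₁, M s r = 2) ∧ PileReduced cs hM (ω₁ ++ ω₂) := by
  induction ω with
  | nil => simp [pile_one] at h
  | cons t ω ih =>
    have h0 := h
    rw [cs.wordProd_cons, pile_simple_mul, togglePile, if_neg hω.2] at h
    rcases eq_or_comm_of_head_pushPile h with rfl | ⟨hts, hs⟩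
    · exact ⟨[], ω, rfl, by simp, hω.1⟩
    · have hst : M s t = 2 := by rw [M.symmetric]; exact hts
      obtain ⟨ω₁, ω₂, rfl, h1, h2⟩ := ih hω.1 hs
      refine ⟨t :: ω₁, ω₂, rfl, by simpa [hst] using h1, h2, ?_⟩
      have : cs.wordProd (ω₁ ++ ω₂) = cs.simple s * cs.wordProd (ω₁ ++ s :: ω₂) := by
        rw [wordProd_of_comm cs h1, cs.simple_mul_simple_cancel_left]
      show (pile cs hM (cs.wordProd (ω₁ ++ ω₂)) t).head? ≠ some true
      rw [this, pile_simple_mul, togglePile, if_pos hs, popPile_of_comm hst]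
      exact hω.2

theorem exists_pileReduced (hM : IsRightAngled M) (ω : List B) :
    ∃ ω', PileReduced cs hM ω' ∧ cs.wordProd ω' = cs.wordProd ω ∧ ω'.length ≤ ω.length := by
  induction ω with
  | nil => exact ⟨[], trivial, rfl, le_rfl⟩
  | cons s ω ih =>
    obtain ⟨ω', h1, h2, h3⟩ := ih
    by_cases h : (pile cs hM (cs.wordProd ω') s).head? = some true
    · obtain ⟨ω₁, ω₂, rfl, h4, h5⟩ := h1.factor h
      refine ⟨ω₁ ++ ω₂, h5, ?_, ?_⟩
      · rw [cs.wordProd_cons, ← h2, wordProd_of_comm cs h4, cs.simple_mul_simple_cancel_left]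
      · simp only [List.length_append, List.length_cons] at h3 ⊢; omega
    · exact ⟨s :: ω', ⟨h1, h⟩, by rw [cs.wordProd_cons, cs.wordProd_cons, h2], by simpa using h3⟩

/-- The pile depends only on the group element. The first letter of one word is therefore on top of
the pile of the other, can be moved to its front, and cancels. -/
theorem PileReduced.perm {hM : IsRightAngled M} {ω ω' : List B} (hω : PileReduced cs hM ω)
    (hω' : PileReduced cs hM ω') (h : cs.wordProd ω = cs.wordProd ω') : ω.Perm ω' := by
  induction ω generalizing ω' with
  | nil =>
    cases ω' with
    | nil => exact List.Perm.refl _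
    | cons s ω' =>
      exfalso
      have h1 : (pile cs hM (cs.wordProd (s :: ω')) s).head? = some true := by
        rw [cs.wordProd_cons, pile_simple_mul, togglePile, if_neg hω'.2, pushPile_self]; rfl
      rw [← h] at h1
      simp [pile_one] at h1
  | cons s ω ih =>
    have h1 : (pile cs hM (cs.wordProd (s :: ω)) s).head? = some true := by
      rw [cs.wordProd_cons, pile_simple_mul, togglePile, if_neg hω.2, pushPile_self]; rfl
    rw [h] at h1
    obtain ⟨ω₁, ω₂, rfl, h4, h5⟩ := hω'.factor h1
    rw [wordProd_of_comm cs h4, cs.wordProd_cons] at h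
    exact ((ih hω.1 h5 (mul_left_cancel h)).cons s).trans List.perm_middle.symm

/-- A shortest word can be replaced by a pile-reduced word of no greater length, and pile-reduced
words of one element have equal length. -/
theorem PileReduced.isReduced {hM : IsRightAngled M} {ω : List B} (hω : PileReduced cs hM ω) :
    cs.IsReduced ω := by
  obtain ⟨ω', h1, h2⟩ := cs.exists_isReduced (cs.wordProd ω)
  obtain ⟨ω'', h3, h4, h5⟩ := exists_pileReduced (cs := cs) hM ω'
  have h6 := (hω.perm h3 (by rw [h4, h2])).length_eq
  have h7 : cs.length (cs.wordProd ω) = ω'.length := by rw [h2]; exact h1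
  have h8 := cs.length_wordProd_le ω
  unfold CoxeterSystem.IsReduced
  omega

theorem pileReduced_of_isReduced (hM : IsRightAngled M) {ω : List B} (hω : cs.IsReduced ω) :
    PileReduced cs hM ω := by
  induction ω with
  | nil => trivial
  | cons s ω ih =>
    have h1 := ih (by simpa using hω.drop 1)
    refine ⟨h1, fun h => ?_⟩
    obtain ⟨ω₁, ω₂, rfl, h4, h5⟩ := h1.factor h
    unfold CoxeterSystem.IsReduced at hω
    rw [cs.wordProd_cons, wordProd_of_comm cs h4, cs.simple_mul_simple_cancel_left] at hω
    have := cs.length_wordProd_le (ω₁ ++ ω₂)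
    simp at hω this
    omega

end Piles

/-! ### Reduced words: descents and letter counts. -/

section Words

variable {B : Type*} {Γ : Type*} [Group Γ] {M : CoxeterMatrix B} {cs : CoxeterSystem M Γ}

theorem ne_of_comm {s t : B} (hst : M s t = 2) : s ≠ t := by
  rintro rfl; simp at hst

/-- The left descents of a reduced word in a right-angled Coxeter group are the letters that can be
moved to the front. -/
theorem exists_factor_of_isLeftDescent (hM : IsRightAngled M) {ω : List B}
    (hω : cs.IsReduced ω) {s : B} (hs : cs.IsLeftDescent (cs.wordProd ω) s) :
    ∃ ω₁ ω₂, ω = ω₁ ++ s :: ω₂ ∧ (∀ r ∈ ω₁, M s r = 2) ∧ cs.IsReduced (ω₁ ++ ω₂) := by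
  have h1 := pileReduced_of_isReduced hM hω
  by_cases h : (pile cs hM (cs.wordProd ω) s).head? = some true
  · obtain ⟨ω₁, ω₂, h3, h4, h5⟩ := h1.factor h
    exact ⟨ω₁, ω₂, h3, h4, h5.isReduced⟩
  · exfalso
    have h2 : cs.IsReduced (s :: ω) := PileReduced.isReduced (hM := hM) ⟨h1, h⟩
    unfold CoxeterSystem.IsReduced at h2 hω
    rw [cs.wordProd_cons] at h2
    unfold CoxeterSystem.IsLeftDescent at hs
    simp at h2
    omega

theorem perm_of_isReduced (hM : IsRightAngled M) {ω ω' : List B} (hω : cs.IsReduced ω)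
    (hω' : cs.IsReduced ω') (h : cs.wordProd ω = cs.wordProd ω') : ω.Perm ω' :=
  (pileReduced_of_isReduced hM hω).perm (pileReduced_of_isReduced hM hω') h

variable (cs) in
theorem simple_injective (hM : IsRightAngled M) : Function.Injective cs.simple := by
  intro s t hst
  have h : ∀ i, cs.IsReduced [i] := fun i => by
    simp [CoxeterSystem.IsReduced]
  have := perm_of_isReduced hM (h s) (h t) (by simpa using hst)
  simpa using this

variable (cs) in
/-- A reduced word of a group element. -/
def redWord (w : Γ) : List B := (cs.exists_isReduced w).choose

theorem isReduced_redWord (w : Γ) : cs.IsReduced (redWord cs w) :=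
  (cs.exists_isReduced w).choose_spec.1

@[simp] theorem wordProd_redWord (w : Γ) : cs.wordProd (redWord cs w) = w :=
  (cs.exists_isReduced w).choose_spec.2.symm

theorem length_redWord (w : Γ) : (redWord cs w).length = cs.length w := by
  have := isReduced_redWord (cs := cs) w
  unfold CoxeterSystem.IsReduced at this
  rw [← this, wordProd_redWord]

open Classical in
variable (cs) in
/-- The number of occurrences of a generator in the reduced words of an element. -/
def letterCount (w : Γ) (s : B) : ℕ := (redWord cs w).count s

theorem letterCount_wordProd (hM : IsRightAngled M) {ω : List B} (hω : cs.IsReduced ω) (s : B) :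
    letterCount cs (cs.wordProd ω) s = by classical exact ω.count s := by
  classical
  exact (perm_of_isReduced hM (isReduced_redWord _) hω (wordProd_redWord _)).count_eq s

theorem letterCount_le_length (w : Γ) (s : B) : letterCount cs w s ≤ cs.length w := by
  classical
  rw [← length_redWord (cs := cs) w]
  exact List.count_le_length

theorem isReduced_cons_iff {s : B} {ω : List B} (hω : cs.IsReduced ω) :
    cs.IsReduced (s :: ω) ↔ ¬ cs.IsLeftDescent (cs.wordProd ω) s := by
  rw [cs.not_isLeftDescent_iff]
  unfold CoxeterSystem.IsReduced at *
  rw [cs.wordProd_cons, List.length_cons, hω]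

theorem isReduced_append_iff {ω ω' : List B} (hω : cs.IsReduced ω) (hω' : cs.IsReduced ω') :
    cs.IsReduced (ω ++ ω') ↔ cs.length (cs.wordProd ω * cs.wordProd ω') =
      cs.length (cs.wordProd ω) + cs.length (cs.wordProd ω') := by
  unfold CoxeterSystem.IsReduced at *
  rw [cs.wordProd_append, List.length_append, hω, hω']

theorem letterCount_mul_of_length (hM : IsRightAngled M) {u v : Γ}
    (h : cs.length (u * v) = cs.length u + cs.length v) (s : B) :
    letterCount cs (u * v) s = letterCount cs u s + letterCount cs v s := by
  classical
  have h1 : cs.IsReduced (redWord cs u ++ redWord cs v) := by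
    rw [isReduced_append_iff (isReduced_redWord _) (isReduced_redWord _)]
    simpa using h
  have h2 := letterCount_wordProd hM h1 s
  rw [cs.wordProd_append, wordProd_redWord, wordProd_redWord, List.count_append] at h2
  exact h2

theorem letterCount_simple_ne (hM : IsRightAngled M) {s t : B} (hst : t ≠ s) :
    letterCount cs (cs.simple t) s = 0 := by
  classical
  have h : cs.IsReduced [t] := by simp [CoxeterSystem.IsReduced]
  have := letterCount_wordProd hM h s
  simpa [hst] using this

/-- Whether `t` lengthens or shortens `w`, one of the products `t · w` and `t · (t w)` is reduced,
and counts are additive on it. -/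
theorem letterCount_simple_mul (hM : IsRightAngled M) {s t : B} (hst : t ≠ s) (w : Γ) :
    letterCount cs (cs.simple t * w) s = letterCount cs w s := by
  rcases cs.length_simple_mul w t with h | h
  · rw [letterCount_mul_of_length hM (by rw [h, cs.length_simple, add_comm]),
      letterCount_simple_ne hM hst, zero_add]
  · have : letterCount cs (cs.simple t * (cs.simple t * w)) s =
        letterCount cs (cs.simple t) s + letterCount cs (cs.simple t * w) s :=
      letterCount_mul_of_length hM (by
        rw [cs.simple_mul_simple_cancel_left, cs.length_simple, ← h, add_comm]) s
    rw [cs.simple_mul_simple_cancel_left, letterCount_simple_ne hM hst, zero_add] at this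
    exact this.symm

/-- Distinct left descents commute. -/
theorem comm_of_isLeftDescent (hM : IsRightAngled M) {w : Γ} {s t : B} (hs : cs.IsLeftDescent w s)
    (ht : cs.IsLeftDescent w t) (hst : s ≠ t) : M s t = 2 := by
  have h0 : cs.wordProd (s :: redWord cs (cs.simple s * w)) = w := by
    rw [cs.wordProd_cons, wordProd_redWord, cs.simple_mul_simple_cancel_left]
  have h1 : cs.IsReduced (s :: redWord cs (cs.simple s * w)) := by
    unfold CoxeterSystem.IsReduced
    rw [h0, List.length_cons, length_redWord]
    exact (cs.isLeftDescent_iff.mp hs).symm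
  obtain ⟨ω₁, ω₂, h2, h3, -⟩ := exists_factor_of_isLeftDescent hM h1 (s := t) (by rwa [h0])
  cases ω₁ with
  | nil => simp at h2; exact absurd h2.1 hst
  | cons r ω₁ =>
    simp at h2
    rw [M.symmetric, h2.1]
    exact h3 r (by simp)

/-- A generator that becomes a left descent after multiplication by `r` on the right. -/
theorem comm_of_isLeftDescent_mul_simple (hM : IsRightAngled M) {ω : List B}
    (hω : cs.IsReduced ω) {s r : B} (h1 : ¬ cs.IsLeftDescent (cs.wordProd ω) s)
    (h2 : cs.IsLeftDescent (cs.wordProd ω * cs.simple r) s) : r = s ∧ ∀ q ∈ ω, M s q = 2 := by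
  have desc : ∀ {ω₁ ω₂ : List B}, cs.IsReduced (ω₁ ++ s :: ω₂) → (∀ r ∈ ω₁, M s r = 2) →
      cs.IsLeftDescent (cs.wordProd (ω₁ ++ s :: ω₂)) s := by
    intro ω₁ ω₂ h3 h4
    unfold CoxeterSystem.IsLeftDescent
    rw [h3.eq, wordProd_of_comm cs h4, cs.simple_mul_simple_cancel_left]
    have := cs.length_wordProd_le (ω₁ ++ ω₂)
    simp at this ⊢
    omega
  by_cases hr : cs.IsReduced (ω ++ [r])
  · obtain ⟨ω₁, ω₂, h3, h4, -⟩ := exists_factor_of_isLeftDescent hM hr (s := s)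
      (by rwa [cs.wordProd_append, cs.wordProd_singleton])
    rcases List.eq_nil_or_concat ω₂ with rfl | ⟨ω₃, q, rfl⟩
    · have := List.append_inj' h3 rfl
      simp at this
      exact ⟨this.2, by rw [this.1]; exact h4⟩
    -- If `s` occurred before the last letter, it could already be moved to the front of `ω`.
    · exfalso
      have h5 : ω ++ [r] = (ω₁ ++ s :: ω₃) ++ [q] := by simpa using h3
      have := List.append_inj' h5 rfl
      obtain rfl := this.1
      exact h1 (desc hω h4)
  -- Here `w r` is one letter shorter than `w` and `s w r` two letters shorter, while `s w` is one
  -- longer. The lengths of `s w` and `s w r` would differ by three.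
  · exfalso
    have h3 : cs.IsRightDescent (cs.wordProd ω) r := by
      by_contra h
      rw [cs.not_isRightDescent_iff] at h
      apply hr
      unfold CoxeterSystem.IsReduced at *
      rw [cs.wordProd_append, cs.wordProd_singleton, h, hω]; simp
    rw [cs.isRightDescent_iff] at h3
    rw [cs.isLeftDescent_iff] at h2
    rw [cs.not_isLeftDescent_iff] at h1
    have h4 : cs.length (cs.simple s * cs.wordProd ω) ≤
        cs.length (cs.simple s * (cs.wordProd ω * cs.simple r)) + 1 := by
      have := cs.length_mul_le (cs.simple s * (cs.wordProd ω * cs.simple r)) (cs.simple r)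
      rwa [cs.length_simple, mul_assoc, cs.simple_mul_simple_cancel_right] at this
    omega

end Words

/-! ### Dirac functions and matrix entries on `ℓ²`. -/

section EllTwo

variable {Γ : Type*}

open Classical in
theorem delta_apply (g v : Γ) : (delta g : EllTwo Γ) v = if v = g then 1 else 0 := by
  simp only [delta, lp.single_apply, Pi.single_apply]

theorem norm_delta (g : Γ) : ‖(delta g : EllTwo Γ)‖ = 1 := by
  classical
  simp [delta, lp.norm_single]

theorem inner_delta_left (g : Γ) (f : EllTwo Γ) : inner ℂ (delta g) f = f g := by
  classical
  simp [delta, lp.inner_single_left]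

theorem hasSum_norm_sq (f : EllTwo Γ) : HasSum (fun v => ‖f v‖ ^ 2) (‖f‖ ^ 2) := by
  have h := lp.hasSum_norm (p := 2) (by norm_num) f
  simpa using h

theorem norm_le_of_sum_sq_le (f : EllTwo Γ) {C : ℝ} (hC : 0 ≤ C)
    (h : ∀ s : Finset Γ, ∑ v ∈ s, ‖f v‖ ^ 2 ≤ C ^ 2) : ‖f‖ ≤ C := by
  refine lp.norm_le_of_forall_sum_le (p := 2) (by norm_num) hC fun s => ?_
  simpa using h s

theorem norm_apply_le (f : EllTwo Γ) (v : Γ) : ‖f v‖ ≤ ‖f‖ :=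
  lp.norm_apply_le_norm (by norm_num) f v

theorem kernel_eq (Q : EllTwo Γ →L[ℂ] EllTwo Γ) (x y : Γ) : kernel Q x y = Q (delta y) x :=
  inner_delta_left x _

end EllTwo

/-! ### The left regular representation of the group algebra. -/

section RegularRepresentation

variable {Γ : Type*} [Group Γ]

@[simp] theorem leftReg_apply (g : Γ) (f : EllTwo Γ) (v : Γ) : leftReg g f v = f (g⁻¹ * v) := rfl

theorem norm_leftReg_apply (g : Γ) (f : EllTwo Γ) : ‖leftReg g f‖ = ‖f‖ := norm_translate g f

theorem leftReg_one : leftReg (1 : Γ) = 1 := by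
  ext f v; simp

theorem leftReg_mul (g h : Γ) : leftReg (g * h) = leftReg g * leftReg h := by
  ext f v; simp [mul_assoc]

variable (Γ) in
/-- The left regular representation as a monoid homomorphism. -/
def leftRegMonoidHom : Γ →* (EllTwo Γ →L[ℂ] EllTwo Γ) where
  toFun := leftReg
  map_one' := leftReg_one
  map_mul' := leftReg_mul

variable (Γ) in
/-- The left regular representation as a homomorphism of algebras. -/
def leftRegAlgHom : MonoidAlgebra ℂ Γ →ₐ[ℂ] (EllTwo Γ →L[ℂ] EllTwo Γ) :=
  MonoidAlgebra.lift ℂ _ Γ (leftRegMonoidHom Γ)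

theorem leftRegAlg_eq (p : MonoidAlgebra ℂ Γ) : leftRegAlg p = leftRegAlgHom Γ p := by
  rw [leftRegAlgHom, MonoidAlgebra.lift_apply]
  rfl

theorem leftRegAlg_apply (p : MonoidAlgebra ℂ Γ) (f : EllTwo Γ) (v : Γ) :
    leftRegAlg p f v = ∑ g ∈ p.coeff.support, p.coeff g * f (g⁻¹ * v) := by
  simp only [leftRegAlg, sum_apply, lp.coeFn_sum, Finset.sum_apply,
    smul_apply, lp.coeFn_smul, Pi.smul_apply, leftReg_apply, smul_eq_mul]

theorem leftReg_delta (g h : Γ) : leftReg g (delta h) = delta (g * h) := by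
  classical
  ext v
  simp [delta_apply, inv_mul_eq_iff_eq_mul]

theorem leftRegAlg_delta_apply (p : MonoidAlgebra ℂ Γ) (h v : Γ) :
    leftRegAlg p (delta h) v = p.coeff (v * h⁻¹) := by
  classical
  rw [leftRegAlg_apply]
  simp only [delta_apply, mul_ite, mul_one, mul_zero]
  have : ∀ g, (g⁻¹ * v = h) ↔ (g = v * h⁻¹) := fun g => by
    rw [inv_mul_eq_iff_eq_mul, eq_mul_inv_iff_mul_eq, eq_comm]
  simp only [this, Finset.sum_ite_eq']
  split_ifs with h1
  · rfl
  · exact (Finsupp.notMem_support_iff.mp h1).symm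

theorem leftRegAlg_delta_one_apply (p : MonoidAlgebra ℂ Γ) (v : Γ) :
    leftRegAlg p (delta 1) v = p.coeff v := by
  rw [leftRegAlg_delta_apply, inv_one, mul_one]

theorem adjoint_leftReg (g : Γ) : ContinuousLinearMap.adjoint (leftReg g) = leftReg g⁻¹ := by
  symm
  rw [ContinuousLinearMap.eq_adjoint_iff]
  intro x y
  have hn : ∀ f, ‖(leftReg g : EllTwo Γ →L[ℂ] EllTwo Γ) f‖ = ‖f‖ := norm_leftReg_apply g
  let U : EllTwo Γ →ₗᵢ[ℂ] EllTwo Γ := ⟨(leftReg g).toLinearMap, hn⟩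
  have h1 : inner ℂ (U (leftReg g⁻¹ x)) (U y) = inner ℂ (leftReg g⁻¹ x) y := U.inner_map_map _ _
  rw [← h1]
  congr 1
  ext v
  simp [U]

end RegularRepresentation

/-! ### Reduced products, cancellation and prefixes. -/

section Concatenation

variable {B : Type*} {Γ : Type*} [Group Γ] {M : CoxeterMatrix B} {cs : CoxeterSystem M Γ}

variable (cs) in
/-- The product `u v` is reduced: lengths add. -/
def LenAdd (u v : Γ) : Prop := cs.length (u * v) = cs.length u + cs.length v

theorem lenAdd_one_left (u : Γ) : LenAdd cs 1 u := by simp [LenAdd]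

theorem LenAdd.isReduced {u v : Γ} (h : LenAdd cs u v) :
    cs.IsReduced (redWord cs u ++ redWord cs v) := by
  rw [isReduced_append_iff (isReduced_redWord _) (isReduced_redWord _)]
  simpa [LenAdd] using h

/-- In a reduced triple product the factors can be regrouped. -/
theorem LenAdd.assoc {u v w : Γ} (h1 : LenAdd cs u v) (h2 : LenAdd cs (u * v) w) :
    LenAdd cs v w ∧ LenAdd cs u (v * w) := by
  unfold LenAdd at *
  have h3 := cs.length_mul_le v w
  have h4 := cs.length_mul_le u (v * w)
  rw [mul_assoc] at h2
  constructor <;> omega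

theorem lenAdd_simple_left_iff {s : B} {w : Γ} :
    LenAdd cs (cs.simple s) w ↔ ¬ cs.IsLeftDescent w s := by
  rw [cs.not_isLeftDescent_iff, LenAdd, cs.length_simple, add_comm]

theorem isLeftDescent_of_factor {s : B} {ω₁ ω₂ : List B} (h3 : cs.IsReduced (ω₁ ++ s :: ω₂))
    (h4 : ∀ r ∈ ω₁, M s r = 2) : cs.IsLeftDescent (cs.wordProd (ω₁ ++ s :: ω₂)) s := by
  unfold CoxeterSystem.IsLeftDescent
  rw [h3.eq, wordProd_of_comm cs h4, cs.simple_mul_simple_cancel_left]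
  have := cs.length_wordProd_le (ω₁ ++ ω₂)
  simp at this ⊢
  omega

/-- A left descent of a reduced product is a left descent of the left factor or commutes with it and
is a left descent of the right factor. -/
theorem isLeftDescent_mul (hM : IsRightAngled M) {u v : Γ} (h : LenAdd cs u v) {s : B}
    (hs : cs.IsLeftDescent (u * v) s) :
    cs.IsLeftDescent u s ∨ ((∀ r ∈ redWord cs u, M s r = 2) ∧ cs.IsLeftDescent v s) := by
  obtain ⟨ω₁, ω₂, h1, h2, -⟩ := exists_factor_of_isLeftDescent hM h.isReduced (s := s)
    (by rwa [cs.wordProd_append, wordProd_redWord, wordProd_redWord])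
  rcases List.append_eq_append_iff.mp h1 with ⟨x, hx1, hx2⟩ | ⟨x, hx1, hx2⟩
  · right
    refine ⟨fun r hr => h2 r (by rw [hx1]; simp [hr]), ?_⟩
    have := isLeftDescent_of_factor (cs := cs) (hx2 ▸ isReduced_redWord v)
      (fun r hr => h2 r (by rw [hx1]; simp [hr]))
    rwa [← hx2, wordProd_redWord] at this
  · cases x with
    | nil =>
      right
      simp at hx1 hx2
      refine ⟨fun r hr => h2 r (by rw [← hx1]; exact hr), ?_⟩
      have := isLeftDescent_of_factor (cs := cs) (s := s) (ω₁ := []) (ω₂ := ω₂)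
        (by rw [List.nil_append, hx2]; exact isReduced_redWord v) (by simp)
      rwa [List.nil_append, hx2, wordProd_redWord] at this
    | cons r x =>
      left
      simp at hx2
      obtain ⟨rfl, hx2⟩ := hx2
      have := isLeftDescent_of_factor (cs := cs) (hx1 ▸ isReduced_redWord u) h2
      rwa [← hx1, wordProd_redWord] at this

/-- A non-reduced product admits a cancellation. -/
theorem exists_cancellation (hM : IsRightAngled M) {u v : Γ} (h : ¬ LenAdd cs u v) :
    ∃ s, cs.IsRightDescent u s ∧ cs.IsLeftDescent v s := by
  obtain ⟨ω, hω, rfl⟩ := cs.exists_isReduced u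
  induction ω with
  | nil => exact absurd (by simpa using lenAdd_one_left v) h
  | cons r ω ih =>
    have hω' : cs.IsReduced ω := by simpa using hω.drop 1
    have hl : cs.length (cs.wordProd (r :: ω)) = cs.length (cs.wordProd ω) + 1 := by
      rw [hω.eq, hω'.eq, List.length_cons]
    by_cases h1 : LenAdd cs (cs.wordProd ω) v
    · have h2 : cs.IsLeftDescent (cs.wordProd ω * v) r := by
        by_contra h2
        rw [cs.not_isLeftDescent_iff] at h2
        apply h
        unfold LenAdd at *
        rw [hl, cs.wordProd_cons, mul_assoc, h2, h1]; omega
      rcases isLeftDescent_mul hM h1 h2 with h3 | ⟨h3, h4⟩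
      · exact absurd h3 ((isReduced_cons_iff hω').mp hω)
      -- Since `r` commutes with all letters of `ω`, it is also a right descent of `r ω`, and it
      -- cancels against `v`.
      · refine ⟨r, ?_, h4⟩
        have h5 := simple_comm_wordProd cs h3
        rw [wordProd_redWord] at h5
        unfold CoxeterSystem.IsRightDescent
        rw [hl, cs.wordProd_cons, h5, cs.simple_mul_simple_cancel_right]
        omega
    · obtain ⟨s, h2, h3⟩ := ih hω' h1
      refine ⟨s, ?_, h3⟩
      rw [cs.isRightDescent_iff] at h2
      unfold CoxeterSystem.IsRightDescent
      have := cs.length_mul_le (cs.simple r) (cs.wordProd ω * cs.simple s)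
      rw [cs.length_simple] at this
      rw [hl, cs.wordProd_cons, mul_assoc]
      omega

/-- Every product is `(a c) (c⁻¹ b)` with all of `a c`, `c⁻¹ b`, `a b` reduced. -/
theorem exists_reduced_decomposition (hM : IsRightAngled M) (u v : Γ) :
    ∃ a c b, u = a * c ∧ v = c⁻¹ * b ∧ LenAdd cs a c ∧ LenAdd cs c⁻¹ b ∧ LenAdd cs a b := by
  induction hn : cs.length u generalizing u v with
  | zero =>
    rw [cs.length_eq_zero_iff] at hn
    subst hn
    exact ⟨1, 1, v, by simp, by simp, by simp [LenAdd], by simp [LenAdd], by simp [LenAdd]⟩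
  | succ n ih =>
    by_cases h : LenAdd cs u v
    · exact ⟨u, 1, v, by simp, by simp, by simp [LenAdd], by simp [LenAdd], h⟩
    · obtain ⟨s, h1, h2⟩ := exists_cancellation hM h
      rw [cs.isRightDescent_iff] at h1
      rw [cs.isLeftDescent_iff] at h2
      -- The letter `s` cancelling between `u` and `v` is later absorbed at the end of `c`.
      obtain ⟨a, c, b, e1, e2, h3, h4, h5⟩ := ih (u * cs.simple s) (cs.simple s * v) (by omega)
      have e1' : u = a * (c * cs.simple s) := by
        rw [← mul_assoc, ← e1, cs.simple_mul_simple_cancel_right]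
      have e2' : v = (c * cs.simple s)⁻¹ * b := by
        rw [mul_inv_rev, cs.inv_simple, mul_assoc, ← e2, cs.simple_mul_simple_cancel_left]
      have h6 := cs.length_mul_le c (cs.simple s)
      have h7 := cs.length_mul_le a (c * cs.simple s)
      have h8 := cs.length_mul_le (c * cs.simple s)⁻¹ b
      rw [cs.length_inv] at h8
      rw [cs.length_simple] at h6
      unfold LenAdd at h3 h4
      rw [cs.length_inv] at h4
      refine ⟨a, c * cs.simple s, b, e1', e2', ?_, ?_, h5⟩
      · rw [← e1'] at h7
        rw [← e1] at h3
        unfold LenAdd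
        rw [← e1']; omega
      · rw [← e2'] at h8
        rw [← e2] at h4
        unfold LenAdd
        rw [← e2', cs.length_inv]; omega

/-- A prefix is determined by the numbers of its letters. -/
theorem prefix_ext (hM : IsRightAngled M) {a b a' b' : Γ} (h1 : LenAdd cs a b)
    (h2 : LenAdd cs a' b') (h : a * b = a' * b')
    (hc : ∀ s, letterCount cs a s = letterCount cs a' s) : a = a' := by
  classical
  obtain ⟨ω, hω, rfl⟩ := cs.exists_isReduced a
  induction ω generalizing a' with
  | nil =>
    have : redWord cs a' = [] := by
      rw [List.eq_nil_iff_forall_not_mem]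
      intro s hs
      have := List.count_pos_iff.mpr hs
      have h3 := hc s
      rw [letterCount_wordProd hM hω] at h3
      simp only [List.count_nil] at h3
      unfold letterCount at h3
      omega
    rw [← wordProd_redWord (cs := cs) a', this]
  | cons s ω ih =>
    have hω' : cs.IsReduced ω := by simpa using hω.drop 1
    have d1 : ¬ cs.IsLeftDescent (cs.wordProd ω) s := (isReduced_cons_iff hω').mp hω
    have l1 : LenAdd cs (cs.simple s) (cs.wordProd ω) := lenAdd_simple_left_iff.mpr d1
    have l2 := LenAdd.assoc l1 (w := b) (by rwa [← cs.wordProd_cons])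
    have d2 : cs.IsLeftDescent (a' * b') s := by
      rw [← h, cs.wordProd_cons, mul_assoc]
      unfold CoxeterSystem.IsLeftDescent
      have := l2.2
      unfold LenAdd at this
      rw [this, cs.simple_mul_simple_cancel_left, cs.length_simple]
      omega
    -- The alternative is that `s` commutes with all letters of `a'`. It is impossible, because
    -- equality of the counts puts `s` among these letters.
    have d3 : cs.IsLeftDescent a' s := by
      rcases isLeftDescent_mul hM h2 d2 with h3 | ⟨h3, -⟩
      · exact h3
      · exfalso
        have h4 : s ∈ redWord cs a' := by
          rw [← List.count_pos_iff]
          have h5 := hc s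
          rw [letterCount_wordProd hM hω] at h5
          unfold letterCount at h5
          rw [← h5]; simp
        exact ne_of_comm (h3 s h4) rfl
    have l3 : LenAdd cs (cs.simple s) (cs.simple s * a') := by
      unfold LenAdd
      rw [cs.simple_mul_simple_cancel_left, cs.length_simple]
      have := cs.isLeftDescent_iff.mp d3
      omega
    have l4 := LenAdd.assoc l3 (w := b') (by rwa [cs.simple_mul_simple_cancel_left])
    have := ih l4.1 hω' l2.1 (by
      rw [mul_assoc, ← h, cs.wordProd_cons, mul_assoc, cs.simple_mul_simple_cancel_left])
      (fun r => by
        have h5 := hc r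
        have e1 := letterCount_mul_of_length hM l1 r
        have e2 := letterCount_mul_of_length hM l3 r
        rw [← cs.wordProd_cons] at e1
        rw [cs.simple_mul_simple_cancel_left] at e2
        omega)
    rw [cs.wordProd_cons, this, cs.simple_mul_simple_cancel_left]

variable (cs) in
theorem finite_length_le [Finite B] (d : ℕ) : {w : Γ | cs.length w ≤ d}.Finite := by
  refine ((List.finite_length_le B d).image cs.wordProd).subset fun w hw => ?_
  exact ⟨redWord cs w, by simpa [length_redWord] using hw, wordProd_redWord w⟩

variable (cs) in
/-- The ball of radius `d` around the identity. -/
def lenBall [Finite B] (d : ℕ) : Finset Γ := (finite_length_le cs d).toFinset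

@[simp] theorem mem_lenBall [Finite B] {d : ℕ} {w : Γ} : w ∈ lenBall cs d ↔ cs.length w ≤ d := by
  simp [lenBall]

open Classical in
/-- The number of prefixes of bounded length grows polynomially with the bound. -/
theorem card_prefix_le [Finite B] (hM : IsRightAngled M) (d : ℕ) (w : Γ) :
    ((lenBall cs d).filter fun a => LenAdd cs a (a⁻¹ * w)).card ≤ (d + 1) ^ Nat.card B := by
  have := Fintype.ofFinite B
  -- The reduction modulo `d + 1` in `Fin.ofNat` loses nothing: counts are bounded by the length,
  -- hence by `d`.
  have h : Set.InjOn (fun (a : Γ) (s : B) => (Fin.ofNat (d + 1) (letterCount cs a s)))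
      ((lenBall cs d).filter fun a => LenAdd cs a (a⁻¹ * w)) := by
    intro a ha a' ha' h
    simp only [Finset.coe_filter, mem_lenBall, Set.mem_ofPred_eq] at ha ha'
    refine prefix_ext hM ha.2 ha'.2 (by simp) fun s => ?_
    have h1 := congrArg Fin.val (congrFun h s)
    simp only [Fin.val_ofNat] at h1
    have h2 := letterCount_le_length (cs := cs) a s
    have h3 := letterCount_le_length (cs := cs) a' s
    rwa [Nat.mod_eq_of_lt (by omega), Nat.mod_eq_of_lt (by omega)] at h1
  have h2 := Finset.card_le_card_of_injOn (t := Finset.univ) _ (fun a _ => Finset.mem_univ _) h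
  simpa [Nat.card_eq_fintype_card] using h2

end Concatenation

/-! ### Rapid decay. -/

section RapidDecay

variable {B : Type*} [Finite B] {Γ : Type*} [Group Γ] {M : CoxeterMatrix B}
  {cs : CoxeterSystem M Γ}

open Classical in
/-- A convolution is dominated by a sum over reduced decompositions. -/
theorem convolution_le (hM : IsRightAngled M) (d : ℕ) (f ψ : Γ → ℝ) (hf : ∀ u, 0 ≤ f u)
    (hψ : ∀ u, 0 ≤ ψ u) (s : Finset Γ) (hs : ∀ u ∈ s, cs.length u ≤ d) (w : Γ) :
    ∑ u ∈ s, f u * ψ (u⁻¹ * w) ≤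
      ∑ a ∈ (lenBall cs d).filter fun a => LenAdd cs a (a⁻¹ * w), ∑ c ∈ lenBall cs d,
        (if a * c ∈ s ∧ LenAdd cs a c then f (a * c) else 0) *
          (if LenAdd cs c⁻¹ (a⁻¹ * w) then ψ (c⁻¹ * (a⁻¹ * w)) else 0) := by
  -- In `u · (u⁻¹ w)` the part `C u` cancels, so `A u` is a prefix of `w`. The pair `(A u, C u)`
  -- determines `u`, so distinct terms of the convolution go to distinct pairs.
  choose A C D hA hC h1 h2 h3 using fun u => exists_reduced_decomposition (cs := cs) hM u (u⁻¹ * w)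
  have hD : ∀ u, D u = (A u)⁻¹ * w := fun u => by
    have := hC u
    nth_rewrite 1 [hA u] at this
    rw [mul_inv_rev, mul_assoc] at this
    exact (mul_left_cancel this).symm
  rw [← Finset.sum_product']
  have hinj : Set.InjOn (fun u => (A u, C u)) s := by
    intro u _ u' _ h
    simp only [Prod.mk.injEq] at h
    rw [hA u, hA u', h.1, h.2]
  calc ∑ u ∈ s, f u * ψ (u⁻¹ * w)
      = ∑ u ∈ s, (fun x : Γ × Γ => (if x.1 * x.2 ∈ s ∧ LenAdd cs x.1 x.2 then f (x.1 * x.2) else 0) *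
          (if LenAdd cs x.2⁻¹ (x.1⁻¹ * w) then ψ (x.2⁻¹ * (x.1⁻¹ * w)) else 0)) (A u, C u) := by
        refine Finset.sum_congr rfl fun u hu => ?_
        simp only
        rw [← hA u, ← hD u, if_pos ⟨hu, h1 u⟩, if_pos (h2 u), ← hC u]
    _ = ∑ x ∈ s.image (fun u => (A u, C u)),
          (if x.1 * x.2 ∈ s ∧ LenAdd cs x.1 x.2 then f (x.1 * x.2) else 0) *
          (if LenAdd cs x.2⁻¹ (x.1⁻¹ * w) then ψ (x.2⁻¹ * (x.1⁻¹ * w)) else 0) :=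
        (Finset.sum_image (f := fun x : Γ × Γ =>
          (if x.1 * x.2 ∈ s ∧ LenAdd cs x.1 x.2 then f (x.1 * x.2) else 0) *
          (if LenAdd cs x.2⁻¹ (x.1⁻¹ * w) then ψ (x.2⁻¹ * (x.1⁻¹ * w)) else 0)) hinj).symm
    _ ≤ _ := by
        refine Finset.sum_le_sum_of_subset_of_nonneg ?_ fun x _ _ => ?_
        · intro x hx
          obtain ⟨u, hu, rfl⟩ := Finset.mem_image.mp hx
          have h4 := h1 u
          unfold LenAdd at h4
          rw [← hA u] at h4
          have h5 := hs u hu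
          simp only [Finset.mem_product, Finset.mem_filter, mem_lenBall]
          refine ⟨⟨by omega, ?_⟩, by omega⟩
          rw [← hD u]; exact h3 u
        · refine mul_nonneg ?_ ?_ <;> split_ifs <;> simp [hf, hψ]

open Classical in
/-- Rapid decay for elements supported in a ball. -/
theorem norm_leftRegAlg_le (hM : IsRightAngled M) (d : ℕ) (p : MonoidAlgebra ℂ Γ)
    (hp : ∀ u ∈ p.coeff.support, cs.length u ≤ d) :
    ‖leftRegAlg p‖ ≤ ((d + 1 : ℝ) ^ Nat.card B) ^ 2 *
      Real.sqrt (∑ g ∈ p.coeff.support, ‖p.coeff g‖ ^ 2) := by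
  set n : ℝ := (d + 1 : ℝ) ^ Nat.card B with hn
  have hn1 : 1 ≤ n := one_le_pow₀ (by simp)
  set s := p.coeff.support with hs
  set σ := ∑ g ∈ s, ‖p.coeff g‖ ^ 2 with hσ
  have hσ0 : 0 ≤ σ := Finset.sum_nonneg fun _ _ => by positivity
  have hcard : ∀ w : Γ, (((lenBall cs d).filter fun a => LenAdd cs a (a⁻¹ * w)).card : ℝ) ≤ n := by
    intro w
    rw [hn]
    exact_mod_cast card_prefix_le hM d w
  refine ContinuousLinearMap.opNorm_le_bound _ (by positivity) fun ξ => ?_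
  refine norm_le_of_sum_sq_le _ (by positivity) fun t => ?_
  set X : Γ → Γ → ℝ := fun a c => if a * c ∈ s ∧ LenAdd cs a c then ‖p.coeff (a * c)‖ else 0 with hX
  set Y : Γ → Γ → ℝ := fun c b => if LenAdd cs c⁻¹ b then ‖ξ (c⁻¹ * b)‖ else 0 with hY
  set F : Γ → ℝ := fun a => ∑ c ∈ lenBall cs d, X a c ^ 2 with hF
  have hF0 : ∀ a, 0 ≤ F a := fun a => Finset.sum_nonneg fun _ _ => by positivity
  -- Cauchy–Schwarz twice: over the prefixes `a` of `w`, which costs their number `n`, and over `c`,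
  -- which costs nothing because the two factors are separated.
  have pointwise : ∀ w, ‖leftRegAlg p ξ w‖ ^ 2 ≤
      n * ∑ a ∈ lenBall cs d, F a * ∑ c ∈ lenBall cs d, Y c (a⁻¹ * w) ^ 2 := by
    intro w
    have h1 : ‖leftRegAlg p ξ w‖ ≤
        ∑ a ∈ (lenBall cs d).filter fun a => LenAdd cs a (a⁻¹ * w), ∑ c ∈ lenBall cs d,
          X a c * Y c (a⁻¹ * w) := by
      rw [leftRegAlg_apply]
      refine (norm_sum_le _ _).trans ?_
      simp only [norm_mul]
      exact convolution_le hM d (fun u => ‖p.coeff u‖) (fun u => ‖ξ u‖) (fun _ => norm_nonneg _)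
        (fun _ => norm_nonneg _) s hp w
    calc ‖leftRegAlg p ξ w‖ ^ 2
        ≤ (∑ a ∈ (lenBall cs d).filter fun a => LenAdd cs a (a⁻¹ * w), 1 * ∑ c ∈ lenBall cs d,
          X a c * Y c (a⁻¹ * w)) ^ 2 := by
          simp only [one_mul]
          exact pow_le_pow_left₀ (norm_nonneg _) h1 2
      _ ≤ _ := Finset.sum_mul_sq_le_sq_mul_sq _ _ _
      _ ≤ n * ∑ a ∈ (lenBall cs d).filter fun a => LenAdd cs a (a⁻¹ * w),
          F a * ∑ c ∈ lenBall cs d, Y c (a⁻¹ * w) ^ 2 := by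
          refine mul_le_mul ?_ (Finset.sum_le_sum fun a _ => Finset.sum_mul_sq_le_sq_mul_sq _ _ _)
            (Finset.sum_nonneg fun _ _ => by positivity) (by positivity)
          simpa using hcard w
      _ ≤ _ := by
          refine mul_le_mul_of_nonneg_left ?_ (by positivity)
          refine Finset.sum_le_sum_of_subset_of_nonneg (Finset.filter_subset _ _) fun a _ _ => ?_
          exact mul_nonneg (hF0 a) (Finset.sum_nonneg fun _ _ => by positivity)
  -- Substituting `v = c⁻¹ a⁻¹ w`, each value `‖ξ v‖²` is counted once for every `c` such that `c⁻¹`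
  -- is a prefix of `v`, hence at most `n` times.
  have sumY : ∀ a, ∑ w ∈ t, ∑ c ∈ lenBall cs d, Y c (a⁻¹ * w) ^ 2 ≤ n * ‖ξ‖ ^ 2 := by
    intro a
    set g : Γ → Γ → ℝ := fun c v => if LenAdd cs c⁻¹ (c * v) then ‖ξ v‖ ^ 2 else 0 with hg
    have hg0 : ∀ c v, 0 ≤ g c v := fun c v => by simp only [hg]; split_ifs <;> positivity
    have hsum : Summable fun v => ‖ξ v‖ ^ 2 := (hasSum_norm_sq ξ).summable
    have hgs : ∀ c, Summable (g c) := fun c => hsum.of_nonneg_of_le (hg0 c) fun v => by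
      simp only [hg]; split_ifs <;> simp
    have hYg : ∀ c w, Y c (a⁻¹ * w) ^ 2 = g c (c⁻¹ * a⁻¹ * w) := by
      intro c w
      simp only [hY, hg]
      rw [← mul_assoc, ← mul_assoc, mul_inv_cancel_left]
      split_ifs <;> simp
    rw [Finset.sum_comm]
    calc ∑ c ∈ lenBall cs d, ∑ w ∈ t, Y c (a⁻¹ * w) ^ 2
        ≤ ∑ c ∈ lenBall cs d, ∑' v, g c v := by
          refine Finset.sum_le_sum fun c _ => ?_
          simp only [hYg]
          have e := (Equiv.mulLeft (c⁻¹ * a⁻¹)).tsum_eq (g c)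
          rw [← e]
          have hs' := (Equiv.mulLeft (c⁻¹ * a⁻¹)).summable_iff.mpr (hgs c)
          exact hs'.sum_le_tsum t fun _ _ => hg0 _ _
      _ = ∑' v, ∑ c ∈ lenBall cs d, g c v := (Summable.tsum_finsetSum fun c _ => hgs c).symm
      _ ≤ ∑' v, n * ‖ξ v‖ ^ 2 := by
          refine Summable.tsum_le_tsum (fun v => ?_) (summable_sum fun c _ => hgs c)
            (hsum.mul_left n)
          simp only [hg]
          rw [← Finset.sum_filter, Finset.sum_const, nsmul_eq_mul]
          refine mul_le_mul_of_nonneg_right ?_ (by positivity)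
          refine le_trans ?_ (hcard v)
          norm_cast
          refine Finset.card_le_card_of_injOn (fun c => c⁻¹) (fun c hc => ?_)
            (fun x _ y _ h => inv_injective h)
          simp only [Finset.coe_filter, mem_lenBall, Set.mem_ofPred_eq, cs.length_inv,
            inv_inv] at hc ⊢
          exact hc
      _ = n * ‖ξ‖ ^ 2 := by rw [tsum_mul_left, (hasSum_norm_sq ξ).tsum_eq]
  -- Each coefficient at `u = a c` is counted once for every prefix `a` of `u`.
  have sumF : ∑ a ∈ lenBall cs d, F a ≤ n * σ := by
    calc ∑ a ∈ lenBall cs d, F a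
        ≤ ∑ a ∈ lenBall cs d, ∑ u ∈ s, (if LenAdd cs a (a⁻¹ * u) then ‖p.coeff u‖ ^ 2 else 0) := by
          refine Finset.sum_le_sum fun a _ => ?_
          have e : F a = ∑ u ∈ (lenBall cs d).image (fun c => a * c),
              if u ∈ s ∧ LenAdd cs a (a⁻¹ * u) then ‖p.coeff u‖ ^ 2 else 0 := by
            rw [Finset.sum_image fun x _ y _ h => mul_left_cancel h]
            refine Finset.sum_congr rfl fun c _ => ?_
            simp only [hX, inv_mul_cancel_left]
            split_ifs <;> simp
          rw [e, ← Finset.sum_filter, ← Finset.sum_filter]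
          refine Finset.sum_le_sum_of_subset_of_nonneg (fun u hu => ?_) fun _ _ _ => by positivity
          simp only [Finset.mem_filter] at hu ⊢
          exact hu.2
      _ = ∑ u ∈ s, ∑ a ∈ lenBall cs d, (if LenAdd cs a (a⁻¹ * u) then ‖p.coeff u‖ ^ 2 else 0) :=
          Finset.sum_comm
      _ ≤ ∑ u ∈ s, n * ‖p.coeff u‖ ^ 2 := by
          refine Finset.sum_le_sum fun u _ => ?_
          rw [← Finset.sum_filter, Finset.sum_const, nsmul_eq_mul]
          exact mul_le_mul_of_nonneg_right (hcard u) (by positivity)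
      _ = n * σ := by rw [← Finset.mul_sum]
  calc ∑ w ∈ t, ‖leftRegAlg p ξ w‖ ^ 2
      ≤ ∑ w ∈ t, n * ∑ a ∈ lenBall cs d, F a * ∑ c ∈ lenBall cs d, Y c (a⁻¹ * w) ^ 2 :=
        Finset.sum_le_sum fun w _ => pointwise w
    _ = n * ∑ a ∈ lenBall cs d, F a * ∑ w ∈ t, ∑ c ∈ lenBall cs d, Y c (a⁻¹ * w) ^ 2 := by
        rw [← Finset.mul_sum, Finset.sum_comm]
        simp only [Finset.mul_sum]
    _ ≤ n * ∑ a ∈ lenBall cs d, F a * (n * ‖ξ‖ ^ 2) := by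
        gcongr with a ha
        exact sumY a
    _ = n * (n * ‖ξ‖ ^ 2) * ∑ a ∈ lenBall cs d, F a := by rw [← Finset.sum_mul]; ring
    _ ≤ n * (n * ‖ξ‖ ^ 2) * (n * σ) := by gcongr
    _ = n ^ 3 * (σ * ‖ξ‖ ^ 2) := by ring
    _ ≤ n ^ 4 * (σ * ‖ξ‖ ^ 2) := by
        gcongr
        norm_num
    _ = (n ^ 2 * Real.sqrt σ * ‖ξ‖) ^ 2 := by
        rw [mul_pow, mul_pow, Real.sq_sqrt hσ0]; ring

theorem wordLength_generators (g : Γ) :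
    wordLength (generators cs : Set Γ) g = cs.length g := by
  have hmem : ∀ w : Γ, w ∈ (generators cs : Set Γ) ↔ ∃ i, cs.simple i = w := by
    intro w; simp [generators]
  have h2 : cs.length g ∈ {n : ℕ | ∃ w : List Γ, w.length = n ∧
      (∀ s ∈ w, s ∈ (generators cs : Set Γ) ∨ s⁻¹ ∈ (generators cs : Set Γ)) ∧ w.prod = g} := by
    refine ⟨(redWord cs g).map cs.simple, by simp [length_redWord], ?_, wordProd_redWord g⟩
    intro s hs
    obtain ⟨i, _, rfl⟩ := List.mem_map.mp hs
    exact Or.inl ((hmem _).mpr ⟨i, rfl⟩)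
  refine le_antisymm (Nat.sInf_le h2) ?_
  obtain ⟨w, h3, h4, h5⟩ := Nat.sInf_mem ⟨_, h2⟩
  unfold wordLength
  rw [← h3]
  have : ∃ ω : List B, ω.map cs.simple = w := by
    clear h3 h5
    induction w with
    | nil => exact ⟨[], rfl⟩
    | cons s w ih =>
      obtain ⟨ω, rfl⟩ := ih fun r hr => h4 r (by simp [hr])
      rcases h4 s (by simp) with h | h
      · obtain ⟨i, rfl⟩ := (hmem _).mp h
        exact ⟨i :: ω, rfl⟩
      · obtain ⟨i, hi⟩ := (hmem _).mp h
        refine ⟨i :: ω, ?_⟩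
        rw [List.map_cons, ← cs.inv_simple, hi, inv_inv]
  obtain ⟨ω, rfl⟩ := this
  rw [← h5, List.length_map]
  exact cs.length_wordProd_le ω

open Classical in
theorem coeff_mul_single_one (p : MonoidAlgebra ℂ Γ) (h v : Γ) :
    (p * MonoidAlgebra.single h 1).coeff v = p.coeff (v * h⁻¹) := by
  rw [← leftRegAlg_delta_one_apply, leftRegAlg_eq, map_mul, ← leftRegAlg_eq, ← leftRegAlg_eq]
  have : leftRegAlg (MonoidAlgebra.single h (1 : ℂ)) = leftReg h := by
    rw [leftRegAlg_eq, leftRegAlgHom, MonoidAlgebra.lift_single, one_smul]; rfl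
  rw [this, mul_apply_eq_comp, leftReg_delta, mul_one, leftRegAlg_delta_apply]

/-- Right-angled Coxeter groups have rapid decay. -/
theorem rapidDecay_of_isRightAngled (cs : CoxeterSystem M Γ) (hM : IsRightAngled M) :
    ∃ C₁ : ℝ, 0 < C₁ ∧ RapidDecay Γ C₁ := by
  classical
  -- The exponent `2|B|` would suffice; the extra one makes it positive even when there are no
  -- generators. The powers of two absorb `d + 1 ≤ 2 d`.
  refine ⟨(2 * Nat.card B + 1 : ℕ), by positivity, generators cs, ?_, 2 ^ (2 * Nat.card B + 1),
    by positivity, fun p => ?_⟩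
  · rw [generators, Set.Finite.coe_toFinset]
    exact cs.subgroup_closure_range_simple
  rw [Real.rpow_natCast]
  set d := suppDiam (generators cs : Set Γ) p with hd
  have hd1 : 1 ≤ d := le_max_left _ _
  by_cases hp : p.coeff.support = ∅
  · have : leftRegAlg p = 0 := by simp [leftRegAlg, hp]
    rw [this, norm_zero]
    positivity
  · obtain ⟨h, hh⟩ := Finset.nonempty_iff_ne_empty.mpr hp
    -- A right translation carries a support of diameter `d` into the ball of radius `d` and changes
    -- neither the operator norm nor the `ℓ²` norm.
    set q := p * MonoidAlgebra.single h⁻¹ 1 with hq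
    have hqc : ∀ v, q.coeff v = p.coeff (v * h) := fun v => by
      rw [hq, coeff_mul_single_one, inv_inv]
    have hqs : q.coeff.support = p.coeff.support.image (fun g => g * h⁻¹) := by
      ext v
      simp only [Finsupp.mem_support_iff, hqc, Finset.mem_image]
      constructor
      · intro hv; exact ⟨v * h, hv, by simp⟩
      · rintro ⟨g, hg, rfl⟩; simpa using hg
    have hlen : ∀ u ∈ q.coeff.support, cs.length u ≤ d := by
      intro u hu
      rw [hqs] at hu
      obtain ⟨g, hg, rfl⟩ := Finset.mem_image.mp hu
      rw [← wordLength_generators]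
      refine le_trans ?_ (le_max_right _ _)
      exact Finset.le_sup (f := fun x : Γ × Γ => wordLength (generators cs : Set Γ) (x.1 * x.2⁻¹))
        (b := (g, h)) (Finset.mk_mem_product hg hh)
    have h1 := norm_leftRegAlg_le hM d q hlen
    have h2 : ‖leftRegAlg p‖ ≤ ‖leftRegAlg q‖ := by
      have e : leftRegAlg p = leftRegAlg q * leftReg h := by
        have e1 : leftReg h = leftRegAlg (MonoidAlgebra.single h (1 : ℂ)) := by
          rw [leftRegAlg_eq, leftRegAlgHom, MonoidAlgebra.lift_single, one_smul]; rfl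
        rw [e1, leftRegAlg_eq, leftRegAlg_eq, leftRegAlg_eq, ← map_mul, hq, mul_assoc,
          MonoidAlgebra.single_mul_single, inv_mul_cancel, one_mul, ← MonoidAlgebra.one_def,
          mul_one]
      rw [e]
      refine (norm_mul_le _ _).trans ?_
      have : ‖(leftReg h : EllTwo Γ →L[ℂ] EllTwo Γ)‖ ≤ 1 :=
        ContinuousLinearMap.opNorm_le_bound _ zero_le_one fun f => by
          rw [norm_leftReg_apply, one_mul]
      exact mul_le_of_le_one_right (norm_nonneg _) this
    have h3 : ∑ g ∈ q.coeff.support, ‖q.coeff g‖ ^ 2 = ∑ g ∈ p.coeff.support, ‖p.coeff g‖ ^ 2 := by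
      rw [hqs, Finset.sum_image fun x _ y _ h => mul_right_cancel h]
      exact Finset.sum_congr rfl fun g _ => by rw [hqc]; simp
    rw [h3] at h1
    refine h2.trans (h1.trans ?_)
    refine mul_le_mul_of_nonneg_right ?_ (Real.sqrt_nonneg _)
    rw [← mul_pow, ← pow_mul, mul_comm (Nat.card B) 2]
    have h5 : (1 : ℝ) ≤ d := by exact_mod_cast hd1
    calc (d + 1 : ℝ) ^ (2 * Nat.card B) ≤ (2 * d : ℝ) ^ (2 * Nat.card B) := by gcongr; linarith
      _ ≤ (2 * d : ℝ) ^ (2 * Nat.card B + 1) := by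
          gcongr
          · linarith
          · omega

end RapidDecay

/-! ### Residual finiteness and permutation representations. -/

section ResidualFiniteness

variable {B : Type*} {Γ : Type*} [Group Γ] {M : CoxeterMatrix B} {cs : CoxeterSystem M Γ}

variable (cs) in
/-- The elements in which every letter occurs at most `n` times. -/
abbrev CountBox (n : ℕ) : Type _ := {w : Γ // ∀ s, letterCount cs w s ≤ n}

theorem finite_countBox [Finite B] (n : ℕ) : Finite (CountBox cs n) := by
  classical
  have := Fintype.ofFinite B
  refine ((finite_length_le cs (Fintype.card B * n)).subset fun w hw => ?_).to_subtype
  show cs.length w ≤ _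
  rw [← length_redWord (cs := cs) w]
  have h := Multiset.sum_count_eq_card (s := Finset.univ) (m := (redWord cs w : Multiset B))
    (fun _ _ => Finset.mem_univ _)
  simp only [Multiset.coe_count, Multiset.coe_card] at h
  rw [← h]
  calc ∑ s, (redWord cs w).count s ≤ ∑ _s : B, n := Finset.sum_le_sum fun s _ => hw s
    _ = Fintype.card B * n := by simp

open Classical in
variable (cs) in
/-- Multiplication by a generator, unless it leads out of the box. -/
def boxStep (hM : IsRightAngled M) (n : ℕ) (s : B) (w : CountBox cs n) : CountBox cs n :=
  if h : letterCount cs (cs.simple s * w.1) s ≤ n then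
    ⟨cs.simple s * w.1, fun t => by
      by_cases hst : s = t
      · subst hst; exact h
      · rw [letterCount_simple_mul hM hst]; exact w.2 t⟩
  else w

open Classical in
theorem boxStep_val (hM : IsRightAngled M) (n : ℕ) (s : B) (w : CountBox cs n) :
    (boxStep cs hM n s w).1 =
      if letterCount cs (cs.simple s * w.1) s ≤ n then cs.simple s * w.1 else w.1 := by
  unfold boxStep
  split_ifs <;> rfl

theorem boxStep_boxStep (hM : IsRightAngled M) (n : ℕ) (s : B) (w : CountBox cs n) :
    boxStep cs hM n s (boxStep cs hM n s w) = w := by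
  apply Subtype.ext
  rw [boxStep_val, boxStep_val]
  by_cases h : letterCount cs (cs.simple s * w.1) s ≤ n
  · simp only [h, if_true, cs.simple_mul_simple_cancel_left, w.2 s]
  · simp only [h, if_false]

/-- Whether the step along `s` is blocked depends on the number of letters `s` alone, which a step
along `t` does not change. -/
theorem boxStep_comm (hM : IsRightAngled M) (n : ℕ) {s t : B} (hst : M s t = 2)
    (w : CountBox cs n) :
    boxStep cs hM n s (boxStep cs hM n t w) = boxStep cs hM n t (boxStep cs hM n s w) := by
  have hne := ne_of_comm hst
  have e : cs.simple s * (cs.simple t * w.1) = cs.simple t * (cs.simple s * w.1) := by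
    rw [← mul_assoc, simple_comm cs hst, mul_assoc]
  have h1 : letterCount cs (cs.simple s * (cs.simple t * w.1)) s =
      letterCount cs (cs.simple s * w.1) s := by rw [e, letterCount_simple_mul hM hne.symm]
  have h2 : letterCount cs (cs.simple t * (cs.simple s * w.1)) t =
      letterCount cs (cs.simple t * w.1) t := by rw [← e, letterCount_simple_mul hM hne]
  apply Subtype.ext
  simp only [boxStep_val]
  rw [e] at h1
  by_cases hs : letterCount cs (cs.simple s * w.1) s ≤ n <;>
    by_cases ht : letterCount cs (cs.simple t * w.1) t ≤ n <;>
    simp only [hs, ht, h1, h2, e, if_true, if_false]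

variable (cs) in
/-- The action of a right-angled Coxeter group on a box. -/
def boxHom (hM : IsRightAngled M) (n : ℕ) : Γ →* Equiv.Perm (CountBox cs n) :=
  cs.lift ⟨fun s => ⟨boxStep cs hM n s, boxStep cs hM n s, boxStep_boxStep hM n s,
      boxStep_boxStep hM n s⟩,
    isLiftable_of_involutions hM _ (fun s => Equiv.ext (boxStep_boxStep hM n s))
      (fun _ _ hst => Equiv.ext (boxStep_comm hM n hst))⟩

/-- A walk from the identity along a word of length at most `n` is never blocked, so elements of
that length act as distinctly as they do on the group. -/
theorem boxHom_apply_one (hM : IsRightAngled M) (n : ℕ) (ω : List B) (hω : cs.IsReduced ω)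
    (hn : ω.length ≤ n) :
    (boxHom cs hM n (cs.wordProd ω) ⟨1, fun s => by
      have := letterCount_le_length (cs := cs) 1 s
      simp at this; omega⟩).1 = cs.wordProd ω := by
  induction ω with
  | nil => rw [cs.wordProd_nil, map_one]; rfl
  | cons s ω ih =>
    have ih' := ih (by simpa using hω.drop 1) (by simp at hn; omega)
    rw [cs.wordProd_cons, map_mul, Equiv.Perm.mul_apply]
    conv_lhs => rw [boxHom]
    rw [cs.lift_apply_simple]
    show (boxStep cs hM n s _).1 = _
    rw [boxStep_val, ← boxHom, ih', if_pos]
    rw [← cs.wordProd_cons]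
    exact (letterCount_le_length _ _).trans (hω.eq ▸ hn)

/-- Right-angled Coxeter groups are residually finite. -/
theorem exists_finite_quotient [Finite B] (cs : CoxeterSystem M Γ) (hM : IsRightAngled M) (n : ℕ) :
    ∃ (q : ℕ) (ρ : Γ →* Equiv.Perm (Fin q)), 0 < q ∧
      ∀ g : Γ, g ≠ 1 → cs.length g ≤ n → ∀ x, ρ g x ≠ x := by
  have := finite_countBox (cs := cs) n
  let f := boxHom cs hM n
  let Q := f.range
  have : Finite (Equiv.Perm (CountBox cs n)) := inferInstance
  have : Finite Q := inferInstance
  obtain ⟨q, ⟨e⟩⟩ := Finite.exists_equiv_fin Q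
  have hq : 0 < q := Fin.pos_iff_nonempty.mpr ⟨e 1⟩
  -- The finite image is made to act on itself by translations: an element with nontrivial image
  -- then has no fixed point at all.
  refine ⟨q, e.permCongrHom.toMonoidHom.comp ((MulAction.toPermHom Q Q).comp f.rangeRestrict), hq,
    fun g hg hgn x hx => ?_⟩
  have h1 : e ((f.rangeRestrict g) * e.symm x) = x := hx
  have h2 : f.rangeRestrict g * e.symm x = e.symm x := by
    rw [← e.symm_apply_apply (f.rangeRestrict g * e.symm x), h1]
  have h3 : f.rangeRestrict g = 1 := mul_eq_right.mp h2
  have h4 : f g = 1 := congrArg Subtype.val h3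
  have h5 := boxHom_apply_one hM n (redWord cs g) (isReduced_redWord g)
    (by rwa [length_redWord])
  rw [wordProd_redWord] at h5
  change (f g _).1 = g at h5
  rw [h4] at h5
  exact hg h5.symm

theorem trace_permMat {N : ℕ} (ρ : Γ →* Equiv.Perm (Fin N)) (g : Γ) :
    (permMat ρ g).trace = by classical exact
      ((Finset.univ.filter fun x => ρ g x = x).card : ℂ) := by
  classical
  simp [permMat, Matrix.trace, Finset.sum_boole, eq_comm]

/-- The `k`-th action is `m k` copies of a finite action in which nontrivial elements of length at
most `k` have no fixed points, so each trace is eventually zero. The multiplicity satisfies `m (k +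
1) = 2 (q k * m k)`, which makes the degrees strictly increasing. -/
theorem exists_convergesInDistribution [Finite B] (cs : CoxeterSystem M Γ) (hM : IsRightAngled M) :
    ∃ (N : ℕ → ℕ) (ρ : ∀ k, Γ →* Equiv.Perm (Fin (N k))),
      StrictMono N ∧ ConvergesInDistribution ρ := by
  choose q ρ hq hρ using exists_finite_quotient cs hM
  let m : ℕ → ℕ := fun k => 2 ^ k * ∏ j ∈ Finset.range k, q j
  have hm : ∀ k, 0 < m k := fun k =>
    Nat.mul_pos (by positivity) (Finset.prod_pos fun j _ => hq j)
  let E : ∀ k, Fin (q k) × Fin (m k) ≃ Fin (q k * m k) := fun k => finProdFinEquiv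
  let τ : ∀ k, Γ →* Equiv.Perm (Fin (q k * m k)) := fun k =>
    { toFun := fun g => (E k).permCongr (Equiv.prodCongr (ρ k g) (Equiv.refl _))
      map_one' := by ext x; simp
      map_mul' := fun g h => by ext x; simp [Prod.map] }
  refine ⟨fun k => q k * m k, τ, strictMono_nat_of_lt_succ fun k => ?_, fun g hg => ?_⟩
  · have h1 : m (k + 1) = 2 * (q k * m k) := by
      simp only [m, Finset.prod_range_succ, pow_succ]; ring
    have h2 := Nat.mul_pos (hq k) (hm k)
    have h3 := Nat.le_mul_of_pos_left (m (k + 1)) (hq (k + 1))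
    show q k * m k < q (k + 1) * m (k + 1)
    omega
  · refine tendsto_const_nhds.congr' ?_
    filter_upwards [eventually_ge_atTop (cs.length g)] with k hk
    have : (permMat (τ k) g).trace = 0 := by
      rw [trace_permMat]
      norm_cast
      rw [Finset.card_eq_zero, Finset.filter_eq_empty_iff]
      intro x _ hx
      have h1 : E k (ρ k g ((E k).symm x).1, ((E k).symm x).2) = x := hx
      have h2 : (ρ k g ((E k).symm x).1, ((E k).symm x).2) = (E k).symm x := by
        rw [Equiv.eq_symm_apply, h1]
      exact hρ k g hg hk _ (congrArg Prod.fst h2)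
    rw [this, zero_div]

end ResidualFiniteness

/-! ### Automorphisms of the unlabelled Cayley graph and exponential decay of invariant functions.
-/

section CayleyAutomorphisms

variable {B : Type*} {Γ : Type*} [Group Γ] {M : CoxeterMatrix B} {cs : CoxeterSystem M Γ}

variable (cs) in
/-- The automorphisms of the (unlabelled) Cayley graph that fix the identity. -/
def cayleyStab : Subgroup (Equiv.Perm Γ) where
  carrier := {F | F 1 = 1 ∧ ∀ v, ∃ π : Equiv.Perm B, ∀ s, F (cs.simple s * v) = cs.simple (π s) * F v}
  one_mem' := ⟨rfl, fun _ => ⟨1, fun _ => rfl⟩⟩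
  mul_mem' := by
    rintro F G ⟨hF1, hF⟩ ⟨hG1, hG⟩
    refine ⟨by simp [hF1, hG1], fun v => ?_⟩
    obtain ⟨π, hπ⟩ := hG v
    obtain ⟨π', hπ'⟩ := hF (G v)
    exact ⟨π' * π, fun s => by simp [hπ, hπ']⟩
  inv_mem' := by
    rintro F ⟨hF1, hF⟩
    refine ⟨by rw [Equiv.Perm.inv_eq_iff_eq, hF1], fun v => ?_⟩
    obtain ⟨π, hπ⟩ := hF (F⁻¹ v)
    refine ⟨π⁻¹, fun s => ?_⟩
    rw [Equiv.Perm.inv_eq_iff_eq, hπ]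
    simp

/-- Paths from the identity are mapped to paths from the identity. -/
theorem length_le_of_mem_cayleyStab {F : Equiv.Perm Γ} (hF : F ∈ cayleyStab cs) (v : Γ) :
    cs.length (F v) ≤ cs.length v := by
  obtain ⟨ω, hω, rfl⟩ := cs.exists_isReduced v
  rw [hω.eq]
  clear hω
  induction ω with
  | nil => simp [hF.1]
  | cons s ω ih =>
    obtain ⟨π, hπ⟩ := hF.2 (cs.wordProd ω)
    rw [cs.wordProd_cons, hπ, List.length_cons]
    have := cs.length_mul_le (cs.simple (π s)) (F (cs.wordProd ω))
    rw [cs.length_simple] at this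
    omega

theorem length_of_mem_cayleyStab {F : Equiv.Perm Γ} (hF : F ∈ cayleyStab cs) (v : Γ) :
    cs.length (F v) = cs.length v := by
  refine le_antisymm (length_le_of_mem_cayleyStab hF v) ?_
  have := length_le_of_mem_cayleyStab ((cayleyStab cs).inv_mem hF) (F v)
  rwa [show F⁻¹ (F v) = v from F.symm_apply_apply v] at this

variable (cs) in
/-- The endomorphism induced by an automorphism of the diagram. -/
def diagramHom (hM : IsRightAngled M) (φ : definingDiagram M ≃g definingDiagram M) : Γ →* Γ :=
  cs.lift ⟨fun s => cs.simple (φ s), isLiftable_of_involutions hM _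
    (fun _ => cs.simple_mul_simple_self _)
    (fun _ _ hst => simple_comm cs (φ.map_adj_iff.mpr hst))⟩

theorem diagramHom_simple (hM : IsRightAngled M) (φ : definingDiagram M ≃g definingDiagram M)
    (s : B) : diagramHom cs hM φ (cs.simple s) = cs.simple (φ s) := by
  rw [diagramHom, cs.lift_apply_simple]

theorem diagramHom_wordProd (hM : IsRightAngled M) (φ : definingDiagram M ≃g definingDiagram M)
    (ω : List B) : diagramHom cs hM φ (cs.wordProd ω) = cs.wordProd (ω.map φ) := by
  induction ω with
  | nil => simp
  | cons s ω ih => rw [cs.wordProd_cons, map_mul, ih, diagramHom_simple, List.map_cons,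
      cs.wordProd_cons]

theorem diagramHom_symm_apply (hM : IsRightAngled M) (φ : definingDiagram M ≃g definingDiagram M)
    (w : Γ) : diagramHom cs hM φ.symm (diagramHom cs hM φ w) = w := by
  rw [← wordProd_redWord (cs := cs) w, diagramHom_wordProd, diagramHom_wordProd, List.map_map]
  congr 1
  exact (List.map_congr_left fun s _ => φ.symm_apply_apply s).trans (List.map_id _)

theorem length_diagramHom_le (hM : IsRightAngled M) (φ : definingDiagram M ≃g definingDiagram M)
    (w : Γ) : cs.length (diagramHom cs hM φ w) ≤ cs.length w := by
  conv_lhs => rw [← wordProd_redWord (cs := cs) w, diagramHom_wordProd]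
  refine (cs.length_wordProd_le _).trans ?_
  rw [List.length_map, length_redWord]

theorem length_diagramHom (hM : IsRightAngled M) (φ : definingDiagram M ≃g definingDiagram M)
    (w : Γ) : cs.length (diagramHom cs hM φ w) = cs.length w := by
  refine le_antisymm (length_diagramHom_le hM φ w) ?_
  have := length_diagramHom_le (cs := cs) hM φ.symm (diagramHom cs hM φ w)
  rwa [diagramHom_symm_apply] at this

/-- A diagram automorphism which fixes `s` and its neighbours. -/
def FixesStar (s : B) (φ : definingDiagram M ≃g definingDiagram M) : Prop :=
  φ s = s ∧ ∀ x, (definingDiagram M).Adj s x → φ x = x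

theorem FixesStar.symm {s : B} {φ : definingDiagram M ≃g definingDiagram M} (h : FixesStar s φ) :
    FixesStar s φ.symm :=
  ⟨by conv_lhs => rw [← h.1, φ.symm_apply_apply],
   fun x hx => by conv_lhs => rw [← h.2 x hx, φ.symm_apply_apply]⟩

theorem isRightDescent_diagramHom (hM : IsRightAngled M) {s : B}
    {φ : definingDiagram M ≃g definingDiagram M} (h : φ s = s) {w : Γ}
    (hw : cs.IsRightDescent w s) : cs.IsRightDescent (diagramHom cs hM φ w) s := by
  have e : diagramHom cs hM φ w * cs.simple s = diagramHom cs hM φ (w * cs.simple s) := by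
    rw [map_mul, diagramHom_simple, h]
  unfold CoxeterSystem.IsRightDescent at *
  rwa [e, length_diagramHom, length_diagramHom]

open Classical in
/-- Apply `φ` beyond the wall crossed between `w` and `s w`. -/
def wallMap (cs : CoxeterSystem M Γ) (hM : IsRightAngled M) (s : B) (w : Γ)
    (φ : definingDiagram M ≃g definingDiagram M) (v : Γ) : Γ :=
  if cs.IsRightDescent (v * w⁻¹) s then diagramHom cs hM φ (v * w⁻¹) * w else v

theorem wallMap_pos (hM : IsRightAngled M) {s : B} {w v : Γ}
    (φ : definingDiagram M ≃g definingDiagram M) (h : cs.IsRightDescent (v * w⁻¹) s) :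
    wallMap cs hM s w φ v = diagramHom cs hM φ (v * w⁻¹) * w := if_pos h

theorem wallMap_neg (hM : IsRightAngled M) {s : B} {w v : Γ}
    (φ : definingDiagram M ≃g definingDiagram M) (h : ¬ cs.IsRightDescent (v * w⁻¹) s) :
    wallMap cs hM s w φ v = v := if_neg h

theorem wallMap_symm_wallMap (hM : IsRightAngled M) {s : B} (w : Γ)
    {φ : definingDiagram M ≃g definingDiagram M} (h : FixesStar s φ) (v : Γ) :
    wallMap cs hM s w φ.symm (wallMap cs hM s w φ v) = v := by
  by_cases h1 : cs.IsRightDescent (v * w⁻¹) s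
  · have h2 := isRightDescent_diagramHom hM h.1 h1
    simp only [wallMap, h1, if_true, mul_inv_cancel_right, h2, diagramHom_symm_apply,
      inv_mul_cancel_right]
  · simp only [wallMap, h1, if_false]

/-- The points next to the wall of `s` are fixed by the automorphisms fixing the star of `s`. -/
theorem eq_and_fixed_of_crossing (hM : IsRightAngled M) {s r : B}
    {φ : definingDiagram M ≃g definingDiagram M} (h : FixesStar s φ) {y : Γ}
    (h1 : ¬ cs.IsRightDescent y s) (h2 : cs.IsRightDescent (cs.simple r * y) s) :
    r = s ∧ diagramHom cs hM φ y = y := by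
  have h3 := comm_of_isLeftDescent_mul_simple hM (isReduced_redWord (cs := cs) y⁻¹) (s := s) (r := r)
    (by rwa [wordProd_redWord, cs.isLeftDescent_inv_iff])
    (by
      rw [← cs.isLeftDescent_inv_iff, mul_inv_rev, cs.inv_simple] at h2
      rwa [wordProd_redWord])
  refine ⟨h3.1, ?_⟩
  have h4 : diagramHom cs hM φ y⁻¹ = y⁻¹ := by
    conv_lhs => rw [← wordProd_redWord (cs := cs) y⁻¹, diagramHom_wordProd]
    conv_rhs => rw [← wordProd_redWord (cs := cs) y⁻¹]
    congr 1
    exact (List.map_congr_left fun q hq => h.2 q (h3.2 q hq)).trans (List.map_id _)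
  rw [map_inv] at h4
  exact inv_injective h4

/-- The automorphism of the Cayley graph which applies `φ` beyond a wall. -/
def wallPerm (cs : CoxeterSystem M Γ) (hM : IsRightAngled M) {s : B} (w : Γ)
    {φ : definingDiagram M ≃g definingDiagram M} (h : FixesStar s φ) : Equiv.Perm Γ where
  toFun := wallMap cs hM s w φ
  invFun := wallMap cs hM s w φ.symm
  left_inv := wallMap_symm_wallMap hM w h
  right_inv := wallMap_symm_wallMap hM w h.symm

/-- Labels are permuted by `φ` beyond the wall and kept on the near side. Edges across the wall
carry the label `s`, and their endpoints are products of letters in the star of `s` translated by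
`w`, so `φ` is the identity there and the two definitions fit. The condition on `w` keeps the
identity element on the near side. -/
theorem wallPerm_mem (hM : IsRightAngled M) {s : B} {w : Γ}
    {φ : definingDiagram M ≃g definingDiagram M} (h : FixesStar s φ)
    (hw : ¬ cs.IsLeftDescent w s) : wallPerm cs hM w h ∈ cayleyStab cs := by
  constructor
  · show wallMap cs hM s w φ 1 = 1
    rw [wallMap, if_neg]
    rwa [one_mul, cs.isRightDescent_inv_iff]
  · intro v
    show ∃ π : Equiv.Perm B, ∀ r, wallMap cs hM s w φ (cs.simple r * v) =
      cs.simple (π r) * wallMap cs hM s w φ v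
    by_cases hv : cs.IsRightDescent (v * w⁻¹) s
    · refine ⟨φ.toEquiv, fun r => ?_⟩
      show _ = cs.simple (φ r) * _
      rw [wallMap_pos hM φ hv]
      by_cases hr : cs.IsRightDescent (cs.simple r * v * w⁻¹) s
      · rw [wallMap_pos hM φ hr, mul_assoc (cs.simple r), map_mul, diagramHom_simple, mul_assoc]
      · rw [wallMap_neg hM φ hr]
        rw [mul_assoc] at hr
        obtain ⟨rfl, h2⟩ := eq_and_fixed_of_crossing hM h hr (r := r)
          (by rwa [cs.simple_mul_simple_cancel_left])
        rw [map_mul, diagramHom_simple] at h2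
        rw [← mul_assoc, h2]
        simp [mul_assoc]
    · refine ⟨1, fun r => ?_⟩
      rw [wallMap_neg hM φ hv, Equiv.Perm.one_apply]
      by_cases hr : cs.IsRightDescent (cs.simple r * v * w⁻¹) s
      · rw [wallMap_pos hM φ hr]
        rw [mul_assoc] at hr ⊢
        obtain ⟨rfl, h2⟩ := eq_and_fixed_of_crossing hM h hv hr
        rw [map_mul, h2, diagramHom_simple, h.1, mul_assoc, inv_mul_cancel_right]
      · rw [wallMap_neg hM φ hr]

variable (M) in
/-- Some diagram automorphism fixes the star of `s` and moves `t` to a vertex which is distinct from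
`t` and not adjacent to it. -/
def FlipPair (s t : B) : Prop :=
  ∃ u, M u t ≠ 2 ∧ u ≠ t ∧ ∃ φ : definingDiagram M ≃g definingDiagram M, FixesStar s φ ∧ φ t = u

theorem flipPair_or_flipPair (hflex : SuperFlexible (definingDiagram M)) {s t : B} (hst : s ≠ t)
    (h : M s t ≠ 2) : FlipPair M s t ∨ FlipPair M t s := by
  obtain ⟨u, h1, h2, h3, h4, φ, ⟨h5, h6, h7, -⟩ | ⟨h5, h6, h7, -⟩⟩ := hflex s t hst h
  · exact Or.inl ⟨u, h4, h2, φ, ⟨h5, h6⟩, h7⟩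
  · exact Or.inr ⟨u, h3, h1, φ, ⟨h5, h6⟩, h7⟩

variable (cs) in
/-- The word can be rearranged so that it contains consecutive letters `t`, `s` for a flip pair. -/
def HasFlip (y : List B) : Prop :=
  ∃ (a : List B) (s t : B) (b : List B), cs.wordProd y = cs.wordProd (a ++ t :: s :: b) ∧
    y.length = (a ++ t :: s :: b).length ∧ FlipPair M s t

theorem comm_of_isRightDescent (hM : IsRightAngled M) {w : Γ} {s t : B}
    (hs : cs.IsRightDescent w s) (ht : cs.IsRightDescent w t) (hst : s ≠ t) : M s t = 2 :=
  comm_of_isLeftDescent hM (w := w⁻¹) (cs.isLeftDescent_inv_iff.mpr hs)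
    (cs.isLeftDescent_inv_iff.mpr ht) hst

theorem isRightDescent_of_isReduced {ω : List B} {s : B} (h : cs.IsReduced (ω ++ [s])) :
    cs.IsRightDescent (cs.wordProd (ω ++ [s])) s := by
  unfold CoxeterSystem.IsRightDescent
  rw [h.eq, cs.wordProd_append, cs.wordProd_singleton, cs.simple_mul_simple_cancel_right]
  have := cs.length_wordProd_le ω
  simp; omega

open Classical in
/-- The orbit of an element under the stabilizer of the identity is exponentially large in the
number of its flips. -/
theorem exists_large_orbit (hM : IsRightAngled M) (L : List (List B)) (w : List B)
    (h : cs.IsReduced (L.flatten ++ w)) :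
    ∃ X : Finset Γ, 2 ^ L.countP (fun y => HasFlip cs y) ≤ X.card ∧ ∀ x ∈ X,
      (∃ F ∈ cayleyStab cs, F (cs.wordProd (L.flatten ++ w)) = x) ∧
      ∃ γ, cs.wordProd (γ ++ w) = x ∧ cs.IsReduced (γ ++ w) := by
  induction L using List.reverseRecOn generalizing w with
  | nil =>
    exact ⟨{cs.wordProd w}, by simp, fun x hx => ⟨⟨1, (cayleyStab cs).one_mem, by
      simpa using (Finset.mem_singleton.mp hx).symm⟩, [], by
      simpa using (Finset.mem_singleton.mp hx).symm, by simpa using h⟩⟩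
  | append_singleton L y ih =>
    have e0 : (L ++ [y]).flatten ++ w = L.flatten ++ (y ++ w) := by simp
    rw [e0] at h ⊢
    obtain ⟨X, hX, hX'⟩ := ih (y ++ w) h
    by_cases hy : HasFlip cs y
    · obtain ⟨a, s, t, b, hy1, hy2, u, hu1, hu2, φ, hφ, hφt⟩ := hy
      have hred : ∀ x ∈ X, ∃ γ, cs.wordProd (γ ++ t :: s :: (b ++ w)) = x ∧
          cs.IsReduced (γ ++ t :: s :: (b ++ w)) := by
        intro x hx
        obtain ⟨-, γ, rfl, hγ⟩ := hX' x hx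
        have e1 : cs.wordProd (γ ++ a ++ t :: s :: (b ++ w)) = cs.wordProd (γ ++ (y ++ w)) := by
          simp only [cs.wordProd_append, hy1, mul_assoc, cs.wordProd_cons]
        refine ⟨γ ++ a, e1, ?_⟩
        unfold CoxeterSystem.IsReduced at *
        rw [e1, hγ]
        simp only [List.length_append, List.length_cons] at hy2 ⊢
        omega
      have hne : X.Nonempty := by
        rw [← Finset.card_pos]; exact lt_of_lt_of_le (by positivity) hX
      have hs : ¬ cs.IsLeftDescent (cs.wordProd (b ++ w)) s := by
        obtain ⟨x, hx⟩ := hne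
        obtain ⟨γ, -, hγ⟩ := hred x hx
        have h1 := hγ.drop (γ.length + 1)
        rw [List.drop_length_add_append, List.drop_succ_cons, List.drop_zero] at h1
        have h2 : cs.IsReduced (b ++ w) := by simpa using h1.drop 1
        exact (isReduced_cons_iff h2).mp h1
      -- The wall crossed by the letter `s` of the pair `t s`: all elements of `X` lie beyond it,
      -- and `F` turns the next letter `t` into `u` without touching the suffix `s b w`.
      let F := wallPerm cs hM (cs.wordProd (b ++ w)) hφ
      have hF : F ∈ cayleyStab cs := wallPerm_mem hM hφ hs
      have hFx : ∀ x ∈ X, ∃ γ, cs.wordProd (γ ++ u :: s :: (b ++ w)) = F x ∧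
          cs.IsReduced (γ ++ u :: s :: (b ++ w)) := by
        intro x hx
        obtain ⟨γ, rfl, hγ⟩ := hred x hx
        have e1 : cs.wordProd (γ ++ t :: s :: (b ++ w)) * (cs.wordProd (b ++ w))⁻¹ =
            cs.wordProd (γ ++ [t] ++ [s]) := by
          rw [mul_inv_eq_iff_eq_mul, ← cs.wordProd_append]; simp
        have e2 : cs.IsReduced (γ ++ [t] ++ [s]) := by
          have := hγ.take (γ.length + 2)
          rw [List.take_length_add_append] at this
          simpa using this
        have e3 : F (cs.wordProd (γ ++ t :: s :: (b ++ w))) =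
            cs.wordProd (γ.map φ ++ u :: s :: (b ++ w)) := by
          show wallMap cs hM s _ φ _ = _
          rw [wallMap, e1, if_pos (isRightDescent_of_isReduced e2), diagramHom_wordProd,
            ← cs.wordProd_append]
          simp [hφt, hφ.1]
        refine ⟨γ.map φ, e3.symm, ?_⟩
        have e4 := length_of_mem_cayleyStab hF (cs.wordProd (γ ++ t :: s :: (b ++ w)))
        unfold CoxeterSystem.IsReduced at *
        rw [← e3, e4, hγ]
        simp
      -- After removal of the suffix `s b w`, a common element would have both `t` and `u` as right
      -- descents, and distinct right descents commute. Hence each flip doubles the orbit.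
      have hdisj : Disjoint X (X.image F) := by
        rw [Finset.disjoint_left]
        intro x hx hx'
        obtain ⟨x', hx'', e⟩ := Finset.mem_image.mp hx'
        obtain ⟨γ, h1, h2⟩ := hred x hx
        obtain ⟨γ', h3, h4⟩ := hFx x' hx''
        have key : ∀ (γ : List B) (r : B), cs.IsReduced (γ ++ r :: s :: (b ++ w)) →
            cs.IsRightDescent (cs.wordProd (γ ++ r :: s :: (b ++ w)) *
              (cs.wordProd (s :: (b ++ w)))⁻¹) r := by
          intro γ r hr
          have e1 : cs.wordProd (γ ++ r :: s :: (b ++ w)) * (cs.wordProd (s :: (b ++ w)))⁻¹ =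
              cs.wordProd (γ ++ [r]) := by
            rw [mul_inv_eq_iff_eq_mul, ← cs.wordProd_append]; simp
          rw [e1]
          apply isRightDescent_of_isReduced
          have := hr.take (γ.length + 1)
          rw [List.take_length_add_append] at this
          simpa using this
        have k1 := key γ t h2
        have k2 := key γ' u h4
        rw [h1] at k1
        rw [h3, e] at k2
        exact hu1 (comm_of_isRightDescent hM k2 k1 hu2)
      refine ⟨X ∪ X.image F, ?_, ?_⟩
      · rw [Finset.card_union_of_disjoint hdisj, Finset.card_image_of_injective _ F.injective,
          List.countP_append]
        have : [y].countP (fun y => HasFlip cs y) = 1 := by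
          simp only [List.countP_singleton, decide_eq_true_eq, ite_eq_left_iff]
          intro h; exact absurd ⟨a, s, t, b, hy1, hy2, u, hu1, hu2, φ, hφ, hφt⟩ h
        rw [this, pow_succ]
        omega
      · intro x hx
        rcases Finset.mem_union.mp hx with hx | hx
        · refine ⟨(hX' x hx).1, ?_⟩
          obtain ⟨γ, h1, h2⟩ := (hX' x hx).2
          exact ⟨γ ++ y, by simpa using h1, by simpa using h2⟩
        · obtain ⟨x', hx', rfl⟩ := Finset.mem_image.mp hx
          obtain ⟨G, hG, hGx⟩ := (hX' x' hx').1
          refine ⟨⟨F * G, (cayleyStab cs).mul_mem hF hG, by rw [Equiv.Perm.mul_apply, hGx]⟩, ?_⟩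
          obtain ⟨γ, h1, h2⟩ := hFx x' hx'
          exact ⟨γ ++ u :: s :: b, by simpa using h1, by simpa using h2⟩
    · refine ⟨X, ?_, fun x hx => ⟨(hX' x hx).1, ?_⟩⟩
      · rw [List.countP_append]
        have : [y].countP (fun y => HasFlip cs y) = 0 := by
          simp [hy]
        rwa [this, add_zero]
      · obtain ⟨γ, h1, h2⟩ := (hX' x hx).2
        exact ⟨γ ++ y, by simpa using h1, by simpa using h2⟩

/-- A word is a word in commuting letters or can be rearranged to contain consecutive letters that
do not commute. -/
theorem pairwise_comm_or_exists {ω : List B} (h : cs.IsReduced ω) :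
    ω.Pairwise (fun s t => M s t = 2) ∨ ∃ (a : List B) (s t : B) (b : List B),
      cs.wordProd ω = cs.wordProd (a ++ t :: s :: b) ∧ ω.length = (a ++ t :: s :: b).length ∧
      s ≠ t ∧ M s t ≠ 2 := by
  induction ω with
  | nil => left; simp
  | cons r ω ih =>
    rcases ih (by simpa using h.drop 1) with h1 | ⟨a, s, t, b, h1, h2, h3, h4⟩
    · by_cases h2 : ∀ q ∈ ω, M r q = 2
      · exact Or.inl (List.pairwise_cons.mpr ⟨h2, h1⟩)
      · right
        push Not at h2
        obtain ⟨q, hq, hrq⟩ := h2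
        obtain ⟨x, z, rfl⟩ := List.append_of_mem hq
        have h3 : ∀ p ∈ x, M q p = 2 := fun p hp => by
          rw [M.symmetric]
          exact (List.pairwise_append.mp h1).2.2 p hp q (by simp)
        have h4 : cs.wordProd (r :: (x ++ q :: z)) = cs.wordProd (r :: q :: (x ++ z)) := by
          rw [cs.wordProd_cons, wordProd_of_comm cs h3, cs.wordProd_cons r, cs.wordProd_cons q]
        refine ⟨[], q, r, x ++ z, h4, by simp; omega, ?_, by rwa [M.symmetric]⟩
        rintro rfl
        unfold CoxeterSystem.IsReduced at h
        rw [h4, cs.wordProd_cons, cs.wordProd_cons, cs.simple_mul_simple_cancel_left] at h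
        have := cs.length_wordProd_le (x ++ z)
        simp at h this
        omega
    · exact Or.inr ⟨r :: a, s, t, b, by rw [cs.wordProd_cons, h1]; simp [cs.wordProd_cons],
        by simp at h2 ⊢; omega, h3, h4⟩

/-- Commuting letters in a list satisfying the first alternative are distinct, so a longer word
brings two non-commuting letters together. Super-flexibility allows only one of the two to be moved,
without a choice of which; this is why the reversed word is needed. -/
theorem hasFlip_or_hasFlip_reverse [Finite B] (hflex : SuperFlexible (definingDiagram M))
    {y : List B} (h : cs.IsReduced y) (hy : Nat.card B < y.length) :
    HasFlip cs y ∨ HasFlip cs y.reverse := by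
  have := Fintype.ofFinite B
  rcases pairwise_comm_or_exists h with h1 | ⟨a, s, t, b, h1, h2, h3, h4⟩
  · exfalso
    have h2 : y.Nodup := h1.imp fun hst => ne_of_comm hst
    have := h2.length_le_card
    rw [Nat.card_eq_fintype_card] at hy
    omega
  · rcases flipPair_or_flipPair hflex h3 h4 with h5 | h5
    · exact Or.inl ⟨a, s, t, b, h1, h2, h5⟩
    · refine Or.inr ⟨b.reverse, t, s, a.reverse, ?_, by simp at h2 ⊢; omega, h5⟩
      rw [cs.wordProd_reverse, h1, ← cs.wordProd_reverse]
      simp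

theorem exists_blocks (k m : ℕ) (ω : List B) (h : k * m ≤ ω.length) :
    ∃ (L : List (List B)) (r : List B), ω = L.flatten ++ r ∧ L.length = m ∧
      ∀ y ∈ L, y.length = k := by
  induction m generalizing ω with
  | zero => exact ⟨[], ω, by simp, rfl, by simp⟩
  | succ m ih =>
    rw [Nat.mul_succ] at h
    obtain ⟨L, r, h1, h2, h3⟩ := ih (ω.drop k) (by simp; omega)
    refine ⟨ω.take k :: L, r, ?_, by simp [h2], ?_⟩
    · rw [List.flatten_cons, List.append_assoc, ← h1, List.take_append_drop]
    · intro y hy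
      rcases List.mem_cons.mp hy with rfl | hy
      · simp; omega
      · exact h3 y hy

theorem IsReduced.of_append_left {ω ω' : List B} (h : cs.IsReduced (ω ++ ω')) : cs.IsReduced ω := by
  simpa using h.take ω.length

theorem IsReduced.of_append_right {ω ω' : List B} (h : cs.IsReduced (ω ++ ω')) :
    cs.IsReduced ω' := by
  simpa using h.drop ω.length

/-- Square-summable functions with the symmetries of the Cayley graph decay exponentially. -/
theorem sq_mul_two_pow_le [Finite B] (hM : IsRightAngled M)
    (hflex : SuperFlexible (definingDiagram M)) {q : Γ → ℝ}
    (h1 : ∀ F ∈ cayleyStab cs, ∀ g, q (F g) = q g) (h2 : ∀ g, q g⁻¹ = q g)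
    (h3 : Summable fun g => q g ^ 2) (g : Γ) :
    q g ^ 2 * 2 ^ (cs.length g / (2 * (Nat.card B + 1))) ≤ ∑' g, q g ^ 2 := by
  classical
  -- The least block length that forces two non-commuting letters into every block.
  set k := Nat.card B + 1 with hk
  set m := cs.length g / k with hm
  have key : ∀ (L : List (List B)) (w : List B), cs.IsReduced (L.flatten ++ w) →
      (q (cs.wordProd (L.flatten ++ w))) ^ 2 * 2 ^ L.countP (fun y => HasFlip cs y) ≤
        ∑' g, q g ^ 2 := by
    intro L w h
    obtain ⟨X, hX, hX'⟩ := exists_large_orbit hM L w h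
    calc (q (cs.wordProd (L.flatten ++ w))) ^ 2 * 2 ^ L.countP (fun y => HasFlip cs y)
        ≤ (q (cs.wordProd (L.flatten ++ w))) ^ 2 * X.card := by
          gcongr; exact_mod_cast hX
      _ = ∑ x ∈ X, q x ^ 2 := by
          rw [mul_comm, ← nsmul_eq_mul, ← Finset.sum_const]
          refine Finset.sum_congr rfl fun x hx => ?_
          obtain ⟨F, hF, rfl⟩ := (hX' x hx).1
          rw [h1 F hF]
      _ ≤ _ := h3.sum_le_tsum X fun _ _ => by positivity
  obtain ⟨L, r, e1, e2, e3⟩ := exists_blocks k m (redWord cs g) (by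
    rw [length_redWord, hm]; exact Nat.mul_div_le _ _)
  have hred : cs.IsReduced (L.flatten ++ r) := e1 ▸ isReduced_redWord g
  have hLr : ∀ y ∈ L, cs.IsReduced y := by
    intro y hy
    obtain ⟨L1, L2, rfl⟩ := List.append_of_mem hy
    have := IsReduced.of_append_left hred
    rw [List.flatten_append, List.flatten_cons] at this
    exact IsReduced.of_append_left (IsReduced.of_append_right this)
  have c1 := key L r hred
  rw [← e1, wordProd_redWord] at c1
  have e4 : (r.reverse :: (L.map List.reverse).reverse).flatten ++ [] = (redWord cs g).reverse := by
    rw [e1, List.reverse_append, List.reverse_flatten]; simp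
  have c2 := key (r.reverse :: (L.map List.reverse).reverse) []
    (by rw [e4]; exact (isReduced_redWord g).reverse)
  rw [e4, cs.wordProd_reverse, wordProd_redWord, h2] at c2
  set n1 := L.countP (fun y => HasFlip cs y) with hn1
  set n2 := (r.reverse :: (L.map List.reverse).reverse).countP (fun y => HasFlip cs y) with hn2
  -- Each block can be flipped in the word of `g` or in the reversed word, which represents `g⁻¹`.
  -- Since `q` is invariant under inversion, the better of the two directions may be used, and it
  -- has at least half of the flips.
  have hn : m ≤ n1 + n2 := by
    have e5 : L.countP (fun y => HasFlip cs y.reverse) ≤ n2 := by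
      rw [hn2, List.countP_cons, List.countP_reverse, List.countP_map]
      exact Nat.le_add_right _ _
    have e6 : m ≤ n1 + L.countP (fun y => HasFlip cs y.reverse) := by
      rw [← e2, hn1]
      clear_value n1 n2
      clear e1 e2 e4 c1 c2 hred hn1 hn2 e5
      induction L with
      | nil => simp
      | cons y L ih =>
        have ih := ih (fun z hz => e3 z (by simp [hz])) (fun z hz => hLr z (by simp [hz]))
        have h5 := hasFlip_or_hasFlip_reverse hflex (hLr y (by simp))
          (by rw [e3 y (by simp), hk]; omega)
        simp only [List.countP_cons, List.length_cons, decide_eq_true_eq]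
        rcases h5 with h5 | h5 <;> simp only [h5, if_true] <;> split_ifs <;> omega
    omega
  have hdiv : cs.length g / (2 * k) = m / 2 := by
    rw [hm, Nat.div_div_eq_div_mul, mul_comm]
  rw [hdiv]
  rcases le_total n1 n2 with h5 | h5
  · refine le_trans ?_ c2
    gcongr
    · norm_num
    · omega
  · refine le_trans ?_ c1
    gcongr
    · norm_num
    · omega

end CayleyAutomorphisms

/-! ### The Kesten–McKay measure of the 3-regular tree. -/

section KestenMcKay

open Real intervalIntegral

/-- The denominator of the Kesten–McKay density of the 3-regular tree in angular coordinates. -/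
def kmDenom (θ : ℝ) : ℝ := 9 - 8 * cos θ ^ 2

theorem one_le_kmDenom (θ : ℝ) : 1 ≤ kmDenom θ := by
  have := cos_sq_le_one θ
  unfold kmDenom; linarith

theorem kmDenom_le (θ : ℝ) : kmDenom θ ≤ 9 := by
  have := sq_nonneg (cos θ)
  unfold kmDenom; linarith

theorem kmDenom_pos (θ : ℝ) : 0 < kmDenom θ := lt_of_lt_of_le one_pos (one_le_kmDenom θ)

theorem continuous_kmDenom : Continuous kmDenom := by unfold kmDenom; fun_prop

/-- The sine moments against the denominator. -/
def sineMoment (m : ℝ) : ℝ := ∫ θ in (0 : ℝ)..π, sin θ * sin (m * θ) / kmDenom θ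

theorem continuous_sineMoment_integrand (m : ℝ) :
    Continuous fun θ => sin θ * sin (m * θ) / kmDenom θ :=
  Continuous.div (by fun_prop) continuous_kmDenom fun θ => (kmDenom_pos θ).ne'

theorem abs_sineMoment_le (m : ℝ) : |sineMoment m| ≤ π := by
  have h := intervalIntegral.norm_integral_le_of_norm_le_const (a := 0) (b := π) (C := 1)
    (f := fun θ => sin θ * sin (m * θ) / kmDenom θ) fun θ _ => by
      rw [norm_div, norm_mul, Real.norm_eq_abs, Real.norm_eq_abs, Real.norm_eq_abs,
        abs_of_pos (kmDenom_pos θ), div_le_one (kmDenom_pos θ)]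
      exact (mul_le_one₀ (abs_sin_le_one _) (abs_nonneg _) (abs_sin_le_one _)).trans
        (one_le_kmDenom θ)
  simpa [sineMoment, abs_of_pos pi_pos] using h

theorem integral_sin_mul_sin (m : ℕ) (hm : 2 ≤ m) :
    ∫ θ in (0 : ℝ)..π, sin θ * sin (m * θ) = 0 := by
  have h1 : ((m : ℝ) - 1) ≠ 0 := by
    have : (2 : ℝ) ≤ m := by exact_mod_cast hm
    linarith
  have h2 : ((m : ℝ) + 1) ≠ 0 := by positivity
  have e : ∀ θ : ℝ, sin θ * sin (m * θ) =
      (1 / 2) * cos (((m : ℝ) - 1) * θ) - (1 / 2) * cos (((m : ℝ) + 1) * θ) := by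
    intro θ
    rw [sub_mul, add_mul, one_mul, cos_sub, cos_add]; ring
  simp_rw [e]
  rw [intervalIntegral.integral_sub (by apply Continuous.intervalIntegrable; fun_prop)
    (by apply Continuous.intervalIntegrable; fun_prop)]
  rw [intervalIntegral.integral_const_mul, intervalIntegral.integral_const_mul,
    intervalIntegral.integral_comp_mul_left (fun x => cos x) h1,
    intervalIntegral.integral_comp_mul_left (fun x => cos x) h2]
  have e1 : sin (((m : ℝ) - 1) * π) = 0 := by
    have := sin_int_mul_pi ((m : ℤ) - 1); push_cast at this; exact this
  have e2 : sin (((m : ℝ) + 1) * π) = 0 := by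
    have := sin_int_mul_pi ((m : ℤ) + 1); push_cast at this; exact this
  simp [e1, e2]

/-- The denominator is `5 - 4 cos 2θ`, and multiplication by `2 cos 2θ` shifts the frequency `m` by
`±2`. -/
theorem sineMoment_rec_aux (m : ℝ) :
    5 * sineMoment m - 2 * sineMoment (m + 2) - 2 * sineMoment (m - 2) =
      ∫ θ in (0 : ℝ)..π, sin θ * sin (m * θ) := by
  unfold sineMoment
  have hi : ∀ m : ℝ, IntervalIntegrable (fun θ => sin θ * sin (m * θ) / kmDenom θ)
      MeasureTheory.volume 0 π := fun m => (continuous_sineMoment_integrand m).intervalIntegrable _ _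
  rw [← intervalIntegral.integral_const_mul, ← intervalIntegral.integral_const_mul,
    ← intervalIntegral.integral_const_mul,
    ← intervalIntegral.integral_sub ((hi _).const_mul _) ((hi _).const_mul _),
    ← intervalIntegral.integral_sub (((hi _).const_mul _).sub ((hi _).const_mul _))
      ((hi _).const_mul _)]
  refine intervalIntegral.integral_congr fun θ _ => ?_
  have hD := (kmDenom_pos θ).ne'
  field_simp
  rw [show θ * (m + 2) = m * θ + 2 * θ by ring, show θ * (m - 2) = m * θ - 2 * θ by ring,
    sin_add, sin_sub, cos_two_mul]
  unfold kmDenom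
  ring

/-- The recursion with step two has characteristic roots `2` and `1/2`. The moments are bounded, so
the component growing like `2 ^ k` is zero. -/
theorem sineMoment_succ_succ (m : ℕ) : sineMoment (m + 2) = sineMoment m / 2 := by
  have hrec : ∀ m : ℕ, sineMoment ((m + 2 : ℕ) + 2) - sineMoment (m + 2 : ℕ) / 2 =
      2 * (sineMoment (m + 2 : ℕ) - sineMoment m / 2) := by
    intro m
    have h1 := sineMoment_rec_aux (m + 2 : ℕ)
    rw [integral_sin_mul_sin _ (by omega)] at h1
    have e : ((m + 2 : ℕ) : ℝ) - 2 = m := by push_cast; ring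
    rw [e] at h1
    linarith
  have hpow : ∀ k : ℕ, sineMoment ((m + 2 * k : ℕ) + 2) - sineMoment (m + 2 * k : ℕ) / 2 =
      2 ^ k * (sineMoment (m + 2) - sineMoment m / 2) := by
    intro k
    induction k with
    | zero => simp
    | succ k ih =>
      have h1 := hrec (m + 2 * k)
      rw [show m + 2 * (k + 1) = m + 2 * k + 2 by ring, h1, pow_succ]
      push_cast at ih ⊢
      rw [ih]; ring
  by_contra hne
  have hpos : 0 < |sineMoment (m + 2) - sineMoment m / 2| := abs_pos.mpr (sub_ne_zero.mpr hne)
  obtain ⟨k, hk⟩ := pow_unbounded_of_one_lt ((2 * π) / |sineMoment (m + 2) - sineMoment m / 2|)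
    (one_lt_two : (1 : ℝ) < 2)
  rw [div_lt_iff₀ hpos] at hk
  have h2 : 2 ^ k * |sineMoment (m + 2) - sineMoment m / 2| ≤ 2 * π := by
    rw [← abs_of_pos (by positivity : (0 : ℝ) < 2 ^ k), ← abs_mul, ← hpow k]
    refine (abs_sub _ _).trans ?_
    have h3 := abs_sineMoment_le ((m + 2 * k : ℕ) + 2)
    have h4 := abs_sineMoment_le (m + 2 * k : ℕ)
    rw [abs_div, abs_of_pos (two_pos : (0 : ℝ) < 2)]
    linarith [pi_pos]
  linarith

theorem sineMoment_one : sineMoment 1 = π / 12 := by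
  have h1 := sineMoment_rec_aux 1
  have h2 : sineMoment (1 + 2) = sineMoment 1 / 2 := by
    simpa using sineMoment_succ_succ 1
  have h3 : sineMoment (1 - 2) = - sineMoment 1 := by
    unfold sineMoment
    rw [← intervalIntegral.integral_neg]
    refine intervalIntegral.integral_congr fun θ _ => ?_
    rw [show ((1 : ℝ) - 2) * θ = -θ by ring, sin_neg, one_mul]; ring
  have h4 : ∫ θ in (0 : ℝ)..π, sin θ * sin (1 * θ) = π / 2 := by
    have : ∀ θ : ℝ, sin θ * sin (1 * θ) = sin θ ^ 2 := fun θ => by rw [one_mul]; ring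
    simp_rw [this]
    rw [integral_sin_sq]; simp
  rw [h2, h3, h4] at h1
  linarith

/-- The angular density of the spectral measure of the 3-regular tree. -/
def kmDensity (θ : ℝ) : ℝ := 12 / π * (sin θ ^ 2 / kmDenom θ)

theorem continuous_kmDensity : Continuous kmDensity := by
  unfold kmDensity
  exact continuous_const.mul (Continuous.div (by fun_prop) continuous_kmDenom
    fun θ => (kmDenom_pos θ).ne')

theorem kmDensity_nonneg (θ : ℝ) : 0 ≤ kmDensity θ := by
  have := kmDenom_pos θ
  have := pi_pos
  unfold kmDensity; positivity

/-- The spectral point of the angle `θ`. -/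
def kmPoint (θ : ℝ) : ℝ := 2 * √2 * cos θ

theorem continuous_kmPoint : Continuous kmPoint := by unfold kmPoint; fun_prop

/-- The integral of a function against the spectral measure of the 3-regular tree. -/
def kmIntegral (f : ℝ → ℝ) : ℝ := ∫ θ in (0 : ℝ)..π, kmDensity θ * f (kmPoint θ)

open Polynomial

/-- The polynomials of the spheres in the 3-regular tree. -/
def treePoly : ℕ → ℝ[X]
  | 0 => 1
  | 1 => X
  | 2 => X ^ 2 - 3
  | n + 3 => X * treePoly (n + 2) - 2 * treePoly (n + 1)

/-- The sphere polynomials are differences of Chebyshev polynomials of the second kind. With the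
halving of sine moments at step two, this form makes their integrals vanish. -/
theorem treePoly_eval (n : ℕ) (θ : ℝ) : (treePoly (n + 1)).eval (kmPoint θ) * sin θ =
    √2 ^ (n + 1) * (sin ((n + 2 : ℕ) * θ) - sin (n * θ) / 2) := by
  have h2 : √2 ^ 2 = 2 := Real.sq_sqrt (by norm_num)
  induction n using Nat.twoStepInduction with
  | zero =>
    simp only [treePoly, kmPoint, eval_X]
    norm_num
    rw [sin_two_mul]; ring
  | one =>
    simp only [treePoly, kmPoint, eval_sub, eval_pow, eval_X, eval_ofNat]
    norm_num
    rw [sin_three_mul]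
    linear_combination 4 * cos θ ^ 2 * sin θ * h2 + 8 * sin θ * sin_sq_add_cos_sq θ
  | more n ih1 ih2 =>
    have e : (treePoly (n + 2 + 1)).eval (kmPoint θ) * sin θ =
        kmPoint θ * ((treePoly (n + 1 + 1)).eval (kmPoint θ) * sin θ) -
          2 * ((treePoly (n + 1)).eval (kmPoint θ) * sin θ) := by
      rw [treePoly]
      simp only [eval_sub, eval_mul, eval_X, eval_ofNat]
      ring
    rw [e, ih1, ih2]
    have a1 : ((n + 2 + 2 : ℕ) : ℝ) * θ = (n + 3 : ℕ) * θ + θ := by push_cast; ring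
    have a2 : ((n + 2 : ℕ) : ℝ) * θ = (n + 3 : ℕ) * θ - θ := by push_cast; ring
    have a3 : ((n + 2 : ℕ) : ℝ) * θ = (n + 1 : ℕ) * θ + θ := by push_cast; ring
    have a4 : (n : ℝ) * θ = (n + 1 : ℕ) * θ - θ := by push_cast; ring
    have b1 : sin (((n + 2 + 2 : ℕ) : ℝ) * θ) + sin (((n + 2 : ℕ) : ℝ) * θ) =
        2 * cos θ * sin ((n + 3 : ℕ) * θ) := by
      rw [a1, a2, sin_add, sin_sub]; ring
    have b2 : sin (((n + 2 : ℕ) : ℝ) * θ) + sin (n * θ) =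
        2 * cos θ * sin ((n + 1 : ℕ) * θ) := by
      rw [a3, a4, sin_add, sin_sub]; ring
    have c1 : sin (((n + 2 + 2 : ℕ) : ℝ) * θ) =
      2 * cos θ * sin ((n + 3 : ℕ) * θ) - sin (((n + 2 : ℕ) : ℝ) * θ) := by linarith
    rw [c1]
    have c2 : sin ((n : ℝ) * θ) = 2 * cos θ * sin ((n + 1 : ℕ) * θ) -
      sin (((n + 2 : ℕ) : ℝ) * θ) := by linarith
    rw [c2]
    unfold kmPoint
    rw [show n + 1 + 2 = n + 3 by ring]
    linear_combination √2 ^ (n + 1) * (3 / 2 * sin ((n + 2 : ℕ) * θ) -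
      cos θ * sin ((n + 1 : ℕ) * θ)) * h2

theorem kmIntegral_treePoly_succ (n : ℕ) : kmIntegral (fun x => (treePoly (n + 1)).eval x) = 0 := by
  have e : ∀ θ : ℝ, kmDensity θ * (treePoly (n + 1)).eval (kmPoint θ) =
      12 / π * √2 ^ (n + 1) * (sin θ * sin ((n + 2 : ℕ) * θ) / kmDenom θ) -
        12 / π * √2 ^ (n + 1) / 2 * (sin θ * sin (n * θ) / kmDenom θ) := by
    intro θ
    have h := treePoly_eval n θ
    calc kmDensity θ * (treePoly (n + 1)).eval (kmPoint θ)
        = 12 / π * (sin θ / kmDenom θ) * ((treePoly (n + 1)).eval (kmPoint θ) * sin θ) := by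
          unfold kmDensity; ring
      _ = _ := by rw [h]; ring
  unfold kmIntegral
  simp_rw [e]
  rw [intervalIntegral.integral_sub
    (((continuous_sineMoment_integrand _).intervalIntegrable _ _).const_mul _)
    (((continuous_sineMoment_integrand _).intervalIntegrable _ _).const_mul _),
    intervalIntegral.integral_const_mul, intervalIntegral.integral_const_mul]
  have h := sineMoment_succ_succ n
  unfold sineMoment at h
  push_cast at h ⊢
  rw [h]; ring

theorem kmIntegral_one : kmIntegral (fun _ => 1) = 1 := by
  have h := sineMoment_one
  unfold sineMoment at h
  unfold kmIntegral kmDensity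
  simp only [mul_one]
  rw [intervalIntegral.integral_const_mul]
  have : ∀ θ : ℝ, sin θ ^ 2 / kmDenom θ = sin θ * sin (1 * θ) / kmDenom θ := fun θ => by
    rw [one_mul, sq]
  simp_rw [this, h]
  field_simp

theorem kmIntegral_congr_le {f g : ℝ → ℝ} (hf : Continuous f) (hg : Continuous g)
    (h : ∀ x, |x| ≤ 2 * √2 → f x ≤ g x) : kmIntegral f ≤ kmIntegral g := by
  refine intervalIntegral.integral_mono_on pi_pos.le ?_ ?_ fun θ _ => ?_
  · exact (continuous_kmDensity.mul (hf.comp continuous_kmPoint)).intervalIntegrable _ _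
  · exact (continuous_kmDensity.mul (hg.comp continuous_kmPoint)).intervalIntegrable _ _
  · refine mul_le_mul_of_nonneg_left (h _ ?_) (kmDensity_nonneg θ)
    unfold kmPoint
    rw [abs_mul, abs_of_pos (by positivity : (0 : ℝ) < 2 * √2)]
    exact mul_le_of_le_one_right (by positivity) (abs_cos_le_one θ)

/-- The spheres span the polynomials. -/
theorem poly_induction_treePoly {p : ℝ[X] → Prop} (h0 : p 1) (h1 : ∀ n, p (treePoly (n + 1)))
    (hadd : ∀ f g, p f → p g → p (f + g)) (hsmul : ∀ (c : ℝ) f, p f → p (c • f)) (f : ℝ[X]) :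
    p f := by
  have hz : p 0 := by simpa using hsmul 0 1 h0
  let V : Submodule ℝ ℝ[X] := ⟨⟨⟨{f | p f}, fun {a b} => hadd a b⟩, hz⟩, fun c f => hsmul c f⟩
  let W : Submodule ℝ ℝ[X] := Submodule.span ℝ (Set.range treePoly)
  have hall : ∀ n, treePoly n ∈ W := fun n => Submodule.subset_span ⟨n, rfl⟩
  have hWV : W ≤ V := by
    refine Submodule.span_le.mpr ?_
    rintro _ ⟨n, rfl⟩
    cases n with
    | zero => exact h0
    | succ n => exact h1 n
  -- By the three-term recursion the span is stable under multiplication by `X`, hence contains all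
  -- monomials.
  have hX : ∀ f ∈ W, X * f ∈ W := by
    intro f hf
    induction hf using Submodule.span_induction with
    | mem x hx =>
      obtain ⟨n, rfl⟩ := hx
      match n with
      | 0 => simpa [treePoly] using hall 1
      | 1 =>
        have : X * treePoly 1 = treePoly 2 + (3 : ℝ) • treePoly 0 := by
          simp only [treePoly, Polynomial.smul_eq_C_mul]
          rw [show (C (3 : ℝ)) = 3 from rfl]; ring
        rw [this]
        exact W.add_mem (hall 2) (W.smul_mem _ (hall 0))
      | n + 2 =>
        have : X * treePoly (n + 2) = treePoly (n + 3) + (2 : ℝ) • treePoly (n + 1) := by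
          rw [treePoly, Polynomial.smul_eq_C_mul, show (C (2 : ℝ)) = 2 from rfl]; ring
        rw [this]
        exact W.add_mem (hall _) (W.smul_mem _ (hall _))
    | zero => simp
    | add x y _ _ hx hy => rw [mul_add]; exact W.add_mem hx hy
    | smul c x _ hx => rw [mul_smul_comm]; exact W.smul_mem _ hx
  have hpow : ∀ n, (X : ℝ[X]) ^ n ∈ W := by
    intro n
    induction n with
    | zero => simpa [treePoly] using hall 0
    | succ n ih => rw [pow_succ']; exact hX _ ih
  have : f ∈ W := by
    rw [f.as_sum_range_C_mul_X_pow]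
    refine W.sum_mem fun n _ => ?_
    rw [← Polynomial.smul_eq_C_mul]
    exact W.smul_mem _ (hpow n)
  exact hWV this

end KestenMcKay

/-! ### Supports in subgroups and multiplicativity of the trace. -/

section Support

variable {Γ : Type*} [Group Γ]

theorem exists_of_coeff_mul_ne_zero {x y : MonoidAlgebra ℂ Γ} {g : Γ} (h : (x * y).coeff g ≠ 0) :
    ∃ u v, x.coeff u ≠ 0 ∧ y.coeff v ≠ 0 ∧ u * v = g := by
  classical
  rw [MonoidAlgebra.coeff_mul] at h
  obtain ⟨u, hu, h⟩ := Finset.exists_ne_zero_of_sum_ne_zero h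
  obtain ⟨v, hv, h⟩ := Finset.exists_ne_zero_of_sum_ne_zero h
  refine ⟨u, v, Finsupp.mem_support_iff.mp hu, Finsupp.mem_support_iff.mp hv, ?_⟩
  by_contra h1
  exact h (if_neg h1)

/-- Powers of an element supported in a subgroup are supported in the subgroup. -/
theorem mem_of_coeff_pow_ne_zero {H : Subgroup Γ} {x : MonoidAlgebra ℂ Γ}
    (hx : ∀ g, x.coeff g ≠ 0 → g ∈ H) (n : ℕ) (g : Γ) (h : (x ^ n).coeff g ≠ 0) : g ∈ H := by
  classical
  induction n generalizing g with
  | zero =>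
    rw [pow_zero, MonoidAlgebra.one_def, MonoidAlgebra.coeff_single, Finsupp.single_apply] at h
    split_ifs at h with h1
    · rw [← h1]; exact H.one_mem
    · exact absurd rfl h
  | succ n ih =>
    rw [pow_succ] at h
    obtain ⟨u, v, hu, hv, rfl⟩ := exists_of_coeff_mul_ne_zero h
    exact H.mul_mem (ih u hu) (hx v hv)

/-- The trace is multiplicative on elements with independent supports. -/
theorem coeff_mul_one_of_disjoint {H K : Subgroup Γ} (hHK : ∀ g, g ∈ H → g ∈ K → g = 1)
    {x y : MonoidAlgebra ℂ Γ} (hx : ∀ g, x.coeff g ≠ 0 → g ∈ H)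
    (hy : ∀ g, y.coeff g ≠ 0 → g ∈ K) : (x * y).coeff 1 = x.coeff 1 * y.coeff 1 := by
  classical
  rw [MonoidAlgebra.coeff_mul, Finsupp.sum, Finset.sum_eq_single 1, Finsupp.sum,
    Finset.sum_eq_single 1]
  · simp
  · intro v _ hv
    simp [hv]
  · intro h
    simp [Finsupp.notMem_support_iff.mp h]
  · intro u hu hu1
    refine Finset.sum_eq_zero fun v hv => if_neg fun huv => hu1 ?_
    have h1 := hx u (Finsupp.mem_support_iff.mp hu)
    have h2 := hy v (Finsupp.mem_support_iff.mp hv)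
    refine hHK u h1 ?_
    rw [mul_eq_one_iff_eq_inv.mp huv]
    exact K.inv_mem h2
  · intro h
    simp [Finsupp.notMem_support_iff.mp h, Finsupp.sum]

theorem coeff_single_mul (h g : Γ) (y : MonoidAlgebra ℂ Γ) :
    (MonoidAlgebra.single h (1 : ℂ) * y).coeff g = y.coeff (h⁻¹ * g) := by
  rw [MonoidAlgebra.coeff_single_mul_eq_mul_coeff (h⁻¹ * g), one_mul]
  intro m _
  rw [eq_inv_mul_iff_mul_eq]

end Support

/-! ### The tree factor and its independence from the other generators. -/

section Tree

variable {B : Type*} {Γ : Type*} [Group Γ] {M : CoxeterMatrix B} (cs : CoxeterSystem M Γ)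

/-- A generator as an element of the group algebra. -/
def genElt (s : B) : MonoidAlgebra ℂ Γ := MonoidAlgebra.single (cs.simple s) 1

theorem genElt_mul_self (s : B) : genElt cs s * genElt cs s = 1 := by
  rw [genElt, MonoidAlgebra.single_mul_single, cs.simple_mul_simple_self, one_mul,
    MonoidAlgebra.one_def]

theorem genElt_comm {s t : B} (h : M s t = 2) :
    genElt cs s * genElt cs t = genElt cs t * genElt cs s := by
  rw [genElt, genElt, MonoidAlgebra.single_mul_single, MonoidAlgebra.single_mul_single,
    simple_comm cs h]

/-- The sum of the words of length `n + 1` without repetitions in three letters that start with a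
given letter. -/
def treeSphere (tri : Fin 3 → B) : ℕ → Fin 3 → MonoidAlgebra ℂ Γ
  | 0, i => genElt cs (tri i)
  | n + 1, i => genElt cs (tri i) * ∑ j ∈ Finset.univ.erase i, treeSphere tri n j

variable {cs}

/-- The remaining word starts with a different letter of the triple. If its product with the first
letter were not reduced, two non-commuting letters would both be left descents of it. In particular
these sums have no identity term, hence trace zero. -/
theorem isLeftDescent_of_coeff_treeSphere (hM : IsRightAngled M) {tri : Fin 3 → B}
    (hinj : Function.Injective tri) (htri : ∀ i j, M (tri i) (tri j) ≠ 2) (n : ℕ) (i : Fin 3)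
    (g : Γ) (h : (treeSphere cs tri n i).coeff g ≠ 0) : cs.IsLeftDescent g (tri i) := by
  classical
  induction n generalizing i g with
  | zero =>
    rw [treeSphere, genElt, MonoidAlgebra.coeff_single, Finsupp.single_apply] at h
    split_ifs at h with h1
    · rw [← h1]
      simp [CoxeterSystem.IsLeftDescent]
    · exact absurd rfl h
  | succ n ih =>
    rw [treeSphere, genElt, coeff_single_mul, cs.inv_simple, MonoidAlgebra.coeff_sum,
      Finsupp.finsetSum_apply] at h
    obtain ⟨j, hj, h⟩ := Finset.exists_ne_zero_of_sum_ne_zero h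
    have h1 := ih j _ h
    have hij : i ≠ j := (Finset.ne_of_mem_erase hj).symm
    by_contra h2
    have h3 : cs.IsLeftDescent (cs.simple (tri i) * g) (tri i) := by
      rw [cs.isLeftDescent_iff_not_isLeftDescent_mul, cs.simple_mul_simple_cancel_left]
      exact h2
    exact htri i j (comm_of_isLeftDescent hM h3 h1 (hinj.ne hij))

theorem coeff_treeSphere_one (hM : IsRightAngled M) {tri : Fin 3 → B}
    (hinj : Function.Injective tri) (htri : ∀ i j, M (tri i) (tri j) ≠ 2) (n : ℕ) (i : Fin 3) :
    (treeSphere cs tri n i).coeff 1 = 0 := by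
  by_contra h
  exact cs.not_isLeftDescent_one _ (isLeftDescent_of_coeff_treeSphere hM hinj htri n i 1 h)

variable (cs) in
/-- The sum of the three generators of the tree factor. -/
def treeElt (tri : Fin 3 → B) : MonoidAlgebra ℂ Γ := ∑ i, genElt cs (tri i)

open Polynomial in
-- Multiplying a sphere by the sum of the three letters gives the next sphere plus the words whose
-- first letter cancels. Each vertex of the previous sphere is hit `2` times in this way, and the
-- identity `3` times.
theorem aeval_treePoly (tri : Fin 3 → B) (n : ℕ) :
    aeval (treeElt cs tri) (treePoly (n + 1)) = ∑ i, treeSphere cs tri n i := by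
  have hA : ∀ Y : Fin 3 → MonoidAlgebra ℂ Γ, treeElt cs tri * ∑ j, Y j =
      ∑ i, genElt cs (tri i) * ∑ j ∈ Finset.univ.erase i, Y j + ∑ i, genElt cs (tri i) * Y i := by
    intro Y
    rw [treeElt, Finset.sum_mul, ← Finset.sum_add_distrib]
    refine Finset.sum_congr rfl fun i _ => ?_
    rw [← mul_add, Finset.sum_erase_add _ _ (Finset.mem_univ i)]
  induction n using Nat.twoStepInduction with
  | zero => simp [treePoly, treeElt, treeSphere]
  | one =>
    have h := hA (fun j => treeSphere cs tri 0 j)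
    have h0 : ∑ j, treeSphere cs tri 0 j = treeElt cs tri := rfl
    have h1 : ∑ i, genElt cs (tri i) * treeSphere cs tri 0 i = 3 := by
      simp [treeSphere, genElt_mul_self]
    rw [h0, h1] at h
    rw [treePoly, map_sub, map_pow, aeval_X, pow_two, h]
    have : (aeval (treeElt cs tri)) (3 : ℝ[X]) = 3 := map_ofNat _ 3
    rw [this, add_sub_cancel_right]
    rfl
  | more n ih1 ih2 =>
    have h := hA (fun j => treeSphere cs tri (n + 1) j)
    have h1 : ∑ i, genElt cs (tri i) * treeSphere cs tri (n + 1) i =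
        2 * ∑ i, treeSphere cs tri n i := by
      simp only [treeSphere, ← mul_assoc, genElt_mul_self, one_mul]
      have : ∀ i : Fin 3, ∑ j ∈ Finset.univ.erase i, treeSphere cs tri n j =
          ∑ j, treeSphere cs tri n j - treeSphere cs tri n i := fun i => by
        rw [← Finset.sum_erase_add _ _ (Finset.mem_univ i), add_sub_cancel_right]
      simp only [this, Finset.sum_sub_distrib, Finset.sum_const, Finset.card_univ,
        Fintype.card_fin]
      rw [nsmul_eq_mul]; push_cast; noncomm_ring
    have e2 : (aeval (treeElt cs tri)) (2 : ℝ[X]) = 2 := map_ofNat _ 2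
    rw [treePoly, map_sub, map_mul, map_mul, aeval_X, ih1, ih2, e2, h, h1, add_sub_cancel_right]
    rfl

open Polynomial in
/-- The trace of a polynomial in the adjacency element of the 3-regular tree. -/
theorem coeff_aeval_treeElt (hM : IsRightAngled M) {tri : Fin 3 → B}
    (hinj : Function.Injective tri) (htri : ∀ i j, M (tri i) (tri j) ≠ 2) (p : ℝ[X]) :
    (aeval (treeElt cs tri) p).coeff 1 = (kmIntegral (fun x => p.eval x) : ℂ) := by
  have hint : ∀ f : ℝ[X], IntervalIntegrable (fun θ => kmDensity θ * f.eval (kmPoint θ))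
      MeasureTheory.volume 0 Real.pi := fun f =>
    (continuous_kmDensity.mul (f.continuous.comp continuous_kmPoint)).intervalIntegrable _ _
  induction p using poly_induction_treePoly with
  | h0 => simp [kmIntegral_one]
  | h1 n =>
    rw [aeval_treePoly, kmIntegral_treePoly_succ, MonoidAlgebra.coeff_sum,
      Finsupp.finsetSum_apply]
    simp [coeff_treeSphere_one hM hinj htri]
  | hadd f g hf hg =>
    rw [map_add, MonoidAlgebra.coeff_add, Finsupp.add_apply, hf, hg, ← Complex.ofReal_add]
    congr 1
    simp only [kmIntegral, eval_add, mul_add]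
    rw [intervalIntegral.integral_add (hint f) (hint g)]
  | hsmul c f hf =>
    rw [map_smul, MonoidAlgebra.coeff_smul, Finsupp.smul_apply, hf, Complex.real_smul,
      ← Complex.ofReal_mul]
    congr 1
    simp only [kmIntegral, eval_smul, smul_eq_mul]
    rw [← intervalIntegral.integral_const_mul]
    congr 1
    funext θ; ring

open Classical in
/-- The retraction onto a special subgroup. -/
theorem exists_retraction (hM : IsRightAngled M) (J : Set B) :
    ∃ r : Γ →* Γ, (∀ s ∈ J, r (cs.simple s) = cs.simple s) ∧ ∀ s ∉ J, r (cs.simple s) = 1 := by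
  have hl : M.IsLiftable (fun s => if s ∈ J then cs.simple s else 1) := by
    refine isLiftable_of_involutions hM _ (fun s => ?_) fun s t hst => ?_
    · split_ifs <;> simp
    · split_ifs <;> simp [simple_comm cs hst]
  refine ⟨cs.lift ⟨_, hl⟩, fun s hs => ?_, fun s hs => ?_⟩
  · rw [cs.lift_apply_simple, if_pos hs]
  · rw [cs.lift_apply_simple, if_neg hs]

open Classical in
variable (cs) in
/-- The sum of the generators outside the tree factor. -/
def restElt [Fintype B] (tri : Fin 3 → B) : MonoidAlgebra ℂ Γ :=
  ∑ s ∈ Finset.univ.filter fun s => s ∉ Set.range tri, genElt cs s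

theorem indicatorElt_generators [Fintype B] (hM : IsRightAngled M) :
    indicatorElt (generators cs) = ∑ s, genElt cs s := by
  classical
  have : generators cs = Finset.univ.image cs.simple := by ext; simp [generators]
  rw [indicatorElt, this, Finset.sum_image fun x _ y _ h => simple_injective cs hM h]
  rfl

theorem treeElt_add_restElt [Fintype B] {tri : Fin 3 → B} (hinj : Function.Injective tri) :
    treeElt cs tri + restElt cs tri = ∑ s, genElt cs s := by
  classical
  rw [restElt, treeElt, ← Finset.sum_image (f := genElt cs) (g := tri) (s := Finset.univ)
    fun x _ y _ h => hinj h, ← Finset.sum_filter_add_sum_filter_not Finset.univ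
    (fun s => s ∈ Set.range tri)]
  congr 2
  ext; simp

theorem treeElt_comm_restElt [Fintype B] {tri : Fin 3 → B}
    (hrest : ∀ s, s ∉ Set.range tri → ∀ i, M s (tri i) = 2) :
    Commute (treeElt cs tri) (restElt cs tri) := by
  refine Commute.sum_left _ _ _ fun i _ => Commute.sum_right _ _ _ fun s hs => ?_
  exact (genElt_comm cs (hrest s (by simpa using hs) i)).symm

/-- The retraction onto the subgroup of the triple fixes the support of the first factor and kills
that of the second, so the two supports generate subgroups meeting only in the identity. -/
theorem coeff_treeElt_pow_mul_restElt_pow [Fintype B] (hM : IsRightAngled M) (tri : Fin 3 → B)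
    (k j : ℕ) : (treeElt cs tri ^ k * restElt cs tri ^ j).coeff 1 =
      (treeElt cs tri ^ k).coeff 1 * (restElt cs tri ^ j).coeff 1 := by
  classical
  obtain ⟨r, hr1, hr2⟩ := exists_retraction (cs := cs) hM (Set.range tri)
  have key : ∀ (s : B) (g : Γ), (genElt cs s).coeff g ≠ 0 → g = cs.simple s := by
    intro s g h
    rw [genElt, MonoidAlgebra.coeff_single, Finsupp.single_apply] at h
    split_ifs at h with h1
    · exact h1.symm
    · exact absurd rfl h
  refine coeff_mul_one_of_disjoint (H := r.eqLocus (MonoidHom.id Γ)) (K := r.ker)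
    (fun g h1 h2 => ?_) (mem_of_coeff_pow_ne_zero (fun g h => ?_) k)
    (mem_of_coeff_pow_ne_zero (fun g h => ?_) j)
  · rw [MonoidHom.mem_ker] at h2
    exact (h1 : r g = g).symm.trans h2
  · rw [treeElt, MonoidAlgebra.coeff_sum, Finsupp.finsetSum_apply] at h
    obtain ⟨i, _, h⟩ := Finset.exists_ne_zero_of_sum_ne_zero h
    rw [key _ _ h]
    exact hr1 _ ⟨i, rfl⟩
  · rw [restElt, MonoidAlgebra.coeff_sum, Finsupp.finsetSum_apply] at h
    obtain ⟨s, hs, h⟩ := Finset.exists_ne_zero_of_sum_ne_zero h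
    rw [key _ _ h, MonoidHom.mem_ker]
    exact hr2 _ (by simpa using hs)

/-- The trace of a power of the sum of all generators. -/
theorem coeff_indicatorElt_pow [Fintype B] (hM : IsRightAngled M) {tri : Fin 3 → B}
    (hinj : Function.Injective tri)
    (hrest : ∀ s, s ∉ Set.range tri → ∀ i, M s (tri i) = 2) (n : ℕ) :
    (indicatorElt (generators cs) ^ n).coeff 1 = ∑ k ∈ Finset.range (n + 1),
      (treeElt cs tri ^ k).coeff 1 * (restElt cs tri ^ (n - k)).coeff 1 * (n.choose k : ℂ) := by
  rw [indicatorElt_generators hM, ← treeElt_add_restElt hinj,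
    (treeElt_comm_restElt hrest).add_pow, MonoidAlgebra.coeff_sum, Finsupp.finsetSum_apply]
  refine Finset.sum_congr rfl fun k _ => ?_
  rw [← coeff_treeElt_pow_mul_restElt_pow hM, ← nsmul_eq_mul', MonoidAlgebra.coeff_smul,
    Finsupp.smul_apply, nsmul_eq_mul']

end Tree

/-! ### Spectral measures and resolvents of self-adjoint operators. -/

section Spectral

open MeasureTheory

variable {H : Type*} [NormedAddCommGroup H] [InnerProductSpace ℂ H] [CompleteSpace H]

theorem inner_eq_re_of_isSelfAdjoint {A : H →L[ℂ] H} (hA : IsSelfAdjoint A) (v : H) :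
    inner ℂ v (A v) = ((inner ℂ v (A v)).re : ℂ) := by
  refine (Complex.conj_eq_iff_re.mp ?_).symm
  rw [inner_conj_symm, ← ContinuousLinearMap.adjoint_inner_right,
    (ContinuousLinearMap.isSelfAdjoint_iff'.mp hA)]

theorem norm_sq_eq_of_isSelfAdjoint {A : H →L[ℂ] H} (hA : IsSelfAdjoint A) (v : H) :
    ‖A v‖ ^ 2 = (inner ℂ v ((A * A) v)).re := by
  have h := inner_self_eq_norm_sq_to_K (𝕜 := ℂ) (A v)
  rw [← ContinuousLinearMap.adjoint_inner_right,
    (ContinuousLinearMap.isSelfAdjoint_iff'.mp hA)] at h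
  rw [mul_apply_eq_comp, h]
  norm_cast

/-- The spectral measure, on the spectrum. -/
theorem exists_measure_cfcHom {T : H →L[ℂ] H} (hT : IsSelfAdjoint T) (v : H) :
    ∃ μ : Measure (spectrum ℝ T), IsFiniteMeasure μ ∧
      ∀ f : C(spectrum ℝ T, ℝ), (inner ℂ v (cfcHom hT f v)).re = ∫ x, f x ∂μ := by
  -- The spectrum is compact, so Riesz–Markov–Kakutani applies to all continuous functions on it.
  let Λ₀ : CompactlySupportedContinuousMap (spectrum ℝ T) ℝ →ₗ[ℝ] ℝ :=
    { toFun := fun f => (inner ℂ v (cfcHom hT (f : C(spectrum ℝ T, ℝ)) v)).re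
      map_add' := fun f g => by
        have : ((f + g : CompactlySupportedContinuousMap (spectrum ℝ T) ℝ) : C(spectrum ℝ T, ℝ)) =
          (f : C(spectrum ℝ T, ℝ)) + g := rfl
        rw [this, map_add, add_apply, inner_add_right, Complex.add_re]
      map_smul' := fun c f => by
        have : ((c • f : CompactlySupportedContinuousMap (spectrum ℝ T) ℝ) : C(spectrum ℝ T, ℝ)) =
          c • (f : C(spectrum ℝ T, ℝ)) := rfl
        rw [this, map_smul, smul_apply, inner_smul_right_eq_smul, Complex.smul_re]
        rfl }
  have hpos : ∀ f : CompactlySupportedContinuousMap (spectrum ℝ T) ℝ, 0 ≤ f → 0 ≤ Λ₀ f := by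
    intro f hf
    have h : 0 ≤ cfcHom hT (f : C(spectrum ℝ T, ℝ)) := (cfcHom_nonneg_iff hT).2 hf
    rw [ContinuousLinearMap.nonneg_iff_isPositive] at h
    exact (Complex.le_def.mp (h.inner_nonneg_right v)).1
  refine ⟨RealRMK.rieszMeasure (PositiveLinearMap.mk₀ Λ₀ hpos), inferInstance, fun f => ?_⟩
  exact (RealRMK.integral_rieszMeasure (PositiveLinearMap.mk₀ Λ₀ hpos)
    (CompactlySupportedContinuousMap.continuousMapEquiv f)).symm

/-- The spectral measure, on the line. -/
theorem exists_measure_cfc {T : H →L[ℂ] H} (hT : IsSelfAdjoint T) (v : H) :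
    ∃ μ : Measure ℝ, IsFiniteMeasure μ ∧ μ (spectrum ℝ T)ᶜ = 0 ∧
      ∀ f : ℝ → ℝ, Continuous f → inner ℂ v (cfc f T v) = ((∫ x, f x ∂μ : ℝ) : ℂ) := by
  obtain ⟨μ, hμ, h⟩ := exists_measure_cfcHom hT v
  have hm : Measurable (Subtype.val : spectrum ℝ T → ℝ) := measurable_subtype_coe
  refine ⟨μ.map Subtype.val, ⟨?_⟩, ?_, fun f hf => ?_⟩
  · rw [Measure.map_apply hm MeasurableSet.univ]
    exact measure_lt_top _ _
  · rw [Measure.map_apply hm (spectrum.isClosed T).isOpen_compl.measurableSet]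
    convert measure_empty (μ := μ)
    ext x; simp
  · rw [inner_eq_re_of_isSelfAdjoint (cfc_predicate f T), cfc_apply f T hT hf.continuousOn, h,
      integral_map hm.aemeasurable hf.aestronglyMeasurable]
    rfl

/-- The imaginary part of the resolvent is the Poisson kernel of the operator. -/
theorem im_inverse_eq_cfc {T : H →L[ℂ] H} (hT : IsSelfAdjoint T) (E : ℝ) {η : ℝ} (hη : 0 < η) :
    (2 * Complex.I)⁻¹ • (Ring.inverse (T - ((E : ℂ) + η * Complex.I) • ContinuousLinearMap.id ℂ H) -
      ContinuousLinearMap.adjoint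
        (Ring.inverse (T - ((E : ℂ) + η * Complex.I) • ContinuousLinearMap.id ℂ H))) =
      cfc (fun x : ℝ => η / ((x - E) ^ 2 + η ^ 2)) T := by
  have hpos : ∀ x : ℝ, (x - E) ^ 2 + η ^ 2 ≠ 0 := fun x => by positivity
  have hca : Continuous fun x : ℝ => (x - E) / ((x - E) ^ 2 + η ^ 2) := by fun_prop (disch := simpa)
  have hcb : Continuous fun x : ℝ => η / ((x - E) ^ 2 + η ^ 2) := by fun_prop (disch := simpa)
  -- The resolvent is `A + i C`, the real and imaginary parts of `1 / (x - E - iη)`; both are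
  -- self-adjoint.
  set A := cfc (fun x : ℝ => (x - E) / ((x - E) ^ 2 + η ^ 2)) T with hA
  set C := cfc (fun x : ℝ => η / ((x - E) ^ 2 + η ^ 2)) T with hC
  have hAs : ContinuousLinearMap.adjoint A = A :=
    ContinuousLinearMap.isSelfAdjoint_iff'.mp (cfc_predicate _ T)
  have hCs : ContinuousLinearMap.adjoint C = C :=
    ContinuousLinearMap.isSelfAdjoint_iff'.mp (cfc_predicate _ T)
  have hTE : cfc (fun x : ℝ => x - E) T = T - (E : ℂ) • (1 : H →L[ℂ] H) := by
    rw [cfc_sub (fun x : ℝ => x) (fun _ => E) T, cfc_id' ℝ T, cfc_const E T,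
      Algebra.algebraMap_eq_smul_one]
    congr 1
  have h1 : (T - (E : ℂ) • (1 : H →L[ℂ] H)) * A + (η : ℂ) • C = 1 := by
    have e2 : (η : ℂ) • C = cfc (fun x : ℝ => η * (η / ((x - E) ^ 2 + η ^ 2))) T := by
      rw [cfc_const_mul η _ T hcb.continuousOn]; rfl
    rw [← hTE, hA, ← cfc_mul _ _ T (by fun_prop) hca.continuousOn, e2,
      ← cfc_add T (fun x : ℝ => (x - E) * ((x - E) / ((x - E) ^ 2 + η ^ 2)))
        (fun x : ℝ => η * (η / ((x - E) ^ 2 + η ^ 2)))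
        ((continuous_id.sub continuous_const).mul hca).continuousOn
        (continuous_const.mul hcb).continuousOn,
      ← cfc_one ℝ T]
    congr 1; funext x
    have := hpos x
    simp only [Pi.one_apply]
    field_simp
  have h2 : (T - (E : ℂ) • (1 : H →L[ℂ] H)) * C = (η : ℂ) • A := by
    have e2 : (η : ℂ) • A = cfc (fun x : ℝ => η * ((x - E) / ((x - E) ^ 2 + η ^ 2))) T := by
      rw [cfc_const_mul η _ T hca.continuousOn]; rfl
    rw [← hTE, hC, e2, ← cfc_mul _ _ T (by fun_prop) hcb.continuousOn]
    congr 1; funext x; ring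
  have hTz : T - ((E : ℂ) + η * Complex.I) • ContinuousLinearMap.id ℂ H =
      (T - (E : ℂ) • (1 : H →L[ℂ] H)) - ((η : ℂ) * Complex.I) • 1 := by
    rw [add_smul, sub_sub]; rfl
  have hr : (T - ((E : ℂ) + η * Complex.I) • ContinuousLinearMap.id ℂ H) *
      (A + Complex.I • C) = 1 := by
    rw [hTz, sub_mul, mul_add, mul_smul_comm, h2, smul_mul_assoc, one_mul, smul_add, smul_smul,
      smul_smul, mul_assoc (η : ℂ), Complex.I_mul_I, mul_comm Complex.I, eq_sub_of_add_eq h1]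
    module
  have hcomm : Commute (T - ((E : ℂ) + η * Complex.I) • ContinuousLinearMap.id ℂ H)
      (A + Complex.I • C) := by
    have hT' : ∀ f : ℝ → ℝ, Commute T (cfc f T) := fun f =>
      ((Commute.refl T).cfc_real f).symm
    refine Commute.sub_left ?_ ?_
    · exact (hT' _).add_right ((hT' _).smul_right _)
    · exact (Commute.one_left _).smul_left _
  have hinv : Ring.inverse (T - ((E : ℂ) + η * Complex.I) • ContinuousLinearMap.id ℂ H) =
      A + Complex.I • C := by
    let u : (H →L[ℂ] H)ˣ := ⟨_, _, hr, hcomm.eq ▸ hr⟩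
    exact Ring.inverse_unit u
  rw [hinv, map_add, hAs, LinearIsometryEquiv.map_smulₛₗ, hCs, Complex.conj_I, ← sub_sub,
    add_sub_right_comm, sub_self, zero_add, neg_smul, sub_neg_eq_add, ← add_smul, smul_smul]
  convert one_smul ℂ C
  rw [← two_mul]
  exact inv_mul_cancel₀ (by simp)

/-- Spectral measures of a self-adjoint operator. -/
theorem exists_spectralMeasure {T : H →L[ℂ] H} (hT : IsSelfAdjoint T) {v : H} (hv : ‖v‖ = 1) :
    ∃ μ : Measure ℝ, IsProbabilityMeasure μ ∧ μ {x : ℝ | (x : ℂ) ∉ spectrum ℂ T} = 0 ∧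
      (∀ n : ℕ, inner ℂ v ((T ^ n) v) = ((∫ x, x ^ n ∂μ : ℝ) : ℂ)) ∧
      (∀ (E η : ℝ), 0 < η → ∃ R : H →L[ℂ] H,
        R = (2 * Complex.I)⁻¹ •
          (Ring.inverse (T - ((E : ℂ) + η * Complex.I) • ContinuousLinearMap.id ℂ H) -
          ContinuousLinearMap.adjoint
            (Ring.inverse (T - ((E : ℂ) + η * Complex.I) • ContinuousLinearMap.id ℂ H))) ∧
        inner ℂ v (R v) = ((∫ x, η / ((x - E) ^ 2 + η ^ 2) ∂μ : ℝ) : ℂ) ∧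
        ‖R v‖ ^ 2 = ∫ x, (η / ((x - E) ^ 2 + η ^ 2)) ^ 2 ∂μ ∧
        (∀ w, 0 ≤ (inner ℂ w (R w)).re) ∧ IsSelfAdjoint R ∧ (∀ C, Commute T C → Commute R C)) ∧
      ((∀ A : H →L[ℂ] H, (∀ C, Commute T C → Commute A C) → A v = 0 → A = 0) →
        ∀ E : ℝ, (E : ℂ) ∈ spectrum ℂ T → ∀ ε > 0, μ (Set.Ioo (E - ε) (E + ε)) ≠ 0) := by
  obtain ⟨μ, hμ, hnull, h⟩ := exists_measure_cfc hT v
  refine ⟨μ, ⟨?_⟩, ?_, fun n => ?_, fun E η hη => ⟨_, rfl, ?_⟩, fun hsep E hE ε hε h0 => ?_⟩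
  · have h1 := h (fun _ => 1) continuous_const
    rw [cfc_const_one ℝ T] at h1
    simp only [one_apply_eq_self, integral_const, smul_eq_mul, mul_one] at h1
    rw [inner_self_eq_norm_sq_to_K, hv] at h1
    have h2 : μ.real Set.univ = 1 := by
      have : (1 : ℂ) = (μ.real Set.univ : ℂ) := by simpa using h1
      exact_mod_cast this.symm
    rw [Measure.real, ENNReal.toReal_eq_one_iff] at h2
    exact h2
  · convert hnull using 2
    ext x
    exact (not_congr (hT.coe_mem_spectrum_complex))
  · rw [← h _ (continuous_pow n), cfc_pow_id T n hT]
  · have hpos : ∀ x : ℝ, (x - E) ^ 2 + η ^ 2 ≠ 0 := fun x => by positivity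
    have hcb : Continuous fun x : ℝ => η / ((x - E) ^ 2 + η ^ 2) := by fun_prop (disch := simpa)
    rw [im_inverse_eq_cfc hT E hη]
    refine ⟨h _ hcb, ?_, fun w => ?_, cfc_predicate _ T, fun C hC => hC.cfc_real _⟩
    · rw [norm_sq_eq_of_isSelfAdjoint (cfc_predicate _ T), ← cfc_mul _ _ T hcb.continuousOn
        hcb.continuousOn,
        h (fun x => η / ((x - E) ^ 2 + η ^ 2) * (η / ((x - E) ^ 2 + η ^ 2))) (hcb.mul hcb), Complex.ofReal_re]
      simp only [pow_two]
    · have hp : 0 ≤ cfc (fun x : ℝ => η / ((x - E) ^ 2 + η ^ 2)) T :=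
        cfc_nonneg fun x _ => by positivity
      rw [ContinuousLinearMap.nonneg_iff_isPositive] at hp
      exact (Complex.le_def.mp (hp.inner_nonneg_right w)).1
  -- If the interval were null, this tent function of `T` would kill `v` and so vanish by `hsep`;
  -- but its spectrum contains `f E = ε`.
  · let f : ℝ → ℝ := fun x => max 0 (ε - |x - E|)
    have hf : Continuous f := by fun_prop
    have hfv : cfc f T v = 0 := by
      rw [← norm_eq_zero, ← sq_eq_zero_iff, norm_sq_eq_of_isSelfAdjoint (cfc_predicate _ T),
        ← cfc_mul _ _ T hf.continuousOn hf.continuousOn, h (fun x => f x * f x) (hf.mul hf), Complex.ofReal_re]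
      refine integral_eq_zero_of_ae ?_
      filter_upwards [measure_eq_zero_iff_ae_notMem.mp h0] with x hx
      have : f x = 0 := by
        refine max_eq_left (sub_nonpos.mpr ?_)
        by_contra hlt
        rw [not_le, abs_lt] at hlt
        exact hx ⟨by linarith, by linarith⟩
      simp [this]
    have hf0 := hsep _ (fun C hC => hC.cfc_real f) hfv
    have hE' : E ∈ spectrum ℝ T := hT.coe_mem_spectrum_complex.mp hE
    have hfE : f E ∈ spectrum ℝ (cfc f T) := by
      rw [cfc_map_spectrum f T hT hf.continuousOn]
      exact ⟨E, hE', rfl⟩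
    rw [hf0] at hfE
    have : Nontrivial (H →L[ℂ] H) := by
      refine ⟨1, 0, fun h1 => ?_⟩
      have : v = 0 := by simpa using congrArg (fun A : H →L[ℂ] H => A v) h1
      rw [this, norm_zero] at hv
      exact zero_ne_one hv
    rw [spectrum.zero_eq, Set.mem_singleton_iff] at hfE
    simp [f] at hfE
    linarith

end Spectral

/-! ### Operators on `ℓ²` induced by permutations. -/

section PermutationOperators

variable {Γ : Type*}

theorem memℓp_comp_perm (F : Equiv.Perm Γ) (f : EllTwo Γ) : Memℓp (fun v => f (F v)) 2 := by
  have h := lp.memℓp f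
  rw [memℓp_gen_iff (by norm_num)] at h ⊢
  exact h.comp_injective F.injective

/-- The operator `f ↦ f ∘ F` on `ℓ²`. -/
def compPerm (F : Equiv.Perm Γ) : EllTwo Γ →L[ℂ] EllTwo Γ :=
  LinearMap.mkContinuous
    { toFun := fun f => (⟨fun v => f (F v), memℓp_comp_perm F f⟩ : EllTwo Γ)
      map_add' := fun _ _ => rfl
      map_smul' := fun _ _ => rfl } 1 fun f => by
    rw [one_mul]
    refine le_of_eq ?_
    have h2 : 0 < (2 : ℝ≥0∞).toReal := by norm_num
    rw [lp.norm_eq_tsum_rpow h2, lp.norm_eq_tsum_rpow h2]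
    congr 1
    exact F.tsum_eq fun v => ‖f v‖ ^ (2 : ℝ≥0∞).toReal

@[simp]
theorem compPerm_apply (F : Equiv.Perm Γ) (f : EllTwo Γ) (v : Γ) : compPerm F f v = f (F v) := rfl

theorem compPerm_delta (F : Equiv.Perm Γ) (g : Γ) : compPerm F (delta (F g)) = delta g := by
  classical
  ext v
  rw [compPerm_apply, delta_apply, delta_apply]
  exact if_congr F.injective.eq_iff rfl rfl

theorem eq_zero_of_apply_delta {A : EllTwo Γ →L[ℂ] EllTwo Γ} (h : ∀ g, A (delta g) = 0) :
    A = 0 := by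
  have h1 : ∀ v, ContinuousLinearMap.adjoint A (delta v) = 0 := by
    intro v
    ext w
    rw [← inner_delta_left, ContinuousLinearMap.adjoint_inner_right, h]
    simp
  ext f v
  rw [← inner_delta_left, ← ContinuousLinearMap.adjoint_inner_left, h1]
  simp

theorem kernel_perm {A : EllTwo Γ →L[ℂ] EllTwo Γ} {F : Equiv.Perm Γ}
    (h : Commute A (compPerm F)) (x y : Γ) : kernel A (F x) (F y) = kernel A x y := by
  rw [kernel_eq, kernel_eq, ← compPerm_delta F y]
  have : A (compPerm F (delta (F y))) = compPerm F (A (delta (F y))) := congrArg (· (delta (F y))) h.eq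
  rw [this, compPerm_apply]

end PermutationOperators

/-! ### Symmetries of the adjacency operator and decay of matrix entries. -/

section Adjacency

variable {B Γ : Type*} [Group Γ] {M : CoxeterMatrix B} {cs : CoxeterSystem M Γ}

theorem leftRegAlg_sum_genElt (s : Finset B) : leftRegAlg (∑ i ∈ s, genElt cs i) =
    ∑ i ∈ s, leftReg (cs.simple i) := by
  rw [leftRegAlg_eq, map_sum]
  refine Finset.sum_congr rfl fun i _ => ?_
  rw [genElt, ← leftRegAlg_eq]
  classical
  ext f v
  rw [leftRegAlg_apply]
  simp [MonoidAlgebra.coeff_single, leftReg_apply]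

theorem isSelfAdjoint_leftRegAlg_sum_genElt (s : Finset B) :
    IsSelfAdjoint (leftRegAlg (∑ i ∈ s, genElt cs i)) := by
  rw [leftRegAlg_sum_genElt, ContinuousLinearMap.isSelfAdjoint_iff', map_sum]
  exact Finset.sum_congr rfl fun i _ => by rw [adjoint_leftReg, cs.inv_simple]

theorem norm_leftReg_le (g : Γ) : ‖leftReg g‖ ≤ 1 :=
  ContinuousLinearMap.opNorm_le_bound _ zero_le_one fun f => by rw [norm_leftReg_apply, one_mul]

theorem norm_leftRegAlg_sum_genElt_le (s : Finset B) :
    ‖leftRegAlg (∑ i ∈ s, genElt cs i)‖ ≤ s.card := by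
  rw [leftRegAlg_sum_genElt]
  refine (norm_sum_le_of_le s fun i _ => norm_leftReg_le _).trans ?_
  simp

theorem inner_leftRegAlg_pow (p : MonoidAlgebra ℂ Γ) (n : ℕ) :
    inner ℂ (delta 1) ((leftRegAlg p ^ n) (delta 1)) = (p ^ n).coeff 1 := by
  rw [leftRegAlg_eq, ← map_pow, ← leftRegAlg_eq, inner_delta_left, leftRegAlg_delta_apply]
  simp

/-- The adjacency operator commutes with the automorphisms of the labelled Cayley graph, up to
permutations of the labels. -/
theorem commute_compPerm [Fintype B] {F : Equiv.Perm Γ}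
    (hF : ∀ v, ∃ π : Equiv.Perm B, ∀ s, F (cs.simple s * v) = cs.simple (π s) * F v) :
    Commute (leftRegAlg (∑ i, genElt cs i)) (compPerm F) := by
  rw [leftRegAlg_sum_genElt]
  refine ContinuousLinearMap.ext fun f => ?_
  ext v
  obtain ⟨π, hπ⟩ := hF v
  simp only [mul_apply_eq_comp, compPerm_apply, sum_apply, lp.coeFn_sum, Finset.sum_apply,
    leftReg_apply, cs.inv_simple, hπ]
  exact Equiv.sum_comp π fun i => f (cs.simple i * F v)

/-- Such an operator commutes with right translations, and these move `delta 1` to every other Dirac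
function. Hence the spectral measure at `delta 1` has full support in the spectrum. -/
theorem eq_zero_of_commute [Fintype B] {A : EllTwo Γ →L[ℂ] EllTwo Γ}
    (hA : ∀ C, Commute (leftRegAlg (∑ i, genElt cs i)) C → Commute A C) (h : A (delta 1) = 0) :
    A = 0 := by
  refine eq_zero_of_apply_delta fun g => ?_
  have h1 : Commute A (compPerm (Equiv.mulRight g⁻¹)) :=
    hA _ (commute_compPerm fun v => ⟨1, fun s => by simp [mul_assoc]⟩)
  have h2 : delta g = compPerm (Equiv.mulRight g⁻¹) (delta (1 : Γ)) := by
    rw [← compPerm_delta (Equiv.mulRight g⁻¹) g]; simp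
  have h3 : A (compPerm (Equiv.mulRight g⁻¹) (delta 1)) =
    compPerm (Equiv.mulRight g⁻¹) (A (delta 1)) := congrArg (· (delta 1)) h1.eq
  rw [h2, h3, h, map_zero]

/-- The squared entries of an operator in the von Neumann algebra of the adjacency operator
decay exponentially. -/
theorem kernel_sq_mul_two_pow_le [Fintype B] (hM : IsRightAngled M)
    (hflex : SuperFlexible (definingDiagram M)) {A : EllTwo Γ →L[ℂ] EllTwo Γ}
    (hsa : IsSelfAdjoint A)
    (hA : ∀ C, Commute (leftRegAlg (∑ i, genElt cs i)) C → Commute A C) (g : Γ) :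
    ‖kernel A 1 g‖ ^ 2 * 2 ^ (cs.length g / (2 * (Nat.card B + 1))) ≤ ‖A (delta 1)‖ ^ 2 := by
  have hk : ∀ x y : Γ, ‖kernel A x y‖ = ‖kernel A y x‖ := by
    intro x y
    rw [kernel, kernel, ← norm_inner_symm, ← ContinuousLinearMap.adjoint_inner_right,
      ContinuousLinearMap.isSelfAdjoint_iff'.mp hsa]
  have hr : ∀ x y h : Γ, kernel A (x * h) (y * h) = kernel A x y := fun x y h =>
    kernel_perm (F := Equiv.mulRight h)
      (hA _ (commute_compPerm fun v => ⟨1, fun s => by simp [mul_assoc]⟩)) x y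
  have hsum : HasSum (fun g => ‖kernel A 1 g‖ ^ 2) (‖A (delta 1)‖ ^ 2) := by
    simpa only [← kernel_eq, hk] using hasSum_norm_sq (A (delta (1 : Γ)))
  rw [← hsum.tsum_eq]
  refine sq_mul_two_pow_le (q := fun g => ‖kernel A 1 g‖) hM hflex (fun F hF g => ?_) (fun g => ?_)
    hsum.summable g
  · have := kernel_perm (hA _ (commute_compPerm hF.2)) 1 g
    rw [hF.1] at this
    simp only [this]
  · have := hr 1 g⁻¹ g
    rw [one_mul, inv_mul_cancel] at this
    simp only [← this, hk]

end Adjacency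

/-! ### Poisson integrals of the Kesten–McKay measure. -/

section PoissonIntegrals

open Real MeasureTheory

/-- The Poisson kernel of the upper half-plane. -/
def poisson (E η x : ℝ) : ℝ := η / ((x - E) ^ 2 + η ^ 2)

theorem continuous_poisson (E : ℝ) {η : ℝ} (hη : 0 < η) : Continuous (poisson E η) := by
  have : ∀ x : ℝ, (x - E) ^ 2 + η ^ 2 ≠ 0 := fun x => by positivity
  unfold poisson
  fun_prop (disch := simp [this])

theorem poisson_pos (E x : ℝ) {η : ℝ} (hη : 0 < η) : 0 < poisson E η x := by
  unfold poisson; positivity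

theorem poisson_le_inv (E x : ℝ) {η : ℝ} (hη : 0 < η) : poisson E η x ≤ 1 / η := by
  unfold poisson
  rw [div_le_div_iff₀ (by positivity) hη]
  nlinarith [sq_nonneg (x - E)]

theorem poisson_add (E η x y : ℝ) : poisson E η (x + y) = poisson (E - y) η x := by
  unfold poisson
  ring_nf

/-- Since `sin θ ≤ 1 ≤ kmDenom θ`, the angular density is at most `12/π · sin θ`. Against `sin θ`
the Poisson kernel has an arctangent as primitive, with increment at most `π / (2√2)`; this yields
`3√2 ≤ 6`. -/
theorem kmIntegral_poisson_le (c : ℝ) {η : ℝ} (hη : 0 < η) : kmIntegral (poisson c η) ≤ 6 := by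
  have hderiv : ∀ θ : ℝ, HasDerivAt (fun θ => -(arctan ((kmPoint θ - c) / η) / (2 * √2)))
      (sin θ * poisson c η (kmPoint θ)) θ := by
    intro θ
    have h1 : HasDerivAt (fun θ => (kmPoint θ - c) / η) (2 * √2 * -sin θ / η) θ :=
      (((hasDerivAt_cos θ).const_mul (2 * √2)).sub_const c).div_const η
    have h2 := ((h1.arctan).div_const (2 * √2)).neg
    refine h2.congr_deriv ?_
    unfold poisson
    have : (√2) ≠ 0 := by positivity
    have : (kmPoint θ - c) ^ 2 + η ^ 2 ≠ 0 := by positivity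
    have : 1 + ((kmPoint θ - c) / η) ^ 2 ≠ 0 := by positivity
    field_simp
    ring
  have hcont : Continuous fun θ => sin θ * poisson c η (kmPoint θ) :=
    continuous_sin.mul ((continuous_poisson c hη).comp continuous_kmPoint)
  have hint : ∫ θ in (0 : ℝ)..π, sin θ * poisson c η (kmPoint θ) ≤ π / (2 * √2) := by
    rw [intervalIntegral.integral_eq_sub_of_hasDerivAt (fun θ _ => hderiv θ)
      (hcont.intervalIntegrable _ _)]
    have ha := neg_pi_div_two_lt_arctan ((kmPoint π - c) / η)
    have hb := arctan_lt_pi_div_two ((kmPoint 0 - c) / η)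
    rw [neg_sub_neg, ← sub_div]
    gcongr
    linarith
  have hle : kmIntegral (poisson c η) ≤
      ∫ θ in (0 : ℝ)..π, 12 / π * (sin θ * poisson c η (kmPoint θ)) := by
    refine intervalIntegral.integral_mono_on pi_pos.le
      ((continuous_kmDensity.mul ((continuous_poisson c hη).comp
        continuous_kmPoint)).intervalIntegrable _ _)
      ((continuous_const.mul hcont).intervalIntegrable _ _) fun θ hθ => ?_
    rw [← mul_assoc]
    refine mul_le_mul_of_nonneg_right ?_ (poisson_pos _ _ hη).le
    unfold kmDensity
    have hs := sin_nonneg_of_mem_Icc hθ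
    refine mul_le_mul_of_nonneg_left ?_ (by positivity)
    rw [div_le_iff₀ (kmDenom_pos θ)]
    nlinarith [sin_le_one θ, one_le_kmDenom θ]
  refine hle.trans ?_
  rw [intervalIntegral.integral_const_mul]
  refine (mul_le_mul_of_nonneg_left hint (by positivity)).trans ?_
  have h2 : (1 : ℝ) ≤ √2 := by rw [Real.one_le_sqrt]; norm_num
  rw [div_mul_div_comm, div_le_iff₀ (by positivity)]
  nlinarith [pi_pos]

/-- The point `c` has an angle `θ₀` with `sin θ₀ ≥ δ`. On the angular window of length `δ η` around
it the density is at least `δ² / (3π)` and the Poisson kernel at least `1 / (3η)`. -/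
theorem le_kmIntegral_poisson {c δ η : ℝ} (hδ : 0 < δ) (hδ1 : δ ≤ 1) (hc : c ^ 2 ≤ 8 * (1 - δ ^ 2))
    (hη : 0 < η) (hη1 : η ≤ 1) : δ ^ 3 / (9 * π) ≤ kmIntegral (poisson c η) := by
  have h22 : √2 ^ 2 = 2 := Real.sq_sqrt zero_le_two
  set t := c / (2 * √2) with ht
  have hct : c = 2 * √2 * t := by rw [ht]; field_simp
  have ht2 : t ^ 2 ≤ 1 - δ ^ 2 := by
    have : c ^ 2 = 8 * t ^ 2 := by rw [hct, mul_pow, mul_pow, h22]; ring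
    linarith
  have hta : |t| ≤ 1 := by
    rw [← sq_le_one_iff_abs_le_one]; nlinarith
  set θ₀ := arccos t with hθ₀
  have hcos : cos θ₀ = t := cos_arccos (abs_le.mp hta).1 (abs_le.mp hta).2
  have hsin : δ ≤ sin θ₀ := by
    rw [hθ₀, sin_arccos]
    exact Real.le_sqrt_of_sq_le (by linarith)
  have h0 : 0 ≤ θ₀ := arccos_nonneg t
  have hπ : θ₀ ≤ π := arccos_le_pi t
  have hl : δ ≤ θ₀ := hsin.trans (sin_le h0)
  have hr : δ ≤ π - θ₀ := hsin.trans (by rw [← sin_pi_sub]; exact sin_le (by linarith))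
  have hδη : δ * η ≤ δ := mul_le_of_le_one_right hδ.le hη1
  have hcont : Continuous fun θ => kmDensity θ * poisson c η (kmPoint θ) :=
    continuous_kmDensity.mul ((continuous_poisson c hη).comp continuous_kmPoint)
  have hlow : ∀ θ ∈ Set.Icc (θ₀ - δ * η / 2) (θ₀ + δ * η / 2),
      δ ^ 2 / (9 * π * η) ≤ kmDensity θ * poisson c η (kmPoint θ) := by
    intro θ hθ
    have habs : |θ - θ₀| ≤ δ * η / 2 := abs_le.mpr ⟨by linarith [hθ.1], by linarith [hθ.2]⟩
    have hs : δ / 2 ≤ sin θ := by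
      have h1 := abs_sin_sub_sin_le θ θ₀
      have := (abs_le.mp (h1.trans habs)).1
      linarith
    have hc' : |cos θ - cos θ₀| ≤ δ * η / 2 := (abs_cos_sub_cos_le θ θ₀).trans habs
    have hden : (kmPoint θ - c) ^ 2 + η ^ 2 ≤ 3 * η ^ 2 := by
      have e : (kmPoint θ - c) ^ 2 = 8 * (cos θ - cos θ₀) ^ 2 := by
        rw [hct, ← hcos, kmPoint, ← mul_sub, mul_pow, mul_pow, h22]; ring
      have h3 : (cos θ - cos θ₀) ^ 2 ≤ (δ * η / 2) ^ 2 := sq_le_sq' (abs_le.mp hc').1 (abs_le.mp hc').2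
      have h4 : (δ * η / 2) ^ 2 ≤ (η / 2) ^ 2 := by
        gcongr
        exact mul_le_of_le_one_left hη.le hδ1
      rw [e]; nlinarith
    have hp : 1 / (3 * η) ≤ poisson c η (kmPoint θ) := by
      unfold poisson
      rw [div_le_div_iff₀ (by positivity) (by positivity)]
      nlinarith
    have hd : δ ^ 2 / (3 * π) ≤ kmDensity θ := by
      unfold kmDensity
      have h5 : (δ / 2) ^ 2 / 9 ≤ sin θ ^ 2 / kmDenom θ := by
        gcongr
        · exact kmDenom_pos θ
        · exact kmDenom_le θ
      calc δ ^ 2 / (3 * π) = 12 / π * ((δ / 2) ^ 2 / 9) := by field_simp; norm_num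
        _ ≤ _ := mul_le_mul_of_nonneg_left h5 (by positivity)
    calc δ ^ 2 / (9 * π * η) = δ ^ 2 / (3 * π) * (1 / (3 * η)) := by field_simp; norm_num
      _ ≤ _ := mul_le_mul hd hp (by positivity) (kmDensity_nonneg θ)
  have hδη0 : 0 < δ * η := mul_pos hδ hη
  calc δ ^ 3 / (9 * π) = ∫ _ in (θ₀ - δ * η / 2)..(θ₀ + δ * η / 2), δ ^ 2 / (9 * π * η) := by
        rw [intervalIntegral.integral_const, smul_eq_mul]; field_simp; ring
    _ ≤ ∫ θ in (θ₀ - δ * η / 2)..(θ₀ + δ * η / 2), kmDensity θ * poisson c η (kmPoint θ) :=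
        intervalIntegral.integral_mono_on (by linarith) (by simp)
          (hcont.intervalIntegrable _ _) hlow
    _ ≤ kmIntegral (poisson c η) :=
        intervalIntegral.integral_mono_interval (by linarith) (by linarith) (by linarith)
          (ae_of_all _ fun θ => mul_nonneg (kmDensity_nonneg θ) (poisson_pos _ _ hη).le)
          (hcont.intervalIntegrable _ _)

end PoissonIntegrals

/-! ### From moments to a convolution of measures. -/

section Weierstrass

open MeasureTheory Polynomial

/-- Two functionals which are nonexpansive for the supremum norm on an interval and agree on
polynomials agree on continuous functions. -/
theorem eq_of_forall_polynomial {R : ℝ} {L₁ L₂ : (ℝ → ℝ) → ℝ}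
    (h₁ : ∀ f g : ℝ → ℝ, Continuous f → Continuous g → ∀ ε : ℝ,
      (∀ x ∈ Set.Icc (-R) R, |f x - g x| ≤ ε) → |L₁ f - L₁ g| ≤ ε)
    (h₂ : ∀ f g : ℝ → ℝ, Continuous f → Continuous g → ∀ ε : ℝ,
      (∀ x ∈ Set.Icc (-R) R, |f x - g x| ≤ ε) → |L₂ f - L₂ g| ≤ ε)
    (h : ∀ p : ℝ[X], L₁ (fun x => p.eval x) = L₂ (fun x => p.eval x)) {f : ℝ → ℝ}
    (hf : Continuous f) : L₁ f = L₂ f := by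
  refine eq_of_forall_dist_le fun ε hε => ?_
  obtain ⟨p, hp⟩ := exists_polynomial_near_of_continuousOn (-R) R f hf.continuousOn (ε / 2)
    (half_pos hε)
  have hp' : ∀ x ∈ Set.Icc (-R) R, |f x - p.eval x| ≤ ε / 2 := fun x hx => by
    rw [abs_sub_comm]; exact (hp x hx).le
  have e1 := h₁ f _ hf p.continuous _ hp'
  have e2 := h₂ f _ hf p.continuous _ hp'
  rw [h] at e1
  rw [abs_sub_comm] at e2
  rw [Real.dist_eq]
  calc |L₁ f - L₂ f| ≤ _ := abs_sub_le _ (L₂ fun x => p.eval x) _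
    _ ≤ ε := by linarith

theorem integrable_of_continuous_of_null {μ : Measure ℝ} [IsFiniteMeasure μ] {R : ℝ}
    (hμ : μ (Set.Icc (-R) R)ᶜ = 0) {f : ℝ → ℝ} (hf : Continuous f) : Integrable f μ := by
  obtain ⟨C, hC⟩ := (isCompact_Icc (a := -R) (b := R)).exists_bound_of_continuousOn hf.continuousOn
  refine Integrable.of_bound hf.aestronglyMeasurable C ?_
  filter_upwards [measure_eq_zero_iff_ae_notMem.mp hμ] with x hx
  exact hC x (by simpa using hx)

theorem integral_mono_of_null {μ : Measure ℝ} [IsFiniteMeasure μ] {R : ℝ}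
    (hμ : μ (Set.Icc (-R) R)ᶜ = 0) {f g : ℝ → ℝ} (hf : Continuous f) (hg : Continuous g)
    (h : ∀ x ∈ Set.Icc (-R) R, f x ≤ g x) : ∫ x, f x ∂μ ≤ ∫ x, g x ∂μ := by
  refine integral_mono_ae (integrable_of_continuous_of_null hμ hf)
    (integrable_of_continuous_of_null hμ hg) ?_
  filter_upwards [measure_eq_zero_iff_ae_notMem.mp hμ] with x hx
  exact h x (by simpa using hx)

theorem abs_integral_sub_le {μ : Measure ℝ} [IsProbabilityMeasure μ] {R : ℝ}
    (hμ : μ (Set.Icc (-R) R)ᶜ = 0) {f g : ℝ → ℝ} (hf : Continuous f) (hg : Continuous g) {ε : ℝ}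
    (h : ∀ x ∈ Set.Icc (-R) R, |f x - g x| ≤ ε) : |∫ x, f x ∂μ - ∫ x, g x ∂μ| ≤ ε := by
  have hi := integrable_of_continuous_of_null hμ hf
  have hj := integrable_of_continuous_of_null hμ hg
  have h1 := integral_mono_of_null hμ hf (hg.add continuous_const)
    (g := fun x => g x + ε) fun x hx => by linarith [(abs_le.mp (h x hx)).2]
  have h2 := integral_mono_of_null hμ hg (hf.add continuous_const)
    (g := fun x => f x + ε) fun x hx => by linarith [(abs_le.mp (h x hx)).1]
  rw [integral_add hj (integrable_const _), integral_const] at h1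
  rw [integral_add hi (integrable_const _), integral_const] at h2
  simp only [probReal_univ, one_smul] at h1 h2
  exact abs_le.mpr ⟨by linarith, by linarith⟩

theorem kmIntegral_add {f g : ℝ → ℝ} (hf : Continuous f) (hg : Continuous g) :
    kmIntegral (fun x => f x + g x) = kmIntegral f + kmIntegral g := by
  simp only [kmIntegral, mul_add]
  exact intervalIntegral.integral_add
    ((continuous_kmDensity.mul (hf.comp continuous_kmPoint)).intervalIntegrable _ _)
    ((continuous_kmDensity.mul (hg.comp continuous_kmPoint)).intervalIntegrable _ _)

theorem kmIntegral_const_mul (c : ℝ) (f : ℝ → ℝ) :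
    kmIntegral (fun x => c * f x) = c * kmIntegral f := by
  simp only [kmIntegral]
  rw [← intervalIntegral.integral_const_mul]
  congr 1; funext θ; ring

theorem kmIntegral_const (c : ℝ) : kmIntegral (fun _ => c) = c := by
  have := kmIntegral_const_mul c fun _ => 1
  simpa [kmIntegral_one] using this

theorem kmIntegral_sum {ι : Type*} (s : Finset ι) {f : ι → ℝ → ℝ} (hf : ∀ i, Continuous (f i)) :
    kmIntegral (fun x => ∑ i ∈ s, f i x) = ∑ i ∈ s, kmIntegral (f i) := by
  classical
  induction s using Finset.induction_on with
  | empty => simpa using kmIntegral_const 0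
  | insert a s ha ih =>
    simp only [Finset.sum_insert ha]
    rw [kmIntegral_add (hf a) (by fun_prop), ih]

theorem continuous_kmIntegral_add {f : ℝ → ℝ} (hf : Continuous f) :
    Continuous fun y => kmIntegral fun x => f (x + y) := by
  have h1 := continuous_kmDensity
  have h2 := continuous_kmPoint
  exact intervalIntegral.continuous_parametric_intervalIntegral_of_continuous'
    (f := fun y θ => kmDensity θ * f (kmPoint θ + y)) (by fun_prop) 0 Real.pi

/-- A measure whose moments are those of a convolution with the spectral measure of the tree. -/
theorem integral_eq_integral_kmIntegral {μ μ' : Measure ℝ} [IsProbabilityMeasure μ]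
    [IsProbabilityMeasure μ'] {R : ℝ} (hμ : μ (Set.Icc (-R) R)ᶜ = 0)
    (hμ' : μ' (Set.Icc (-R) R)ᶜ = 0)
    (hmom : ∀ n : ℕ, ∫ x, x ^ n ∂μ = ∑ k ∈ Finset.range (n + 1),
      kmIntegral (fun x => x ^ k) * (∫ y, y ^ (n - k) ∂μ') * n.choose k) {f : ℝ → ℝ}
    (hf : Continuous f) : ∫ x, f x ∂μ = ∫ y, kmIntegral (fun x => f (x + y)) ∂μ' := by
  -- Sums of a point of `[-R, R]` and a point of the tree spectrum lie in the larger interval, where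
  -- the polynomial approximation must hold.
  have hR : R ≤ R + 2 * √2 := by simp
  have hsub : ∀ ν : Measure ℝ, ν (Set.Icc (-R) R)ᶜ = 0 →
      ν (Set.Icc (-(R + 2 * √2)) (R + 2 * √2))ᶜ = 0 := fun ν h =>
    measure_mono_null (Set.compl_subset_compl.mpr (Set.Icc_subset_Icc (by linarith) hR)) h
  refine eq_of_forall_polynomial (R := R + 2 * √2) (L₁ := fun f => ∫ x, f x ∂μ)
    (L₂ := fun f => ∫ y, kmIntegral (fun x => f (x + y)) ∂μ')
    (fun f g hf hg ε h => abs_integral_sub_le (hsub μ hμ) hf hg h) (fun f g hf hg ε h => ?_)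
    (fun p => ?_) hf
  · refine abs_integral_sub_le hμ' (continuous_kmIntegral_add hf) (continuous_kmIntegral_add hg)
      fun y hy => ?_
    have hf' : Continuous fun x => f (x + y) := by fun_prop
    have hg' : Continuous fun x => g (x + y) := by fun_prop
    have hxy : ∀ x, |x| ≤ 2 * √2 → |f (x + y) - g (x + y)| ≤ ε := fun x hx =>
      h _ ⟨by linarith [(abs_le.mp hx).1, hy.1], by linarith [(abs_le.mp hx).2, hy.2]⟩
    have e1 := kmIntegral_congr_le hf' (hg'.add continuous_const) (g := fun x => g (x + y) + ε)
      fun x hx => by linarith [(abs_le.mp (hxy x hx)).2]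
    have e2 := kmIntegral_congr_le hg' (hf'.add continuous_const) (g := fun x => f (x + y) + ε)
      fun x hx => by linarith [(abs_le.mp (hxy x hx)).1]
    rw [kmIntegral_add hg' continuous_const, kmIntegral_const] at e1
    rw [kmIntegral_add hf' continuous_const, kmIntegral_const] at e2
    exact abs_le.mpr ⟨by linarith, by linarith⟩
  · induction p using Polynomial.induction_on' with
    | add p q hp hq =>
      simp only [eval_add]
      rw [integral_add (integrable_of_continuous_of_null hμ p.continuous)
        (integrable_of_continuous_of_null hμ q.continuous), hp, hq, ← integral_add
        (integrable_of_continuous_of_null hμ' (continuous_kmIntegral_add p.continuous))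
        (integrable_of_continuous_of_null hμ' (continuous_kmIntegral_add q.continuous))]
      congr 1; funext y
      have := p.continuous
      have := q.continuous
      rw [kmIntegral_add (f := fun x => p.eval (x + y)) (g := fun x => q.eval (x + y))
        (by fun_prop) (by fun_prop)]
    | monomial n a =>
      simp only [eval_monomial, kmIntegral_const_mul]
      rw [integral_const_mul, integral_const_mul, hmom]
      congr 1
      have : ∀ y : ℝ, kmIntegral (fun x => (x + y) ^ n) = ∑ k ∈ Finset.range (n + 1),
          kmIntegral (fun x => x ^ k) * y ^ (n - k) * n.choose k := by
        intro y
        simp only [add_pow]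
        rw [kmIntegral_sum _ fun i => by fun_prop]
        refine Finset.sum_congr rfl fun k _ => ?_
        rw [mul_assoc, mul_comm, ← kmIntegral_const_mul]
        congr 1; funext x; ring
      simp only [this]
      rw [integral_finsetSum _ fun k _ =>
        integrable_of_continuous_of_null hμ' (by fun_prop)]
      refine Finset.sum_congr rfl fun k _ => ?_
      rw [integral_mul_const, integral_const_mul]

end Weierstrass

/-! ### The exceptional set of the spectrum. -/

section Exceptional

open MeasureTheory

variable {μ μ' : Measure ℝ} {R : ℝ}

theorem integral_poisson_le [IsProbabilityMeasure μ'] (hμ' : μ' (Set.Icc (-R) R)ᶜ = 0)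
    (hconv : ∀ f : ℝ → ℝ, Continuous f →
      ∫ x, f x ∂μ = ∫ y, kmIntegral (fun x => f (x + y)) ∂μ') (E : ℝ) {η : ℝ} (hη : 0 < η) :
    ∫ x, poisson E η x ∂μ ≤ 6 := by
  rw [hconv _ (continuous_poisson E hη)]
  have h := integral_mono_of_null hμ' (continuous_kmIntegral_add (continuous_poisson E hη))
    (continuous_const (y := (6 : ℝ))) fun y _ => by
      simp only [poisson_add]
      exact kmIntegral_poisson_le (E - y) hη
  simpa using h

variable (μ') in
/-- The points at distance less than `2√2` from the support of a measure. -/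
def innerSpectrum : Set ℝ := {E | ∃ δ : ℝ, 0 < δ ∧ δ ≤ 1 ∧
  μ' (Set.Icc (E - 2 * √2 * (1 - δ)) (E + 2 * √2 * (1 - δ))) ≠ 0}

/-- Replacing the margin `δ` by `δ / 2` leaves room to move `E` by less than `√2 δ`. The mass of
`μ'` that was charged stays inside, and each of its points contributes the lower bound for the tree.
-/
theorem exists_lower_bound_of_mem_innerSpectrum [IsProbabilityMeasure μ']
    (hμ' : μ' (Set.Icc (-R) R)ᶜ = 0)
    (hconv : ∀ f : ℝ → ℝ, Continuous f →
      ∫ x, f x ∂μ = ∫ y, kmIntegral (fun x => f (x + y)) ∂μ') {E : ℝ}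
    (hE : E ∈ innerSpectrum μ') : ∃ ε > 0, ∃ c > 0, ∀ E' ∈ Set.Ioo (E - ε) (E + ε),
      E' ∈ innerSpectrum μ' ∧ ∀ η : ℝ, 0 < η → η ≤ 1 → c ≤ ∫ x, poisson E' η x ∂μ := by
  obtain ⟨δ, hδ, hδ1, hm⟩ := hE
  have h2 : (0 : ℝ) < √2 := by positivity
  have h22 : √2 ^ 2 = 2 := Real.sq_sqrt zero_le_two
  set A := Set.Icc (E - 2 * √2 * (1 - δ)) (E + 2 * √2 * (1 - δ)) with hA
  have hm' : 0 < μ'.real A := ENNReal.toReal_pos hm (measure_ne_top _ _)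
  refine ⟨√2 * δ, by positivity, (δ / 2) ^ 3 / (9 * Real.pi) * μ'.real A, by positivity,
    fun E' hE' => ?_⟩
  have hsub : A ⊆ Set.Icc (E' - 2 * √2 * (1 - δ / 2)) (E' + 2 * √2 * (1 - δ / 2)) :=
    Set.Icc_subset_Icc (by nlinarith [hE'.2]) (by nlinarith [hE'.1])
  refine ⟨⟨δ / 2, by positivity, by linarith, fun h => hm (measure_mono_null hsub h)⟩,
    fun η hη hη1 => ?_⟩
  rw [hconv _ (continuous_poisson E' hη)]
  simp only [poisson_add]
  have hcont : Continuous fun y => kmIntegral (poisson (E' - y) η) := by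
    simpa only [poisson_add] using continuous_kmIntegral_add (continuous_poisson E' hη)
  have hge : ∀ y ∈ A, (δ / 2) ^ 3 / (9 * Real.pi) ≤ kmIntegral (poisson (E' - y) η) := by
    intro y hy
    refine le_kmIntegral_poisson (half_pos hδ) (by linarith) ?_ hη hη1
    have hy' := hsub hy
    have h3 : |E' - y| ≤ 2 * √2 * (1 - δ / 2) :=
      abs_le.mpr ⟨by linarith [hy'.2], by linarith [hy'.1]⟩
    calc (E' - y) ^ 2 ≤ (2 * √2 * (1 - δ / 2)) ^ 2 := sq_le_sq' (abs_le.mp h3).1 (abs_le.mp h3).2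
      _ = 8 * (1 - δ / 2) ^ 2 := by rw [mul_pow, mul_pow, h22]; norm_num
      _ ≤ _ := by nlinarith
  refine le_trans ?_ (mul_meas_ge_le_integral_of_nonneg (ε := (δ / 2) ^ 3 / (9 * Real.pi)) ?_ ?_)
  · exact mul_le_mul_of_nonneg_left (measureReal_mono fun y hy => hge y hy) (by positivity)
  · refine ae_of_all _ fun y => ?_
    have := kmIntegral_congr_le continuous_const (continuous_poisson (E' - y) hη) (f := fun _ => 0)
      fun x _ => (poisson_pos _ _ hη).le
    rwa [kmIntegral_const] at this
  · exact integrable_of_continuous_of_null hμ' hcont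

theorem measure_Ioo_eq_zero_of_notMem {E : ℝ} (hE : E ∉ innerSpectrum μ') :
    μ' (Set.Ioo (E - 2 * √2) (E + 2 * √2)) = 0 := by
  have h2 : (0 : ℝ) < √2 := by positivity
  have hsub : Set.Ioo (E - 2 * √2) (E + 2 * √2) ⊆ ⋃ n : ℕ,
      Set.Icc (E - 2 * √2 * (1 - 1 / (n + 1 : ℝ))) (E + 2 * √2 * (1 - 1 / (n + 1 : ℝ))) := by
    intro y hy
    have habs : |y - E| < 2 * √2 := abs_lt.mpr ⟨by linarith [hy.1], by linarith [hy.2]⟩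
    obtain ⟨n, hn⟩ := exists_nat_one_div_lt (K := ℝ) (ε := 1 - |y - E| / (2 * √2))
      (by rw [sub_pos, div_lt_one (by positivity)]; exact habs)
    have h3 : |y - E| ≤ 2 * √2 * (1 - 1 / (n + 1 : ℝ)) := by
      rw [mul_comm, ← div_le_iff₀ (by positivity)]
      linarith
    exact Set.mem_iUnion.mpr ⟨n, by linarith [(abs_le.mp h3).1], by linarith [(abs_le.mp h3).2]⟩
  refine measure_mono_null hsub (measure_iUnion_null fun n => ?_)
  by_contra h
  refine hE ⟨1 / (n + 1 : ℝ), by positivity, ?_, h⟩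
  rw [div_le_one (by positivity)]
  linarith [n.cast_nonneg (α := ℝ)]

/-- The topological support on the line. -/
def lineSupport (ν : Measure ℝ) : Set ℝ := {t | ∀ ε > 0, ν (Set.Ioo (t - ε) (t + ε)) ≠ 0}

theorem notMem_lineSupport {ν : Measure ℝ} {a b t : ℝ} (h : ν (Set.Ioo a b) = 0)
    (ht : t ∈ Set.Ioo a b) : t ∉ lineSupport ν := by
  intro hs
  refine hs (min (t - a) (b - t)) (lt_min (by linarith [ht.1]) (by linarith [ht.2]))
    (measure_mono_null (Set.Ioo_subset_Ioo ?_ ?_) h)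
  · linarith [min_le_left (t - a) (b - t)]
  · linarith [min_le_right (t - a) (b - t)]

/-- The open interval of radius `2√2` about `E` is null for `μ'`. If neither endpoint were in the
support, a slightly larger interval would be null too, and the convolution would give no mass to a
neighbourhood of `E`. -/
theorem mem_lineSupport_or_mem_lineSupport [IsProbabilityMeasure μ]
    (hμ : μ (Set.Icc (-R) R)ᶜ = 0)
    (hconv : ∀ f : ℝ → ℝ, Continuous f →
      ∫ x, f x ∂μ = ∫ y, kmIntegral (fun x => f (x + y)) ∂μ') {E : ℝ}
    (hE : E ∈ lineSupport μ) (hE' : E ∉ innerSpectrum μ') :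
    E - 2 * √2 ∈ lineSupport μ' ∨ E + 2 * √2 ∈ lineSupport μ' := by
  by_contra! h
  obtain ⟨h1, h2⟩ := h
  simp only [lineSupport, Set.mem_ofPred_eq, not_forall, not_not] at h1 h2
  obtain ⟨ε₁, hε₁, h1⟩ := h1
  obtain ⟨ε₂, hε₂, h2⟩ := h2
  have h0 := measure_Ioo_eq_zero_of_notMem hE'
  set ε := min ε₁ ε₂ with hε
  have hεpos : 0 < ε := lt_min hε₁ hε₂
  have hl : ε ≤ ε₁ := min_le_left _ _
  have hr : ε ≤ ε₂ := min_le_right _ _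
  have hnull : ∀ᵐ y ∂μ', ε + 2 * √2 ≤ |y - E| := by
    filter_upwards [measure_eq_zero_iff_ae_notMem.mp h0, measure_eq_zero_iff_ae_notMem.mp h1,
      measure_eq_zero_iff_ae_notMem.mp h2] with y g0 g1 g2
    simp only [Set.mem_Ioo, not_and_or, not_lt] at g0 g1 g2
    rw [le_abs]
    rcases g0 with g0 | g0
    · right
      rcases g1 with g1 | g1 <;> linarith
    · left
      rcases g2 with g2 | g2 <;> linarith
  let f : ℝ → ℝ := fun x => max 0 (ε - |x - E|)
  have hf : Continuous f := by fun_prop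
  have hf0 : ∫ x, f x ∂μ = 0 := by
    rw [hconv f hf]
    refine integral_eq_zero_of_ae ?_
    filter_upwards [hnull] with y hy
    have hz : ∀ x : ℝ, |x| ≤ 2 * √2 → f (x + y) = 0 := by
      intro x hx
      refine max_eq_left (sub_nonpos.mpr ?_)
      have := abs_sub_abs_le_abs_sub (y - E) (-x)
      rw [abs_neg, sub_neg_eq_add, show y - E + x = x + y - E by ring] at this
      linarith
    have hfy : Continuous fun x => f (x + y) := by fun_prop
    have e1 := kmIntegral_congr_le hfy continuous_const (g := fun _ => 0) fun x hx => (hz x hx).le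
    have e2 := kmIntegral_congr_le continuous_const hfy (f := fun _ => 0) fun x hx => (hz x hx).ge
    rw [kmIntegral_const] at e1 e2
    exact le_antisymm e1 e2
  rw [integral_eq_zero_iff_of_nonneg (f := f) (fun x => le_max_left _ _)
    (integrable_of_continuous_of_null hμ hf)] at hf0
  refine hE ε hεpos (measure_eq_zero_iff_ae_notMem.mpr ?_)
  filter_upwards [hf0] with x hx hx'
  have habs : |x - E| < ε := abs_lt.mpr ⟨by linarith [hx'.1], by linarith [hx'.2]⟩
  have : 0 < f x := lt_max_of_lt_right (sub_pos.mpr habs)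
  exact this.ne' hx

theorem finite_of_floor_injOn {S : Set ℝ} (hb : S ⊆ Set.Icc (-R) R)
    (h : ∀ x ∈ S, ∀ y ∈ S, x < y → y < x + 1 → False) : S.Finite := by
  refine Set.Finite.of_finite_image (f := Int.floor)
    ((Set.finite_Icc ⌊-R⌋ ⌊R⌋).subset ?_) fun x hx y hy hxy => ?_
  · rintro _ ⟨x, hx, rfl⟩
    exact ⟨Int.floor_le_floor (hb hx).1, Int.floor_le_floor (hb hx).2⟩
  · have hd := abs_lt.mp (Int.abs_sub_lt_one_of_floor_eq_floor hxy)
    rcases lt_trichotomy x y with hlt | heq | hgt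
    · exact (h x hx y hy hlt (by linarith [hd.1])).elim
    · exact heq
    · exact (h y hy x hx hgt (by linarith [hd.2])).elim

/-- The spectrum is an open set with locally bounded spectral density, up to finitely many
points. -/
theorem exists_exceptional_set [IsProbabilityMeasure μ] [IsProbabilityMeasure μ']
    (hμ : μ (Set.Icc (-R) R)ᶜ = 0) (hμ' : μ' (Set.Icc (-R) R)ᶜ = 0)
    (hconv : ∀ f : ℝ → ℝ, Continuous f →
      ∫ x, f x ∂μ = ∫ y, kmIntegral (fun x => f (x + y)) ∂μ')
    {σ : Set ℝ} (hσ : IsClosed σ) (hsub : σ ⊆ lineSupport μ) (hnull : μ σᶜ = 0) :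
    ∃ D : Set ℝ, D.Finite ∧ IsOpen (σ \ D) ∧ ∀ a b : ℝ, Set.Icc a b ⊆ σ \ D →
      ∃ c > 0, ∀ E ∈ Set.Icc a b, ∀ η : ℝ, 0 < η → η ≤ 1 → c ≤ ∫ x, poisson E η x ∂μ := by
  have h2 : (1 : ℝ) ≤ √2 := by rw [Real.one_le_sqrt]; norm_num
  have hU : innerSpectrum μ' ⊆ σ := by
    intro E hE
    by_contra hEσ
    obtain ⟨ε, hε, hball⟩ := Metric.isOpen_iff.mp hσ.isOpen_compl E hEσ
    obtain ⟨ε', hε', c, hc, hlow⟩ := exists_lower_bound_of_mem_innerSpectrum hμ' hconv hE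
    have hlow' := (hlow E ⟨by linarith, by linarith⟩).2
    -- At distance at least `ε` from `E` the Poisson kernel is at most `η / ε² ≤ c / 2`, which
    -- contradicts the lower bound `c`.
    set η := min 1 (c * ε ^ 2 / 2) with hη
    have hη0 : 0 < η := lt_min one_pos (by positivity)
    have h1 := hlow' η hη0 (min_le_left _ _)
    have h3 : ∫ x, poisson E η x ∂μ ≤ ∫ _, c / 2 ∂μ := by
      refine integral_mono_ae (integrable_of_continuous_of_null hμ (continuous_poisson E hη0))
        (integrable_const _) ?_
      filter_upwards [measure_eq_zero_iff_ae_notMem.mp hnull] with x hx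
      have hd : ε ≤ |x - E| := by
        by_contra hlt
        exact hx (hball (by rw [Metric.mem_ball, Real.dist_eq]; exact not_le.mp hlt))
      have hd2 : ε ^ 2 ≤ (x - E) ^ 2 := by rw [← sq_abs (x - E)]; gcongr
      have hη2 : η ≤ c * ε ^ 2 / 2 := min_le_right _ _
      unfold poisson
      rw [div_le_iff₀ (by positivity)]
      nlinarith [mul_le_mul_of_nonneg_left hd2 hc.le, mul_pos hc (pow_pos hη0 2)]
    simp only [integral_const, probReal_univ, one_smul] at h3
    linarith
  have hbd : σ ⊆ Set.Icc (-R) R := by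
    intro E hE
    by_contra hEn
    obtain ⟨ε, hε, hball⟩ := Metric.isOpen_iff.mp (isClosed_Icc (a := -R) (b := R)).isOpen_compl E hEn
    rw [Real.ball_eq_Ioo] at hball
    exact hsub hE ε hε (measure_mono_null hball hμ)
  have hσD : σ \ (σ \ innerSpectrum μ') = innerSpectrum μ' := by
    rw [Set.sdiff_sdiff_right_self]; exact Set.inter_eq_right.mpr hU
  refine ⟨σ \ innerSpectrum μ', ?_, ?_, ?_⟩
  · have hsplit : σ \ innerSpectrum μ' ⊆
        {E ∈ σ \ innerSpectrum μ' | E - 2 * √2 ∈ lineSupport μ'} ∪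
        {E ∈ σ \ innerSpectrum μ' | E + 2 * √2 ∈ lineSupport μ'} := fun E hE =>
      (mem_lineSupport_or_mem_lineSupport hμ hconv (hsub hE.1) hE.2).imp
        (fun h => ⟨hE, h⟩) fun h => ⟨hE, h⟩
    -- Two exceptional points of the same kind are not closer than `1`: the endpoint in the support
    -- belonging to one of them would lie in the null interval of radius `2√2` about the other.
    refine (Set.Finite.union (finite_of_floor_injOn (R := R) (fun E hE => hbd hE.1.1) ?_)
      (finite_of_floor_injOn (R := R) (fun E hE => hbd hE.1.1) ?_)).subset hsplit
    · intro x hx y hy hxy hyx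
      exact notMem_lineSupport (measure_Ioo_eq_zero_of_notMem hx.1.2)
        (t := y - 2 * √2) ⟨by linarith, by linarith⟩ hy.2
    · intro x hx y hy hxy hyx
      exact notMem_lineSupport (measure_Ioo_eq_zero_of_notMem hy.1.2)
        (t := x + 2 * √2) ⟨by linarith, by linarith⟩ hx.2
  · rw [hσD, Metric.isOpen_iff]
    intro E hE
    obtain ⟨ε, hε, c, hc, hlow⟩ := exists_lower_bound_of_mem_innerSpectrum hμ' hconv hE
    exact ⟨ε, hε, fun E' hE' => (hlow E' (by rwa [Real.ball_eq_Ioo] at hE')).1⟩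
  · intro a b hab
    rw [hσD] at hab
    refine (isCompact_Icc (a := a) (b := b)).induction_on (p := fun s => ∃ c > 0, ∀ E ∈ s, ∀ η : ℝ,
      0 < η → η ≤ 1 → c ≤ ∫ x, poisson E η x ∂μ) ⟨1, one_pos, by simp⟩ ?_ ?_ ?_
    · rintro s t hst ⟨c, hc, h⟩
      exact ⟨c, hc, fun E hE => h E (hst hE)⟩
    · rintro s t ⟨c, hc, h⟩ ⟨c', hc', h'⟩
      refine ⟨min c c', lt_min hc hc', fun E hE η h0 h1 => ?_⟩
      rcases hE with hE | hE
      · exact (min_le_left _ _).trans (h E hE η h0 h1)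
      · exact (min_le_right _ _).trans (h' E hE η h0 h1)
    · intro E hE
      obtain ⟨ε, hε, c, hc, hlow⟩ := exists_lower_bound_of_mem_innerSpectrum hμ' hconv (hab hE)
      exact ⟨_, mem_nhdsWithin_of_mem_nhds (Ioo_mem_nhds (by linarith : E - ε < E)
        (by linarith : E < E + ε)), c, hc, fun E' hE' => (hlow E' hE').2⟩

end Exceptional

/-! ### The spectral measure of the adjacency operator. -/

section SpectralData

open MeasureTheory

/-- Positivity is tested on `u - ω v`, with the phase `ω` chosen so that the cross term is `-2 |⟨u,
A v⟩|`. -/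
theorem norm_inner_le_of_nonneg {H : Type*} [NormedAddCommGroup H] [InnerProductSpace ℂ H]
    [CompleteSpace H] {A : H →L[ℂ] H} (hA : IsSelfAdjoint A)
    (hpos : ∀ w, 0 ≤ (inner ℂ w (A w)).re) {u v : H} {c : ℝ} (hu : (inner ℂ u (A u)).re ≤ c)
    (hv : (inner ℂ v (A v)).re ≤ c) : ‖inner ℂ u (A v)‖ ≤ c := by
  obtain ⟨ω, hω, h⟩ := RCLike.exists_norm_eq_mul_self (K := ℂ) (inner ℂ u (A v))
  have hvu : inner ℂ v (A u) = (starRingEnd ℂ) (inner ℂ u (A v)) := by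
    rw [inner_conj_symm, ← ContinuousLinearMap.adjoint_inner_right,
      ContinuousLinearMap.isSelfAdjoint_iff'.mp hA]
  have hωω : (starRingEnd ℂ) ω * ω = 1 := by
    rw [← Complex.normSq_eq_conj_mul_self, Complex.normSq_eq_norm_sq, hω]; simp
  have key := hpos (u - ω • v)
  have e : inner ℂ (u - ω • v) (A (u - ω • v)) = inner ℂ u (A u) + inner ℂ v (A v) -
      (ω * inner ℂ u (A v) + (starRingEnd ℂ) (ω * inner ℂ u (A v))) := by
    simp only [map_sub, map_smul, inner_sub_left, inner_sub_right, inner_smul_left,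
      inner_smul_right, hvu, map_mul]
    linear_combination (inner ℂ v (A v)) * hωω
  rw [e, ← h] at key
  simp only [Complex.sub_re, Complex.add_re, Complex.conj_re] at key
  have hre : ∀ r : ℝ, (RCLike.ofReal r : ℂ).re = r := Complex.ofReal_re
  rw [hre] at key
  linarith

variable {B Γ : Type*} [Fintype B] [Group Γ] {M : CoxeterMatrix B} {cs : CoxeterSystem M Γ}

theorem measure_compl_Icc_eq_zero {μ : Measure ℝ} (s : Finset B)
    (h : μ {x : ℝ | (x : ℂ) ∉ spectrum ℂ (leftRegAlg (∑ i ∈ s, genElt cs i))} = 0) :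
    μ (Set.Icc (-(Nat.card B : ℝ)) (Nat.card B))ᶜ = 0 := by
  refine measure_mono_null (fun x hx => Set.mem_ofPred_eq.symm ▸ fun hx' => hx ?_) h
  have h1 := spectrum.norm_le_norm_mul_of_mem hx'
  have h2 : ‖(1 : EllTwo Γ →L[ℂ] EllTwo Γ)‖ ≤ 1 := ContinuousLinearMap.norm_id_le
  have h3 := norm_leftRegAlg_sum_genElt_le (cs := cs) s
  have h4 : (s.card : ℝ) ≤ Nat.card B := by
    rw [Nat.card_eq_fintype_card]; exact_mod_cast s.card_le_univ
  rw [Complex.norm_real, Real.norm_eq_abs] at h1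
  have h5 : |x| ≤ Nat.card B := h1.trans
    ((mul_le_of_le_one_right (norm_nonneg _) h2).trans (h3.trans h4))
  exact abs_le.mp h5

variable (cs) in
/-- The adjacency operator of the Cayley graph. -/
def adjOp : EllTwo Γ →L[ℂ] EllTwo Γ := leftRegAlg (indicatorElt (generators cs))

/-- The spectral measure of the adjacency operator and its regularity. -/
theorem exists_spectral_data (hM : IsRightAngled M) {tri : Fin 3 → B}
    (hinj : Function.Injective tri) (htri : ∀ i j, M (tri i) (tri j) ≠ 2)
    (hrest : ∀ s, s ∉ Set.range tri → ∀ i, M s (tri i) = 2) :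
    ∃ μ : Measure ℝ, IsProbabilityMeasure μ ∧
      μ (Set.Icc (-(Nat.card B : ℝ)) (Nat.card B))ᶜ = 0 ∧
      (∀ n : ℕ, (indicatorElt (generators cs) ^ n).coeff 1 = ((∫ x, x ^ n ∂μ : ℝ) : ℂ)) ∧
      (∀ (E η : ℝ), 0 < η → ∃ R : EllTwo Γ →L[ℂ] EllTwo Γ,
        R = imResolv (adjOp cs) ((E : ℂ) + η * Complex.I) ∧
        kernel R 1 1 = ((∫ x, poisson E η x ∂μ : ℝ) : ℂ) ∧
        ‖R (delta 1)‖ ^ 2 = ∫ x, poisson E η x ^ 2 ∂μ ∧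
        (∀ w, 0 ≤ (inner ℂ w (R w)).re) ∧ IsSelfAdjoint R ∧
        (∀ C, Commute (leftRegAlg (∑ i, genElt cs i)) C → Commute R C)) ∧
      (∀ E η : ℝ, 0 < η → ∫ x, poisson E η x ∂μ ≤ 6) ∧
      ∃ D : Set ℝ, D.Finite ∧ IsOpen (realSpectrum (adjOp cs) \ D) ∧
        ∀ a b : ℝ, Set.Icc a b ⊆ realSpectrum (adjOp cs) \ D →
        ∃ c > 0, ∀ E ∈ Set.Icc a b, ∀ η : ℝ, 0 < η → η ≤ 1 → c ≤ ∫ x, poisson E η x ∂μ := by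
  classical
  have hind := indicatorElt_generators (cs := cs) hM
  obtain ⟨μ, hμ, hnull, hmom, hR, hsep⟩ := exists_spectralMeasure
    (isSelfAdjoint_leftRegAlg_sum_genElt (cs := cs) Finset.univ) (v := delta 1) (norm_delta 1)
  obtain ⟨μ', hμ', hnull', hmom', -, -⟩ := exists_spectralMeasure
    (isSelfAdjoint_leftRegAlg_sum_genElt (cs := cs)
      (Finset.univ.filter fun s => s ∉ Set.range tri)) (v := delta 1) (norm_delta 1)
  have hc := measure_compl_Icc_eq_zero _ hnull
  have hc' := measure_compl_Icc_eq_zero _ hnull'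
  have hmom1 : ∀ n : ℕ, (indicatorElt (generators cs) ^ n).coeff 1 =
      ((∫ x, x ^ n ∂μ : ℝ) : ℂ) := fun n => by
    rw [← hmom, inner_leftRegAlg_pow, hind]
  have hmom2 : ∀ n : ℕ, (restElt cs tri ^ n).coeff 1 = ((∫ x, x ^ n ∂μ' : ℝ) : ℂ) := fun n => by
    rw [← hmom', inner_leftRegAlg_pow]; rfl
  have hmom3 : ∀ n : ℕ, (treeElt cs tri ^ n).coeff 1 = (kmIntegral (fun x => x ^ n) : ℂ) :=
    fun n => by
    have := coeff_aeval_treeElt (cs := cs) hM hinj htri (Polynomial.X ^ n)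
    simpa using this
  have hconv : ∀ f : ℝ → ℝ, Continuous f →
      ∫ x, f x ∂μ = ∫ y, kmIntegral (fun x => f (x + y)) ∂μ' := by
    intro f hf
    refine integral_eq_integral_kmIntegral hc hc' (fun n => ?_) hf
    have h := coeff_indicatorElt_pow (cs := cs) hM hinj hrest n
    rw [hmom1] at h
    simp only [hmom2, hmom3] at h
    exact_mod_cast h
  refine ⟨μ, hμ, hc, hmom1, fun E η hη => ?_, fun E η hη => integral_poisson_le hc' hconv E hη, ?_⟩
  · obtain ⟨R, hR1, hR2, hR3, hR4, hR5, hR6⟩ := hR E η hη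
    refine ⟨R, ?_, hR2, hR3, hR4, hR5, hR6⟩
    rw [hR1, adjOp, hind]; rfl
  · refine exists_exceptional_set hc hc' hconv ?_ (fun E hE => ?_) ?_
    · exact (spectrum.isClosed (𝕜 := ℂ) (adjOp cs)).preimage Complex.continuous_ofReal
    · refine fun ε hε => hsep (fun A hA h => eq_zero_of_commute hA h) E ?_ ε hε
      have hE' : (E : ℂ) ∈ spectrum ℂ (adjOp cs) := hE
      rwa [adjOp, hind] at hE'
    · rw [← hind] at hnull
      exact hnull

end SpectralData

/-! ### The fourth-moment condition and absolute continuity. -/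

section FourthMoment

open MeasureTheory

/-- Only half of the exponential decay rate is left after interpolation; it still absorbs every
power of the length. -/
theorem exists_rpow_le_mul_sqrt (s : ℝ) {m : ℕ} (hm : 0 < m) :
    ∃ K : ℝ, 0 < K ∧ ∀ l : ℕ, (l : ℝ) ^ s ≤ K * √(2 ^ (l / m)) := by
  set b := Real.log 2 / (2 * m) with hb
  have hbpos : 0 < b := by have := Real.log_pos one_lt_two; positivity
  have ht := (tendsto_rpow_mul_exp_neg_mul_atTop_nhds_zero s b hbpos).comp
    tendsto_natCast_atTop_atTop
  obtain ⟨K, hK⟩ := ht.bddAbove_range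
  refine ⟨(|K| + 1) * √2, by positivity, fun l => ?_⟩
  have h1 : (l : ℝ) ^ s * Real.exp (-b * l) ≤ |K| + 1 :=
    (hK ⟨l, rfl⟩).trans ((le_abs_self K).trans (by linarith))
  have h2 : Real.exp (b * l) ≤ √2 * √(2 ^ (l / m)) := by
    rw [← Real.sqrt_mul zero_le_two, ← pow_succ']
    refine Real.le_sqrt_of_sq_le ?_
    rw [← Real.exp_nat_mul, ← Real.rpow_natCast, Real.rpow_def_of_pos two_pos]
    refine Real.exp_le_exp.mpr ?_
    have h3 : (l : ℝ) ≤ m * ((l / m + 1 : ℕ) : ℝ) := by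
      exact_mod_cast (Nat.lt_mul_div_succ l hm).le
    have hm' : (0 : ℝ) < m := by exact_mod_cast hm
    rw [hb]
    have h4 : ((2 : ℕ) : ℝ) * (Real.log 2 / (2 * m) * l) = Real.log 2 * (l / m) := by
      push_cast; field_simp
    rw [h4]
    refine mul_le_mul_of_nonneg_left ?_ (Real.log_pos one_lt_two).le
    rw [div_le_iff₀ hm', mul_comm]; exact h3
  calc (l : ℝ) ^ s = (l : ℝ) ^ s * Real.exp (-b * l) * Real.exp (b * l) := by
        rw [mul_assoc, ← Real.exp_add]; simp
    _ ≤ (|K| + 1) * (√2 * √(2 ^ (l / m))) := mul_le_mul h1 h2 (Real.exp_pos _).le (by positivity)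
    _ = _ := by ring

/-- The pointwise bound behind the fourth-moment condition. -/
theorem sq_mul_le_of_decay {x a C D : ℝ} (hx : 0 ≤ x) (hC : 0 ≤ C) (hD : 0 < D) (h1 : x ≤ C)
    (h2 : x * D ≤ a) : x * √D ≤ √(C * a) := by
  refine Real.le_sqrt_of_sq_le ?_
  rw [mul_pow, Real.sq_sqrt hD.le, pow_two, mul_assoc]
  exact mul_le_mul h1 h2 (by positivity) hC

theorem integral_sq_poisson_le {μ : Measure ℝ} [IsFiniteMeasure μ] {R c E η : ℝ}
    (hμ : μ (Set.Icc (-R) R)ᶜ = 0) (hη : 0 < η) (h : ∫ x, poisson E η x ∂μ ≤ c) :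
    ∫ x, poisson E η x ^ 2 ∂μ ≤ c / η := by
  have h1 := integral_mono_of_null hμ (f := fun x => poisson E η x ^ 2)
    (g := fun x => 1 / η * poisson E η x) ((continuous_poisson E hη).pow 2)
    ((continuous_const (y := 1 / η)).mul (continuous_poisson E hη)) fun x _ => by
      rw [pow_two]
      exact mul_le_mul_of_nonneg_right (poisson_le_inv _ _ hη) (poisson_pos _ _ hη).le
  refine h1.trans ?_
  rw [integral_const_mul, div_mul_eq_mul_div, one_mul]
  gcongr

variable {B Γ : Type*} [Fintype B] [Group Γ] {M : CoxeterMatrix B} {cs : CoxeterSystem M Γ}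

/-- The square of an entry is at most `36` and has the exponential decay with constant `6 / η`. The
geometric mean of the two bounds pays for the weight at the price `√(216 / η)`; the remaining square
sums to at most `6 / η`. With the factor `η²` this is of order `√η`, for every exponent and
uniformly in `E`. -/
theorem fourthMomentCondition_of_bounds (hM : IsRightAngled M)
    (hflex : SuperFlexible (definingDiagram M)) {μ : Measure ℝ} [IsProbabilityMeasure μ]
    (hμ : μ (Set.Icc (-(Nat.card B : ℝ)) (Nat.card B))ᶜ = 0)
    (hR : ∀ (E η : ℝ), 0 < η → ∃ R : EllTwo Γ →L[ℂ] EllTwo Γ,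
        R = imResolv (adjOp cs) ((E : ℂ) + η * Complex.I) ∧
        kernel R 1 1 = ((∫ x, poisson E η x ∂μ : ℝ) : ℂ) ∧
        ‖R (delta 1)‖ ^ 2 = ∫ x, poisson E η x ^ 2 ∂μ ∧
        (∀ w, 0 ≤ (inner ℂ w (R w)).re) ∧ IsSelfAdjoint R ∧
        (∀ C, Commute (leftRegAlg (∑ i, genElt cs i)) C → Commute R C))
    (hup : ∀ E η : ℝ, 0 < η → ∫ x, poisson E η x ∂μ ≤ 6) (I : Set ℝ) (s : ℝ) :
    FourthMomentCondition (generators cs : Set Γ) (adjOp cs) I s := by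
  obtain ⟨K, hK, hKs⟩ := exists_rpow_le_mul_sqrt s (m := 2 * (Nat.card B + 1)) (by positivity)
  have hbound : ∀ E η : ℝ, 0 < η → ∑' g : Γ, ENNReal.ofReal
      (η ^ 2 * ‖kernel (imResolv (adjOp cs) ((E : ℝ) + η * Complex.I)) 1 g‖ ^ 4
        * (wordLength (generators cs : Set Γ) g : ℝ) ^ s) ≤
      ENNReal.ofReal (6 * η * K * √(36 * (6 / η))) := by
    intro E η hη
    obtain ⟨R, hR1, hR2, hR3, hR4, hR5, hR6⟩ := hR E η hη
    rw [← hR1]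
    have hsq : ‖R (delta 1)‖ ^ 2 ≤ 6 / η := by
      rw [hR3]; exact integral_sq_poisson_le hμ hη (hup E η hη)
    have hdiag : ∀ g : Γ, (inner ℂ (delta g) (R (delta g))).re ≤ 6 := by
      intro g
      have h1 := kernel_perm (F := Equiv.mulRight g)
        (hR6 _ (commute_compPerm fun v => ⟨1, fun s => by simp [mul_assoc]⟩)) 1 1
      simp only [Equiv.coe_mulRight, one_mul] at h1
      rw [← kernel, h1, hR2, Complex.ofReal_re]
      exact hup E η hη
    have hle : ∀ g : Γ, ‖kernel R 1 g‖ ^ 2 ≤ 36 := by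
      intro g
      have := norm_inner_le_of_nonneg hR5 hR4 (hdiag 1) (hdiag g)
      calc ‖kernel R 1 g‖ ^ 2 ≤ 6 ^ 2 := pow_le_pow_left₀ (norm_nonneg _) this 2
        _ = 36 := by norm_num
    have hterm : ∀ g : Γ, η ^ 2 * ‖kernel R 1 g‖ ^ 4 *
        (wordLength (generators cs : Set Γ) g : ℝ) ^ s ≤
        η ^ 2 * (K * √(36 * (6 / η))) * ‖kernel R 1 g‖ ^ 2 := by
      intro g
      have h1 := sq_mul_le_of_decay (sq_nonneg ‖kernel R 1 g‖) (by norm_num : (0 : ℝ) ≤ 36)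
        (by positivity) (hle g) ((kernel_sq_mul_two_pow_le hM hflex hR5 hR6 g).trans hsq)
      have h2 := hKs (cs.length g)
      rw [wordLength_generators]
      calc η ^ 2 * ‖kernel R 1 g‖ ^ 4 * (cs.length g : ℝ) ^ s
          = η ^ 2 * ‖kernel R 1 g‖ ^ 2 * (‖kernel R 1 g‖ ^ 2 * (cs.length g : ℝ) ^ s) := by ring
        _ ≤ η ^ 2 * ‖kernel R 1 g‖ ^ 2 * (‖kernel R 1 g‖ ^ 2 *
            (K * √(2 ^ (cs.length g / (2 * (Nat.card B + 1)))))) := by gcongr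
        _ = η ^ 2 * ‖kernel R 1 g‖ ^ 2 * (K * (‖kernel R 1 g‖ ^ 2 *
            √(2 ^ (cs.length g / (2 * (Nat.card B + 1)))))) := by ring
        _ ≤ η ^ 2 * ‖kernel R 1 g‖ ^ 2 * (K * √(36 * (6 / η))) := by gcongr
        _ = _ := by ring
    have hk : ∀ g : Γ, ‖kernel R 1 g‖ = ‖R (delta 1) g‖ := by
      intro g
      rw [← kernel_eq, kernel, kernel, ← norm_inner_symm, ← ContinuousLinearMap.adjoint_inner_right,
        ContinuousLinearMap.isSelfAdjoint_iff'.mp hR5]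
    have hsum := hasSum_norm_sq (R (delta (1 : Γ)))
    simp only [← hk] at hsum
    calc _ ≤ ∑' g : Γ, ENNReal.ofReal (η ^ 2 * (K * √(36 * (6 / η))) * ‖kernel R 1 g‖ ^ 2) :=
          ENNReal.tsum_le_tsum fun g => ENNReal.ofReal_le_ofReal (hterm g)
      _ = ENNReal.ofReal (∑' g : Γ, η ^ 2 * (K * √(36 * (6 / η))) * ‖kernel R 1 g‖ ^ 2) :=
          (ENNReal.ofReal_tsum_of_nonneg (fun g => by positivity) (hsum.summable.mul_left _)).symm
      _ ≤ _ := by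
          refine ENNReal.ofReal_le_ofReal ?_
          rw [tsum_mul_left, hsum.tsum_eq]
          calc η ^ 2 * (K * √(36 * (6 / η))) * ‖R (delta 1)‖ ^ 2
              ≤ η ^ 2 * (K * √(36 * (6 / η))) * (6 / η) := by gcongr
            _ = _ := by field_simp
  have hlim : Tendsto (fun η : ℝ => ENNReal.ofReal (6 * η * K * √(36 * (6 / η)))) (𝓝[>] 0) (𝓝 0) := by
    have h1 : Tendsto (fun η : ℝ => 6 * K * √(216 * η)) (𝓝[>] 0) (𝓝 0) := by
      have : Continuous fun η : ℝ => 6 * K * √(216 * η) := by fun_prop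
      simpa using (this.tendsto 0).mono_left nhdsWithin_le_nhds
    have h2 := (ENNReal.tendsto_ofReal h1)
    rw [ENNReal.ofReal_zero] at h2
    refine h2.congr' ?_
    filter_upwards [self_mem_nhdsWithin] with η hη
    have hη' : (0 : ℝ) < η := hη
    congr 1
    have : √(216 * η) = η * √(36 * (6 / η)) := by
      rw [← Real.sqrt_sq hη'.le, ← Real.sqrt_mul (by positivity), Real.sqrt_sq hη'.le]
      congr 1; field_simp; norm_num
    rw [this]; ring
  refine tendsto_of_tendsto_of_tendsto_of_le_of_le' tendsto_const_nhds hlim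
    (Eventually.of_forall fun _ => zero_le) ?_
  filter_upwards [self_mem_nhdsWithin] with η hη
  exact iSup₂_le fun E _ => hbound E η hη

theorem acCondition_of_bounds {μ : Measure ℝ}
    (hR : ∀ (E η : ℝ), 0 < η → kernel (imResolv (adjOp cs) ((E : ℂ) + η * Complex.I)) 1 1 =
      ((∫ x, poisson E η x ∂μ : ℝ) : ℂ))
    (hup : ∀ E η : ℝ, 0 < η → ∫ x, poisson E η x ∂μ ≤ 6) {I : Set ℝ} {c : ℝ} (hc : 0 < c)
    (hlow : ∀ E ∈ I, ∀ η : ℝ, 0 < η → η ≤ 1 → c ≤ ∫ x, poisson E η x ∂μ) :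
    ACCondition (adjOp cs) I := by
  refine ⟨max 6 c⁻¹, le_max_of_le_left (by norm_num), fun E hE η hη => ?_⟩
  rw [hR E η hη, Complex.ofReal_re]
  refine ⟨(hup E η hη).trans (le_max_left _ _), fun hη1 => le_trans ?_ (hlow E hE η hη hη1)⟩
  rw [inv_le_comm₀ (by positivity) hc]
  exact le_max_right _ _

end FourthMoment

/-! ### Hilbert–Schmidt norms and singular subspaces. -/

section HilbertSchmidt

open Matrix

variable {N : ℕ}

/-- The square of the Hilbert–Schmidt norm. -/
def hsSq (A : Matrix (Fin N) (Fin N) ℂ) : ℝ := ∑ x, ∑ y, ‖A x y‖ ^ 2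

theorem inner_toEuclideanLin (A : Matrix (Fin N) (Fin N) ℂ) (v w : EuclideanSpace ℂ (Fin N)) :
    inner ℂ v (toEuclideanLin A w) = inner ℂ (toEuclideanLin Aᴴ v) w := by
  rw [toEuclideanLin_conjTranspose_eq_adjoint, LinearMap.adjoint_inner_left]

theorem toEuclideanLin_mul_apply (A C : Matrix (Fin N) (Fin N) ℂ) (v : EuclideanSpace ℂ (Fin N)) :
    toEuclideanLin (A * C) v = toEuclideanLin A (toEuclideanLin C v) := by
  rw [toLpLin_mul_same]; rfl

theorem sum_norm_inner_sq (φ : OrthonormalBasis (Fin N) ℂ (EuclideanSpace ℂ (Fin N)))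
    (A : Matrix (Fin N) (Fin N) ℂ) :
    ∑ α, ∑ β, ‖inner ℂ (φ β) (toEuclideanLin A (φ α))‖ ^ 2 = hsSq A := by
  simp only [φ.sum_sq_norm_inner_right]
  have h1 : ∀ α, ‖toEuclideanLin A (φ α)‖ ^ 2 =
      ∑ x, ‖inner ℂ (WithLp.toLp 2 fun y => star (A x y) : EuclideanSpace ℂ (Fin N)) (φ α)‖ ^ 2 := by
    intro α
    rw [EuclideanSpace.norm_sq_eq]
    refine Finset.sum_congr rfl fun x _ => ?_
    congr 2
    simp [PiLp.inner_apply, toLpLin_apply, mulVec, dotProduct, mul_comm]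
  simp only [h1]
  rw [Finset.sum_comm]
  refine Finset.sum_congr rfl fun x _ => ?_
  rw [φ.sum_sq_norm_inner_left, EuclideanSpace.norm_sq_eq]
  simp

theorem trace_eq_sum_inner_basis (φ : OrthonormalBasis (Fin N) ℂ (EuclideanSpace ℂ (Fin N)))
    (A : Matrix (Fin N) (Fin N) ℂ) :
    A.trace = ∑ α, inner ℂ (φ α) (toEuclideanLin A (φ α)) := by
  rw [← LinearMap.trace_eq_sum_inner, LinearMap.trace_eq_sum_inner _ (EuclideanSpace.basisFun _ ℂ)]
  refine Finset.sum_congr rfl fun x _ => ?_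
  simp [toLpLin_apply, EuclideanSpace.inner_single_left]

theorem hsSq_eq_trace (A : Matrix (Fin N) (Fin N) ℂ) : (hsSq A : ℂ) = (Aᴴ * A).trace := by
  simp only [hsSq, trace, diag, mul_apply, conjTranspose_apply, Complex.ofReal_sum]
  rw [Finset.sum_comm]
  refine Finset.sum_congr rfl fun x _ => Finset.sum_congr rfl fun y _ => ?_
  rw [RCLike.star_def, ← Complex.normSq_eq_conj_mul_self, Complex.normSq_eq_norm_sq]

open scoped ComplexOrder in
/-- The span of the singular vectors with singular value larger than `√θ`. -/
theorem exists_singular_subspace (A : Matrix (Fin N) (Fin N) ℂ) {θ : ℝ} (hθ : 0 ≤ θ) :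
    ∃ V : Submodule ℂ (EuclideanSpace ℂ (Fin N)),
      (∀ p : ℕ, (Module.finrank ℂ V : ℝ) * θ ^ p ≤ ((Aᴴ * A) ^ p).trace.re) ∧
      ∀ b ∈ Vᗮ, ‖toEuclideanLin A b‖ ^ 2 ≤ θ * ‖b‖ ^ 2 := by
  classical
  have hpsd := posSemidef_conjTranspose_mul_self A
  set ψ := hpsd.isHermitian.eigenvectorBasis
  set l := hpsd.isHermitian.eigenvalues
  have hl : ∀ i, 0 ≤ l i := hpsd.eigenvalues_nonneg
  have hψ : ∀ i, toEuclideanLin (Aᴴ * A) (ψ i) = (l i : ℂ) • ψ i := by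
    intro i
    have := hpsd.isHermitian.mulVec_eigenvectorBasis i
    ext x
    have h2 := congrFun this x
    simpa [toLpLin_apply] using h2
  have hpow : ∀ (p : ℕ) i, toEuclideanLin ((Aᴴ * A) ^ p) (ψ i) = ((l i : ℂ) ^ p) • ψ i := by
    intro p i
    induction p with
    | zero => simp
    | succ p ih => rw [pow_succ, toEuclideanLin_mul_apply, hψ, map_smul, ih, smul_smul, pow_succ']
  set s := Finset.univ.filter fun i => θ < l i
  refine ⟨Submodule.span ℂ (s.image ψ : Set (EuclideanSpace ℂ (Fin N))), fun p => ?_, fun b hb => ?_⟩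
  · have h1 : ((Aᴴ * A) ^ p).trace.re = ∑ i, l i ^ p := by
      rw [trace_eq_sum_inner_basis ψ, Complex.re_sum]
      refine Finset.sum_congr rfl fun i _ => ?_
      rw [hpow, inner_smul_right, inner_self_eq_norm_sq_to_K, ψ.norm_eq_one]
      simp only [map_one, one_pow, mul_one]
      rw [← Complex.ofReal_pow, Complex.ofReal_re]
    have h2 : (Module.finrank ℂ (Submodule.span ℂ (s.image ψ : Set (EuclideanSpace ℂ (Fin N)))) : ℝ)
        ≤ s.card := by
      exact_mod_cast (finrank_span_finset_le_card (s.image ψ)).trans Finset.card_image_le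
    rw [h1]
    calc _ ≤ (s.card : ℝ) * θ ^ p := by gcongr
      _ = ∑ i ∈ s, θ ^ p := by simp
      _ ≤ ∑ i ∈ s, l i ^ p := Finset.sum_le_sum fun i hi => by
          have : θ < l i := (Finset.mem_filter.mp hi).2
          gcongr
      _ ≤ ∑ i, l i ^ p := Finset.sum_le_sum_of_subset_of_nonneg (Finset.subset_univ _)
          fun i _ _ => pow_nonneg (hl i) p
  · have h1 : ∀ i, θ < l i → inner ℂ (ψ i) b = 0 := fun i hi =>
      Submodule.mem_orthogonal _ b |>.mp hb (ψ i) (Submodule.subset_span (by simp [s]; exact ⟨i, hi, rfl⟩))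
    have h2 : (‖toEuclideanLin A b‖ ^ 2 : ℝ) = ∑ i, l i * ‖inner ℂ (ψ i) b‖ ^ 2 := by
      have h3 : ((‖toEuclideanLin A b‖ ^ 2 : ℝ) : ℂ) = inner ℂ (toEuclideanLin (Aᴴ * A) b) b := by
        rw [toEuclideanLin_mul_apply, ← inner_toEuclideanLin, inner_self_eq_norm_sq_to_K]
        norm_cast
      have hherm : (Aᴴ * A)ᴴ = Aᴴ * A := hpsd.isHermitian
      rw [← Complex.ofReal_inj, h3, ← ψ.sum_inner_mul_inner, Complex.ofReal_sum]
      refine Finset.sum_congr rfl fun i _ => ?_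
      have h4 : inner ℂ (toEuclideanLin (Aᴴ * A) b) (ψ i) = l i * inner ℂ b (ψ i) := by
        conv_lhs => rw [← hherm]
        rw [← inner_toEuclideanLin, hψ, inner_smul_right]
      rw [h4, mul_assoc, ← inner_conj_symm b, ← Complex.normSq_eq_conj_mul_self,
        Complex.normSq_eq_norm_sq]
      push_cast; rfl
    rw [h2, ← ψ.sum_sq_norm_inner_right b, Finset.mul_sum]
    refine Finset.sum_le_sum fun i _ => ?_
    by_cases hi : θ < l i
    · simp [h1 i hi]
    · exact mul_le_mul_of_nonneg_right (not_lt.mp hi) (sq_nonneg _)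

end HilbertSchmidt

/-! ### Permutation representations of the group algebra. -/

section PermutationAlgebra

open Matrix

variable {Γ : Type*} [Group Γ] {N : ℕ}

theorem permMat_one (ρ : Γ →* Equiv.Perm (Fin N)) : permMat ρ 1 = 1 := by
  ext x y; simp [permMat, one_apply]

theorem permMat_mul (ρ : Γ →* Equiv.Perm (Fin N)) (g h : Γ) :
    permMat ρ (g * h) = permMat ρ g * permMat ρ h := by
  ext x y; simp [permMat, mul_apply]

theorem conjTranspose_permMat (ρ : Γ →* Equiv.Perm (Fin N)) (g : Γ) :
    (permMat ρ g)ᴴ = permMat ρ g⁻¹ := by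
  ext x y
  simp only [permMat, conjTranspose_apply, of_apply, map_inv, Equiv.Perm.eq_inv_iff_eq]
  split_ifs with h1 h2 h2
  · simp
  · exact absurd h1.symm h2
  · exact absurd h2.symm h1
  · simp

/-- The algebra homomorphism extending a permutation representation. -/
def permAlgHom (ρ : Γ →* Equiv.Perm (Fin N)) :
    MonoidAlgebra ℂ Γ →ₐ[ℂ] Matrix (Fin N) (Fin N) ℂ :=
  MonoidAlgebra.lift ℂ _ Γ ⟨⟨permMat ρ, permMat_one ρ⟩, permMat_mul ρ⟩

theorem permAlg_eq (ρ : Γ →* Equiv.Perm (Fin N)) (p : MonoidAlgebra ℂ Γ) :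
    permAlg ρ p = permAlgHom ρ p := by
  rw [permAlgHom, MonoidAlgebra.lift_apply]
  rfl

theorem permAlg_single (ρ : Γ →* Equiv.Perm (Fin N)) (g : Γ) (c : ℂ) :
    permAlg ρ (MonoidAlgebra.single g c) = c • permMat ρ g := by
  rw [permAlg_eq, permAlgHom, MonoidAlgebra.lift_single]
  rfl

theorem permAlg_mul (ρ : Γ →* Equiv.Perm (Fin N)) (p q : MonoidAlgebra ℂ Γ) :
    permAlg ρ (p * q) = permAlg ρ p * permAlg ρ q := by
  simp only [permAlg_eq, map_mul]

/-- The adjoint in the group algebra. -/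
def starElt (p : MonoidAlgebra ℂ Γ) : MonoidAlgebra ℂ Γ :=
  ∑ g ∈ p.coeff.support, MonoidAlgebra.single g⁻¹ (star (p.coeff g))

theorem permAlg_starElt (ρ : Γ →* Equiv.Perm (Fin N)) (p : MonoidAlgebra ℂ Γ) :
    permAlg ρ (starElt p) = (permAlg ρ p)ᴴ := by
  rw [starElt, permAlg_eq, map_sum, permAlg, conjTranspose_sum]
  refine Finset.sum_congr rfl fun g _ => ?_
  rw [← permAlg_eq, permAlg_single, conjTranspose_smul, conjTranspose_permMat]

theorem leftRegAlg_single (g : Γ) (c : ℂ) :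
    leftRegAlg (MonoidAlgebra.single g c) = c • leftReg g := by
  rw [leftRegAlg_eq, leftRegAlgHom, MonoidAlgebra.lift_single]
  rfl

theorem leftRegAlg_starElt (p : MonoidAlgebra ℂ Γ) :
    leftRegAlg (starElt p) = ContinuousLinearMap.adjoint (leftRegAlg p) := by
  rw [starElt, leftRegAlg_eq, map_sum, leftRegAlg, map_sum]
  refine Finset.sum_congr rfl fun g _ => ?_
  rw [← leftRegAlg_eq, leftRegAlg_single, LinearIsometryEquiv.map_smulₛₗ, adjoint_leftReg]
  rfl

theorem norm_coeff_le (p : MonoidAlgebra ℂ Γ) (g : Γ) : ‖p.coeff g‖ ≤ ‖leftRegAlg p‖ := by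
  rw [← leftRegAlg_delta_one_apply]
  refine (norm_apply_le _ _).trans ((ContinuousLinearMap.le_opNorm _ _).trans ?_)
  rw [norm_delta, mul_one]

theorem norm_coeff_starElt_mul_pow_le (k : MonoidAlgebra ℂ Γ) (p : ℕ) (g : Γ) :
    ‖((starElt k * k) ^ p).coeff g‖ ≤ (‖leftRegAlg k‖ ^ 2) ^ p := by
  refine (norm_coeff_le _ _).trans ?_
  rw [leftRegAlg_eq, map_pow, map_mul, ← leftRegAlg_eq, ← leftRegAlg_eq, leftRegAlg_starElt]
  rcases p.eq_zero_or_pos with rfl | hp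
  · rw [pow_zero, pow_zero]; exact ContinuousLinearMap.norm_id_le
  refine (norm_pow_le' _ hp).trans (pow_le_pow_left₀ (norm_nonneg _) ?_ p)
  refine (norm_mul_le _ _).trans ?_
  rw [LinearIsometryEquiv.norm_map, sq]

theorem tendsto_trace_permAlg {N : ℕ → ℕ} (hN : Tendsto N atTop atTop)
    {ρ : ∀ k, Γ →* Equiv.Perm (Fin (N k))} (hρ : ConvergesInDistribution ρ)
    (p : MonoidAlgebra ℂ Γ) :
    Tendsto (fun k => (permAlg (ρ k) p).trace / (N k : ℂ)) atTop (𝓝 (p.coeff 1)) := by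
  classical
  have h1 : ∀ g : Γ, Tendsto (fun k => (permMat (ρ k) g).trace / (N k : ℂ)) atTop
      (𝓝 (if g = 1 then 1 else 0)) := by
    intro g
    split_ifs with hg
    · subst hg
      refine tendsto_const_nhds.congr' ?_
      filter_upwards [hN.eventually_gt_atTop 0] with k hk
      rw [permMat_one, trace_one, Fintype.card_fin, div_self]
      exact_mod_cast hk.ne'
    · exact hρ g hg
  have h2 := tendsto_finsetSum p.coeff.support fun g _ => (h1 g).const_mul (p.coeff g)
  have e : ∑ g ∈ p.coeff.support, p.coeff g * (if g = 1 then 1 else 0) = p.coeff 1 := by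
    simp only [mul_ite, mul_one, mul_zero, Finset.sum_ite_eq']
    split_ifs with h
    · rfl
    · exact (Finsupp.notMem_support_iff.mp h).symm
  rw [e] at h2
  refine h2.congr fun k => ?_
  rw [permAlg, trace_sum, Finset.sum_div]
  refine Finset.sum_congr rfl fun g _ => ?_
  rw [trace_smul, smul_eq_mul, mul_div_assoc]

end PermutationAlgebra

/-! ### Norm bounds outside subspaces of dimension `o(N)`. -/

section SmallSubspaces

open Matrix

variable {Γ : Type*} [Group Γ] {N : ℕ → ℕ} {ρ : ∀ k, Γ →* Equiv.Perm (Fin (N k))}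

/-- Outside a subspace of small dimension, `ρ(k)` is bounded by twice the norm of `λ(k)`. -/
theorem exists_small_subspace (hN : Tendsto N atTop atTop) (hρ : ConvergesInDistribution ρ)
    (q : MonoidAlgebra ℂ Γ) {L : ℝ} (hL : 0 < L) (hq : ‖leftRegAlg q‖ ≤ L) :
    ∃ V : ∀ k, Submodule ℂ (EuclideanSpace ℂ (Fin (N k))),
      Tendsto (fun k => (Module.finrank ℂ (V k) : ℝ) / N k) atTop (𝓝 0) ∧
      ∀ k, ∀ b ∈ (V k)ᗮ, ‖toEuclideanLin (permAlg (ρ k) q) b‖ ≤ 2 * L * ‖b‖ := by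
  -- The dimension times `(2L)^{2p}` is at most the trace of `(q* q)^p`, eventually at most `2
  -- L^{2p} N`. The proportion is therefore eventually below `2 · 4^{-p}`, with `p` arbitrary; the
  -- doubled threshold makes this small.
  choose V hV1 hV2 using fun k => exists_singular_subspace (permAlg (ρ k) q) (sq_nonneg (2 * L))
  refine ⟨V, ?_, fun k b hb => ?_⟩
  · rw [Metric.tendsto_atTop]
    intro ε hε
    obtain ⟨p, hp⟩ := exists_pow_lt_of_lt_one (half_pos hε) (by norm_num : (1 / 4 : ℝ) < 1)
    have ht := tendsto_trace_permAlg hN hρ ((starElt q * q) ^ p)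
    have hre := (Complex.continuous_re.tendsto _).comp ht
    have hlim : (((starElt q * q) ^ p).coeff 1).re < (L ^ 2) ^ p + (L ^ 2) ^ p := by
      have h1 := (Complex.re_le_norm _).trans (norm_coeff_starElt_mul_pow_le q p 1)
      have h2 : (‖leftRegAlg q‖ ^ 2) ^ p ≤ (L ^ 2) ^ p := by gcongr
      have h3 : 0 < (L ^ 2) ^ p := by positivity
      linarith
    obtain ⟨k₀, hk₀⟩ := eventually_atTop.mp ((hre.eventually_lt_const hlim).and
      (hN.eventually_gt_atTop 0))
    refine ⟨k₀, fun k hk => ?_⟩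
    obtain ⟨h1, h2⟩ := hk₀ k hk
    have hNk : (0 : ℝ) < N k := by exact_mod_cast h2
    have h3 := hV1 k p
    rw [← permAlg_starElt, ← permAlg_mul] at h3
    have h4 : ((permAlg (ρ k) ((starElt q * q) ^ p)).trace / (N k : ℂ)).re =
        ((permAlg (ρ k) ((starElt q * q) ^ p)).trace).re / N k := by
      rw [← Complex.ofReal_natCast, Complex.div_ofReal_re]
    simp only [Function.comp_apply] at h1
    rw [h4, div_lt_iff₀ hNk] at h1
    have h5 : permAlg (ρ k) (starElt q * q) ^ p = permAlg (ρ k) ((starElt q * q) ^ p) := by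
      rw [permAlg_eq, permAlg_eq, map_pow]
    rw [h5] at h3
    rw [Real.dist_eq, sub_zero, abs_of_nonneg (by positivity), div_lt_iff₀ hNk]
    have h6 : 0 < (L ^ 2) ^ p := by positivity
    have h7 : ((2 * L) ^ 2) ^ p = (L ^ 2) ^ p * 4 ^ p := by rw [← mul_pow]; ring
    have h8 : (Module.finrank ℂ (V k) : ℝ) * 4 ^ p < 2 * N k := by
      rw [h7] at h3
      have : (L ^ 2) ^ p * ((Module.finrank ℂ (V k) : ℝ) * 4 ^ p) < (L ^ 2) ^ p * (2 * N k) := by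
        linarith
      exact lt_of_mul_lt_mul_left this h6.le
    have h9 : (1 / 4 : ℝ) ^ p * 4 ^ p = 1 := by rw [← mul_pow]; norm_num
    calc (Module.finrank ℂ (V k) : ℝ) = (1 / 4) ^ p * ((Module.finrank ℂ (V k) : ℝ) * 4 ^ p) := by
          rw [mul_left_comm, h9, mul_one]
      _ < (1 / 4) ^ p * (2 * N k) := by gcongr
      _ ≤ ε / 2 * (2 * N k) := by gcongr
      _ = ε * N k := by ring
  · have := hV2 k b hb
    rw [← mul_pow] at this
    exact (sq_le_sq₀ (norm_nonneg _) (by positivity)).mp this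

/-- A diagonal argument for countably many sequences of small subspaces. -/
theorem exists_small_subspace_of_countable {ι : Type*} [Countable ι]
    (V : ι → ∀ k, Submodule ℂ (EuclideanSpace ℂ (Fin (N k))))
    (hV : ∀ i, Tendsto (fun k => (Module.finrank ℂ (V i k) : ℝ) / N k) atTop (𝓝 0)) :
    ∃ W : ∀ k, Submodule ℂ (EuclideanSpace ℂ (Fin (N k))),
      Tendsto (fun k => (Module.finrank ℂ (W k) : ℝ) / N k) atTop (𝓝 0) ∧
      ∀ i, ∀ᶠ k in atTop, V i k ≤ W k := by
  classical
  rcases isEmpty_or_nonempty ι with hι | hι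
  · exact ⟨fun _ => ⊥, by simp, fun i => isEmptyElim i⟩
  obtain ⟨e, he⟩ := exists_surjective_nat ι
  let S : ℕ → ℕ → ℝ := fun J k => ∑ i ∈ Finset.range J, (Module.finrank ℂ (V (e i) k) : ℝ) / N k
  have hS : ∀ J, Tendsto (S J) atTop (𝓝 0) := fun J => by
    simpa using tendsto_finsetSum (Finset.range J) fun i _ => hV (e i)
  -- The number of subspaces joined at stage `k` grows without bound, but only as fast as their
  -- total dimension permits.
  let J : ℕ → ℕ := fun k => Nat.findGreatest (fun j => S j k ≤ 1 / (j + 1 : ℝ)) k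
  have hJ : Tendsto J atTop atTop := by
    refine tendsto_atTop.mpr fun j => ?_
    filter_upwards [(hS j).eventually_le_const (by positivity : (0 : ℝ) < 1 / (j + 1 : ℝ)),
      eventually_ge_atTop j] with k h1 h2
    exact Nat.le_findGreatest h2 h1
  have hJS : ∀ k, S (J k) k ≤ 1 / (J k + 1 : ℝ) := fun k =>
    Nat.findGreatest_spec (P := fun j => S j k ≤ 1 / (j + 1 : ℝ)) (Nat.zero_le k)
      (by simp [S])
  refine ⟨fun k => (Finset.range (J k)).sup fun i => V (e i) k, ?_, fun i => ?_⟩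
  · refine squeeze_zero (fun k => by positivity) (fun k => ?_)
      (tendsto_one_div_add_atTop_nhds_zero_nat.comp hJ)
    refine le_trans ?_ (hJS k)
    simp only [S]
    rw [← Finset.sum_div]
    refine div_le_div_of_nonneg_right ?_ (Nat.cast_nonneg _)
    have : ∀ s : Finset ℕ, Module.finrank ℂ (s.sup fun i => V (e i) k : Submodule ℂ _) ≤
        ∑ i ∈ s, Module.finrank ℂ (V (e i) k) := by
      intro s
      induction s using Finset.induction_on with
      | empty => simp
      | insert a s ha ih =>
        rw [Finset.sup_insert, Finset.sum_insert ha]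
        exact (Submodule.finrank_add_le_finrank_add_finrank _ _).trans (Nat.add_le_add_left ih _)
    exact_mod_cast this _
  · obtain ⟨n, rfl⟩ := he i
    filter_upwards [hJ.eventually_gt_atTop n] with k hk
    exact Finset.le_sup (f := fun i => V (e i) k) (Finset.mem_range.mpr hk)

end SmallSubspaces

/-! ### Traces with diagonal matrices and the decomposition of local matrices. -/

section LocalMatrices

open Matrix

variable {Γ : Type*} [Group Γ] {N : ℕ}

open Classical in
/-- The number of fixed points. -/
def fixCount (ρ : Γ →* Equiv.Perm (Fin N)) (g : Γ) : ℕ := (Finset.univ.filter fun x => ρ g x = x).card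

theorem tendsto_fixCount {N : ℕ → ℕ} {ρ : ∀ k, Γ →* Equiv.Perm (Fin (N k))}
    (hρ : ConvergesInDistribution ρ) {g : Γ} (hg : g ≠ 1) :
    Tendsto (fun k => (fixCount (ρ k) g : ℝ) / N k) atTop (𝓝 0) := by
  refine (tendsto_zero_iff_norm_tendsto_zero.mp (hρ g hg)).congr fun k => ?_
  rw [trace_permMat, norm_div, Complex.norm_natCast]
  congr 1
  exact Complex.norm_natCast _

/-- The trace of `D* g D h` for a diagonal matrix `D`. -/
theorem trace_diagonal_permMat (ρ : Γ →* Equiv.Perm (Fin N)) (b : Fin N → ℂ) (g h : Γ) :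
    ((diagonal b)ᴴ * permMat ρ g * diagonal b * permMat ρ h).trace =
      ∑ x, if ρ (g * h) x = x then star (b x) * b (ρ h x) else 0 := by
  rw [trace]
  refine Finset.sum_congr rfl fun x _ => ?_
  rw [diag_apply, mul_apply, Finset.sum_eq_single (ρ h x)]
  · rw [mul_diagonal, diagonal_conjTranspose, diagonal_mul]
    simp only [permMat, of_apply, if_true, mul_one, map_mul, Equiv.Perm.coe_mul,
      Function.comp_apply, mul_ite, mul_zero, ite_mul, zero_mul, Pi.star_apply]
    exact if_congr eq_comm rfl rfl
  · intro y _ hy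
    simp [permMat, hy]
  · simp

theorem norm_trace_diagonal_permMat_le (ρ : Γ →* Equiv.Perm (Fin N)) {b : Fin N → ℂ}
    (hb : ∀ x, ‖b x‖ ≤ 2) (g h : Γ) :
    ‖((diagonal b)ᴴ * permMat ρ g * diagonal b * permMat ρ h).trace‖ ≤
      4 * fixCount ρ (g * h) := by
  classical
  rw [trace_diagonal_permMat, ← Finset.sum_filter, fixCount]
  refine (norm_sum_le_of_le _ (f := fun x => star (b x) * b (ρ h x)) (n := fun _ => 4)
    fun x _ => ?_).trans ?_
  · rw [norm_mul, norm_star]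
    calc ‖b x‖ * ‖b (ρ h x)‖ ≤ 2 * 2 := mul_le_mul (hb _) (hb _) (norm_nonneg _) zero_le_two
      _ = 4 := by norm_num
  · rw [Finset.sum_const, nsmul_eq_mul, mul_comm]

theorem trace_diagonal_permMat_inv (ρ : Γ →* Equiv.Perm (Fin N)) (b : Fin N → ℂ) (g : Γ) :
    ((diagonal b)ᴴ * permMat ρ g * diagonal b * permMat ρ g⁻¹).trace =
      inner ℂ (WithLp.toLp 2 b) (toEuclideanLin (permMat ρ g) (WithLp.toLp 2 b)) := by
  rw [trace_diagonal_permMat, PiLp.inner_apply]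
  refine Finset.sum_congr rfl fun x _ => ?_
  have h : (toEuclideanLin (permMat ρ g) (WithLp.toLp 2 b)) x = b (ρ g⁻¹ x) := by
    rw [toLpLin_apply]
    simp only [mulVec, dotProduct, permMat, of_apply, ite_mul, one_mul, zero_mul]
    rw [Finset.sum_eq_single (ρ g⁻¹ x)]
    · simp
    · intro y _ hy
      rw [if_neg]
      rintro rfl
      exact hy (by simp)
    · simp
  rw [h]
  simp [mul_comm]

/-- The element `∑_g p_g q_{g⁻¹} g`. -/
def twistElt (p q : MonoidAlgebra ℂ Γ) : MonoidAlgebra ℂ Γ :=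
  ∑ g ∈ p.coeff.support, MonoidAlgebra.single g (p.coeff g * q.coeff g⁻¹)

theorem coeff_twistElt (p q : MonoidAlgebra ℂ Γ) (g : Γ) :
    (twistElt p q).coeff g = p.coeff g * q.coeff g⁻¹ := by
  classical
  rw [twistElt, MonoidAlgebra.coeff_sum, Finsupp.finsetSum_apply]
  simp only [MonoidAlgebra.coeff_single, Finsupp.single_apply, Finset.sum_ite_eq']
  split_ifs with h
  · rfl
  · rw [Finsupp.notMem_support_iff.mp h, zero_mul]

open Classical in
/-- The contribution of the fixed points of nontrivial elements. -/
def crossErr (ρ : Γ →* Equiv.Perm (Fin N)) (p q : MonoidAlgebra ℂ Γ) : ℝ :=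
  ∑ g ∈ p.coeff.support, ∑ h ∈ q.coeff.support.filter fun h => h ≠ g⁻¹,
    ‖p.coeff g‖ * ‖q.coeff h‖ * fixCount ρ (g * h)

theorem tendsto_crossErr {N : ℕ → ℕ} {ρ : ∀ k, Γ →* Equiv.Perm (Fin (N k))}
    (hρ : ConvergesInDistribution ρ) (p q : MonoidAlgebra ℂ Γ) :
    Tendsto (fun k => crossErr (ρ k) p q / N k) atTop (𝓝 0) := by
  classical
  have h : Tendsto (fun k => ∑ g ∈ p.coeff.support, ∑ h ∈ q.coeff.support.filter fun h => h ≠ g⁻¹,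
      ‖p.coeff g‖ * ‖q.coeff h‖ * (fixCount (ρ k) (g * h) / N k)) atTop (𝓝 (∑ g ∈ p.coeff.support,
        ∑ h ∈ q.coeff.support.filter fun h => h ≠ g⁻¹, ‖p.coeff g‖ * ‖q.coeff h‖ * 0)) := by
    refine tendsto_finsetSum _ fun g _ => tendsto_finsetSum _ fun h hh => ?_
    refine (tendsto_fixCount hρ fun h1 => (Finset.mem_filter.mp hh).2 ?_).const_mul _
    exact (inv_eq_of_mul_eq_one_right h1).symm
  simp only [mul_zero, Finset.sum_const_zero] at h
  refine h.congr fun k => ?_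
  simp only [crossErr, Finset.sum_div, mul_div_assoc]

/-- The trace is expanded in pairs `(g, h)`. Pairs with `h = g⁻¹` produce the quadratic form of
`twistElt`; any other pair is supported on the fixed points of `g h ≠ 1`. -/
theorem norm_trace_sub_inner_le (ρ : Γ →* Equiv.Perm (Fin N)) {b : Fin N → ℂ}
    (hb : ∀ x, ‖b x‖ ≤ 2) (p q : MonoidAlgebra ℂ Γ) :
    ‖((diagonal b)ᴴ * permAlg ρ p * diagonal b * permAlg ρ q).trace -
      inner ℂ (WithLp.toLp 2 b) (toEuclideanLin (permAlg ρ (twistElt p q)) (WithLp.toLp 2 b))‖ ≤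
      4 * crossErr ρ p q := by
  classical
  set τ : Γ → Γ → ℂ := fun g h => ((diagonal b)ᴴ * permMat ρ g * diagonal b * permMat ρ h).trace
    with hτ
  have h1 : ((diagonal b)ᴴ * permAlg ρ p * diagonal b * permAlg ρ q).trace =
      ∑ g ∈ p.coeff.support, ∑ h ∈ q.coeff.support, p.coeff g * q.coeff h * τ g h := by
    simp only [permAlg, Finset.mul_sum, Finset.sum_mul, trace_sum, mul_smul_comm, smul_mul_assoc,
      trace_smul, smul_eq_mul, hτ]
    rw [Finset.sum_comm]
    exact Finset.sum_congr rfl fun g _ => Finset.sum_congr rfl fun h _ => by ring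
  have h2 : inner ℂ (WithLp.toLp 2 b)
      (toEuclideanLin (permAlg ρ (twistElt p q)) (WithLp.toLp 2 b)) =
      ∑ g ∈ p.coeff.support, p.coeff g * q.coeff g⁻¹ * τ g g⁻¹ := by
    rw [twistElt, permAlg_eq, map_sum, map_sum, LinearMap.sum_apply, inner_sum]
    refine Finset.sum_congr rfl fun g _ => ?_
    rw [← permAlg_eq, permAlg_single, map_smul, LinearMap.smul_apply, inner_smul_right,
      ← trace_diagonal_permMat_inv]
  have h3 : ∀ g, ∑ h ∈ q.coeff.support, p.coeff g * q.coeff h * τ g h =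
      p.coeff g * q.coeff g⁻¹ * τ g g⁻¹ +
      ∑ h ∈ q.coeff.support.filter (fun h => h ≠ g⁻¹), p.coeff g * q.coeff h * τ g h := by
    intro g
    rw [← Finset.sum_filter_add_sum_filter_not q.coeff.support (fun h => h = g⁻¹)]
    congr 1
    rw [Finset.sum_filter, Finset.sum_ite_eq']
    split_ifs with h
    · rfl
    · rw [Finsupp.notMem_support_iff.mp h]; simp
  rw [h1, h2, ← Finset.sum_sub_distrib, crossErr, Finset.mul_sum]
  refine norm_sum_le_of_le _ fun g _ => ?_
  rw [h3, add_sub_cancel_left, Finset.mul_sum]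
  refine norm_sum_le_of_le _ fun h _ => ?_
  rw [norm_mul, norm_mul]
  have := norm_trace_diagonal_permMat_le ρ hb g h
  calc _ ≤ ‖p.coeff g‖ * ‖q.coeff h‖ * (4 * fixCount ρ (g * h)) := by gcongr
    _ = _ := by ring

theorem norm_toLp_sq_le {b : Fin N → ℂ} (hb : ∀ x, ‖b x‖ ≤ 2) :
    ‖(WithLp.toLp 2 b : EuclideanSpace ℂ (Fin N))‖ ^ 2 ≤ 4 * N := by
  rw [EuclideanSpace.norm_sq_eq]
  calc ∑ x, ‖b x‖ ^ 2 ≤ ∑ _ : Fin N, (2 : ℝ) ^ 2 :=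
        Finset.sum_le_sum fun x _ => pow_le_pow_left₀ (norm_nonneg _) (hb x) 2
    _ = 4 * N := by rw [Finset.sum_const, Finset.card_univ, Fintype.card_fin, nsmul_eq_mul]; ring

/-- The Hilbert–Schmidt norm of a sandwiched diagonal matrix. -/
theorem hsSq_permAlg_diagonal_le (ρ : Γ →* Equiv.Perm (Fin N)) {b : Fin N → ℂ}
    (hb : ∀ x, ‖b x‖ ≤ 2) (p q : MonoidAlgebra ℂ Γ) {L : ℝ}
    (hL : ‖toEuclideanLin (permAlg ρ (twistElt (starElt p * p) (q * starElt q)))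
      (WithLp.toLp 2 b)‖ ≤ 2 * L * ‖(WithLp.toLp 2 b : EuclideanSpace ℂ (Fin N))‖) (hL0 : 0 ≤ L) :
    hsSq (permAlg ρ p * diagonal b * permAlg ρ q) ≤
      8 * L * N + 4 * crossErr ρ (starElt p * p) (q * starElt q) := by
  set v : EuclideanSpace ℂ (Fin N) := WithLp.toLp 2 b
  set k := twistElt (starElt p * p) (q * starElt q)
  have h1 : (hsSq (permAlg ρ p * diagonal b * permAlg ρ q) : ℂ) =
      ((diagonal b)ᴴ * permAlg ρ (starElt p * p) * diagonal b * permAlg ρ (q * starElt q)).trace := by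
    rw [hsSq_eq_trace, permAlg_mul, permAlg_mul, permAlg_starElt, permAlg_starElt,
      conjTranspose_mul, conjTranspose_mul, mul_assoc, trace_mul_comm]
    simp only [mul_assoc]
  have h2 := norm_trace_sub_inner_le ρ hb (starElt p * p) (q * starElt q)
  have h3 : ‖inner ℂ v (toEuclideanLin (permAlg ρ k) v)‖ ≤ 8 * L * N := by
    calc _ ≤ ‖v‖ * ‖toEuclideanLin (permAlg ρ k) v‖ := norm_inner_le_norm _ _
      _ ≤ ‖v‖ * (2 * L * ‖v‖) := by gcongr
      _ = 2 * L * ‖v‖ ^ 2 := by ring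
      _ ≤ 2 * L * (4 * N) := by gcongr; exact norm_toLp_sq_le hb
      _ = _ := by ring
  rw [← h1] at h2
  have h4 : hsSq (permAlg ρ p * diagonal b * permAlg ρ q) ≤
      ‖(hsSq (permAlg ρ p * diagonal b * permAlg ρ q) : ℂ)‖ := by
    rw [Complex.norm_real]; exact le_abs_self _
  calc _ ≤ _ := h4
    _ ≤ ‖inner ℂ v (toEuclideanLin (permAlg ρ k) v)‖ + _ := norm_le_norm_add_norm_sub' _ _
    _ ≤ _ := add_le_add h3 h2

/-- The values of a local matrix along `t`. -/
def symbol (ρ : Γ →* Equiv.Perm (Fin N)) (K : Matrix (Fin N) (Fin N) ℂ) (t : Γ) : Fin N → ℂ :=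
  fun x => K (ρ t x) x

/-- The centered values of a local matrix along `t`. -/
def centeredSymbol (ρ : Γ →* Equiv.Perm (Fin N)) (K : Matrix (Fin N) (Fin N) ℂ) (t : Γ) :
    Fin N → ℂ := fun x => K (ρ t x) x - (∑ y, K (ρ t y) y) / (N : ℂ)

theorem norm_centeredSymbol_le (ρ : Γ →* Equiv.Perm (Fin N)) {K : Matrix (Fin N) (Fin N) ℂ}
    (hK : ∀ x y, ‖K x y‖ ≤ 1) (t : Γ) (x : Fin N) : ‖centeredSymbol ρ K t x‖ ≤ 2 := by
  have hN : (0 : ℝ) < N := by exact_mod_cast (Fin.pos x)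
  have h1 : ‖(∑ y, K (ρ t y) y) / (N : ℂ)‖ ≤ 1 := by
    rw [norm_div, Complex.norm_natCast, div_le_one hN]
    refine (norm_sum_le_of_le _ fun y _ => hK _ _).trans ?_
    simp
  refine (norm_sub_le _ _).trans ?_
  linarith [hK (ρ t x) x]

/-- The error made by counting the coincidences of the translates. -/
def coincidenceErr (ρ : Γ →* Equiv.Perm (Fin N)) (T : Finset Γ) (K : Matrix (Fin N) (Fin N) ℂ) :
    Matrix (Fin N) (Fin N) ℂ := K - ∑ t ∈ T, permMat ρ t * diagonal (symbol ρ K t)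

theorem sub_average_eq (ρ : Γ →* Equiv.Perm (Fin N)) (T : Finset Γ)
    (K : Matrix (Fin N) (Fin N) ℂ) : K - average ρ T K =
      ∑ t ∈ T, permMat ρ t * diagonal (centeredSymbol ρ K t) + coincidenceErr ρ T K := by
  have h1 : average ρ T K = ∑ t ∈ T, permMat ρ t * diagonal fun _ => (∑ y, K (ρ t y) y) / (N : ℂ) := by
    rw [average, permAlg_eq, map_sum]
    refine Finset.sum_congr rfl fun t _ => ?_
    rw [← permAlg_eq, permAlg_single, ← smul_one_eq_diagonal, mul_smul_comm, mul_one]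
  have h2 : ∀ t, permMat ρ t * diagonal (centeredSymbol ρ K t) =
      permMat ρ t * diagonal (symbol ρ K t) -
      permMat ρ t * diagonal fun _ => (∑ y, K (ρ t y) y) / (N : ℂ) := by
    intro t
    rw [← mul_sub, diagonal_sub]
    rfl
  rw [h1, coincidenceErr, Finset.sum_congr rfl fun t _ => h2 t, Finset.sum_sub_distrib]
  abel

open Classical in
/-- The number of coincidences of the translates. -/
def coincidenceCount (ρ : Γ →* Equiv.Perm (Fin N)) (T : Finset Γ) : ℝ :=
  (T.card : ℝ) ^ 2 * ∑ t ∈ T, ∑ t' ∈ T.filter fun t' => t' ≠ t, (fixCount ρ (t⁻¹ * t') : ℝ)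

theorem tendsto_coincidenceCount {N : ℕ → ℕ} {ρ : ∀ k, Γ →* Equiv.Perm (Fin (N k))}
    (hρ : ConvergesInDistribution ρ) (T : Finset Γ) :
    Tendsto (fun k => coincidenceCount (ρ k) T / N k) atTop (𝓝 0) := by
  classical
  have h : Tendsto (fun k => (T.card : ℝ) ^ 2 * ∑ t ∈ T, ∑ t' ∈ T.filter fun t' => t' ≠ t,
      ((fixCount (ρ k) (t⁻¹ * t') : ℝ) / N k)) atTop (𝓝 ((T.card : ℝ) ^ 2 * ∑ t ∈ T,
        ∑ t' ∈ T.filter fun t' => t' ≠ t, (0 : ℝ))) := by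
    refine (tendsto_finsetSum _ fun t _ => tendsto_finsetSum _ fun t' ht' => ?_).const_mul _
    refine tendsto_fixCount hρ fun h1 => (Finset.mem_filter.mp ht').2 ?_
    rwa [inv_mul_eq_one, eq_comm] at h1
  simp only [mul_zero, Finset.sum_const_zero] at h
  refine h.congr fun k => ?_
  simp only [coincidenceCount, mul_div_assoc, Finset.sum_div]

/-- The entry at `(x, y)` is `K x y` times one minus the number of `t` in `T` with `x = t.y`. It
vanishes unless two elements `t`, `t'` agree at `y`, that is, unless `t⁻¹ t'` fixes `y`. -/
theorem hsSq_coincidenceErr_le (ρ : Γ →* Equiv.Perm (Fin N)) {T : Finset Γ}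
    {K : Matrix (Fin N) (Fin N) ℂ} (hloc : IsLocal ρ T K) (hK : ∀ x y, ‖K x y‖ ≤ 1) :
    hsSq (coincidenceErr ρ T K) ≤ coincidenceCount ρ T := by
  classical
  have hentry : ∀ x y, coincidenceErr ρ T K x y =
      K x y * (1 - ((T.filter fun t => x = ρ t y).card : ℂ)) := by
    intro x y
    rw [coincidenceErr, Matrix.sub_apply, Matrix.sum_apply, mul_sub, mul_one, Finset.card_filter]
    push_cast
    rw [Finset.mul_sum]
    congr 1
    refine Finset.sum_congr rfl fun t _ => ?_
    rw [mul_diagonal, permMat, of_apply, symbol]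
    split_ifs with h
    · rw [h, one_mul, mul_one]
    · rw [zero_mul, mul_zero]
  have hpt : ∀ x y, ‖coincidenceErr ρ T K x y‖ ^ 2 ≤ (T.card : ℝ) ^ 2 *
      ∑ t ∈ T, ∑ t' ∈ T.filter fun t' => t' ≠ t, if x = ρ t y ∧ x = ρ t' y then (1 : ℝ) else 0 := by
    intro x y
    have hnn : 0 ≤ ∑ t ∈ T, ∑ t' ∈ T.filter fun t' => t' ≠ t,
        if x = ρ t y ∧ x = ρ t' y then (1 : ℝ) else 0 :=
      Finset.sum_nonneg fun _ _ => Finset.sum_nonneg fun _ _ => by split_ifs <;> norm_num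
    rw [hentry]
    set n := (T.filter fun t => x = ρ t y).card with hn
    rcases Nat.lt_or_ge 1 n with h1 | h1
    · obtain ⟨t, t', ht, ht', htt⟩ := Finset.one_lt_card_iff.mp h1
      rw [Finset.mem_filter] at ht ht'
      have hone : 1 ≤ ∑ t ∈ T, ∑ t' ∈ T.filter fun t' => t' ≠ t,
          if x = ρ t y ∧ x = ρ t' y then (1 : ℝ) else 0 := by
        calc (1 : ℝ) = if x = ρ t y ∧ x = ρ t' y then (1 : ℝ) else 0 := by rw [if_pos ⟨ht.2, ht'.2⟩]
          _ ≤ ∑ t' ∈ T.filter fun t' => t' ≠ t, if x = ρ t y ∧ x = ρ t' y then (1 : ℝ) else 0 :=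
              Finset.single_le_sum (f := fun t' => if x = ρ t y ∧ x = ρ t' y then (1 : ℝ) else 0)
                (fun _ _ => by split_ifs <;> norm_num)
                (Finset.mem_filter.mpr ⟨ht'.1, fun h => htt h.symm⟩)
          _ ≤ _ := Finset.single_le_sum (f := fun t => ∑ t' ∈ T.filter fun t' => t' ≠ t,
                if x = ρ t y ∧ x = ρ t' y then (1 : ℝ) else 0)
                (fun _ _ => Finset.sum_nonneg fun _ _ => by split_ifs <;> norm_num) ht.1
      have h2 : ‖K x y * (1 - (n : ℂ))‖ ≤ T.card := by
        rw [norm_mul]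
        have h3 : ‖(1 : ℂ) - n‖ = (n : ℝ) - 1 := by
          rw [show (1 : ℂ) - n = ((1 - n : ℝ) : ℂ) by push_cast; rfl, Complex.norm_real,
            Real.norm_eq_abs, abs_sub_comm, abs_of_nonneg]
          have : (1 : ℝ) ≤ n := by exact_mod_cast h1.le
          linarith
        have h4 : (n : ℝ) ≤ T.card := by exact_mod_cast Finset.card_filter_le _ _
        rw [h3]
        have h5 : (1 : ℝ) ≤ n := by exact_mod_cast h1.le
        calc ‖K x y‖ * ((n : ℝ) - 1) ≤ 1 * ((n : ℝ) - 1) :=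
              mul_le_mul_of_nonneg_right (hK x y) (by linarith)
          _ ≤ _ := by linarith
      calc _ ≤ (T.card : ℝ) ^ 2 := pow_le_pow_left₀ (norm_nonneg _) h2 2
        _ ≤ _ := le_mul_of_one_le_right (sq_nonneg _) hone
    · have h0 : K x y * (1 - (n : ℂ)) = 0 := by
        interval_cases h : n
        · rw [hloc x y, zero_mul]
          rintro ⟨g, hg, hxy⟩
          have := Finset.card_eq_zero.mp hn.symm
          exact absurd (Finset.mem_filter.mpr ⟨hg, hxy⟩) (by rw [this]; simp)
        · simp
      rw [h0, norm_zero, zero_pow two_ne_zero]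
      positivity
  calc hsSq (coincidenceErr ρ T K) ≤ ∑ x, ∑ y, (T.card : ℝ) ^ 2 *
      ∑ t ∈ T, ∑ t' ∈ T.filter fun t' => t' ≠ t, (if x = ρ t y ∧ x = ρ t' y then (1 : ℝ) else 0) :=
        Finset.sum_le_sum fun x _ => Finset.sum_le_sum fun y _ => hpt x y
    _ = coincidenceCount ρ T := by
        simp only [← Finset.mul_sum]
        rw [coincidenceCount]
        congr 1
        rw [Finset.sum_comm]
        simp only [Finset.sum_comm (s := Finset.univ) (t := T)]
        refine Finset.sum_congr rfl fun t _ => ?_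
        simp only [Finset.sum_comm (s := Finset.univ) (t := T.filter fun t' => t' ≠ t)]
        refine Finset.sum_congr (by congr!) fun t' _ => ?_
        rw [fixCount, Finset.card_filter]
        push_cast
        refine Finset.sum_congr rfl fun y _ => ?_
        rw [Finset.sum_eq_single (ρ t y)]
        · refine if_congr ?_ rfl rfl
          simp only [true_and, map_mul, map_inv, Equiv.Perm.coe_mul, Function.comp_apply,
            Equiv.Perm.inv_eq_iff_eq]
          exact eq_comm
        · intro x _ hx
          rw [if_neg fun h => hx h.1]
        · simp

end LocalMatrices

/-! ### Operator norms of elements with exponentially decaying coefficients. -/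

section GroupAlgebraNorm

variable {Γ : Type*} [Group Γ]

theorem leftRegAlg_injective : Function.Injective (leftRegAlg : MonoidAlgebra ℂ Γ → _) := by
  intro p q h
  ext g
  rw [← leftRegAlg_delta_one_apply, h, leftRegAlg_delta_one_apply]

theorem leftRegAlg_mul (p q : MonoidAlgebra ℂ Γ) :
    leftRegAlg (p * q) = leftRegAlg p * leftRegAlg q := by
  simp only [leftRegAlg_eq, map_mul]

theorem starElt_mul (p q : MonoidAlgebra ℂ Γ) : starElt (p * q) = starElt q * starElt p := by
  refine leftRegAlg_injective ?_
  rw [leftRegAlg_starElt, leftRegAlg_mul, leftRegAlg_mul, leftRegAlg_starElt, leftRegAlg_starElt]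
  exact ContinuousLinearMap.adjoint_comp _ _

theorem starElt_single_one (g : Γ) :
    starElt (MonoidAlgebra.single g 1) = MonoidAlgebra.single g⁻¹ 1 := by
  refine leftRegAlg_injective ?_
  rw [leftRegAlg_starElt, leftRegAlg_single, leftRegAlg_single, one_smul, one_smul,
    adjoint_leftReg]

theorem starElt_of_isSelfAdjoint {p : MonoidAlgebra ℂ Γ} (h : IsSelfAdjoint (leftRegAlg p)) :
    starElt p = p :=
  leftRegAlg_injective (by rw [leftRegAlg_starElt, ContinuousLinearMap.isSelfAdjoint_iff'.mp h])

theorem sum_norm_coeff_sq_le (p : MonoidAlgebra ℂ Γ) (s : Finset Γ) :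
    ∑ g ∈ s, ‖p.coeff g‖ ^ 2 ≤ ‖leftRegAlg p (delta 1)‖ ^ 2 := by
  have h := hasSum_norm_sq (leftRegAlg p (delta (1 : Γ)))
  simp only [leftRegAlg_delta_one_apply] at h
  exact sum_le_hasSum s (fun _ _ => sq_nonneg _) h

theorem sum_norm_coeff_comp_le (p : MonoidAlgebra ℂ Γ) (e : Equiv.Perm Γ) (s : Finset Γ) :
    ∑ g ∈ s, ‖p.coeff (e g)‖ ^ 2 ≤ ‖leftRegAlg p (delta 1)‖ ^ 2 := by
  have := sum_norm_coeff_sq_le p (s.map e.toEmbedding)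
  rwa [Finset.sum_map] at this

variable {B : Type*} [Finite B] {M : CoxeterMatrix B} {cs : CoxeterSystem M Γ}

theorem summable_sphere_weight (n : ℕ) {m : ℕ} (hm : 0 < m) :
    Summable fun d : ℕ => (((d : ℝ) + 1) ^ n) ^ 2 / √(√(2 ^ (d / m))) := by
  obtain ⟨K, hK, h⟩ := exists_rpow_le_mul_sqrt ((2 * (2 * n + 2) : ℕ) : ℝ) hm
  have hs : Summable fun d : ℕ => √(K * √2) * (1 / ((d : ℝ) + 1) ^ 2) := by
    refine Summable.mul_left _ ?_
    have := (summable_nat_add_iff 1).mpr (Real.summable_one_div_nat_pow.mpr one_lt_two)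
    simpa using this
  refine Summable.of_nonneg_of_le (fun d => by positivity) (fun d => ?_) hs
  have h1 := h (d + 1)
  rw [Real.rpow_natCast] at h1
  have h2 : √((2 : ℝ) ^ ((d + 1) / m)) ≤ √2 * √(2 ^ (d / m)) := by
    rw [← Real.sqrt_mul zero_le_two, ← pow_succ']
    refine Real.sqrt_le_sqrt (pow_le_pow_right₀ one_le_two ?_)
    calc (d + 1) / m ≤ (d + m) / m := Nat.div_le_div_right (by omega)
      _ = d / m + 1 := Nat.add_div_right d hm
  have h3 : (((d : ℝ) + 1) ^ (2 * n + 2)) ^ 2 ≤ K * √2 * √(2 ^ (d / m)) := by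
    calc _ = ((d + 1 : ℕ) : ℝ) ^ (2 * (2 * n + 2)) := by push_cast; ring
      _ ≤ _ := h1
      _ ≤ K * (√2 * √(2 ^ (d / m))) := by gcongr
      _ = _ := by ring
  have h4 := Real.le_sqrt_of_sq_le h3
  rw [Real.sqrt_mul (by positivity)] at h4
  rw [mul_one_div, div_le_div_iff₀ (by positivity) (by positivity)]
  calc _ = ((d : ℝ) + 1) ^ (2 * n + 2) := by ring
    _ ≤ _ := h4

/-- The rapid decay property for elements whose `ℓ²` norm on spheres decays exponentially. -/
theorem exists_norm_leftRegAlg_le_of_decay (cs : CoxeterSystem M Γ) (hM : IsRightAngled M) {m : ℕ}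
    (hm : 0 < m) : ∃ C : ℝ, 0 < C ∧ ∀ (k : MonoidAlgebra ℂ Γ) (A : ℝ), 0 ≤ A →
      (∀ d : ℕ, ∑ g ∈ k.coeff.support.filter (fun g => cs.length g = d), ‖k.coeff g‖ ^ 2 ≤
        A / √(2 ^ (d / m))) → ‖leftRegAlg k‖ ≤ C * √A := by
  classical
  have hsum := summable_sphere_weight (Nat.card B) hm
  set u := fun d : ℕ => (((d : ℝ) + 1) ^ Nat.card B) ^ 2 / √(√(2 ^ (d / m))) with hu
  refine ⟨(∑' d, u d) + 1, by
    have : 0 ≤ ∑' d, u d := tsum_nonneg fun d => by positivity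
    linarith, fun k A hA hk => ?_⟩
  -- Rapid decay is applied on each sphere separately; its polynomial loss is summable against the
  -- exponential decay.
  let kd : ℕ → MonoidAlgebra ℂ Γ := fun d =>
    ∑ g ∈ k.coeff.support.filter (fun g => cs.length g = d), MonoidAlgebra.single g (k.coeff g)
  have hcoeff : ∀ d g, (kd d).coeff g = if cs.length g = d then k.coeff g else 0 := by
    intro d g
    simp only [kd, MonoidAlgebra.coeff_sum, Finsupp.finsetSum_apply, MonoidAlgebra.coeff_single,
      Finsupp.single_apply, Finset.sum_ite_eq', Finset.mem_filter, Finsupp.mem_support_iff]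
    by_cases h1 : cs.length g = d <;> by_cases h2 : k.coeff g = 0 <;> simp [h1, h2]
  have hkd : ∀ d, ‖leftRegAlg (kd d)‖ ≤ √A * u d := by
    intro d
    have hsupp : ∀ g ∈ (kd d).coeff.support, cs.length g = d := fun g hg => by
      rw [Finsupp.mem_support_iff, hcoeff] at hg
      by_contra h
      exact hg (if_neg h)
    refine (norm_leftRegAlg_le (cs := cs) hM d (kd d) fun g hg => (hsupp g hg).le).trans ?_
    have h1 : ∑ g ∈ (kd d).coeff.support, ‖(kd d).coeff g‖ ^ 2 ≤ A / √(2 ^ (d / m)) := by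
      refine le_trans ?_ (hk d)
      refine (Finset.sum_congr rfl fun g hg => ?_).trans_le (Finset.sum_le_sum_of_subset_of_nonneg
        (f := fun g => ‖k.coeff g‖ ^ 2) (fun g hg => ?_) fun _ _ _ => sq_nonneg _)
      · rw [hcoeff, if_pos (hsupp g hg)]
      · have hd := hsupp g hg
        refine Finset.mem_filter.mpr ⟨?_, hd⟩
        rw [Finsupp.mem_support_iff, hcoeff, if_pos hd] at hg
        exact Finsupp.mem_support_iff.mpr hg
    calc _ ≤ (((d : ℝ) + 1) ^ Nat.card B) ^ 2 * √(A / √(2 ^ (d / m))) := by gcongr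
      _ = √A * u d := by rw [Real.sqrt_div hA, hu]; ring
  have hk' : k = ∑ d ∈ k.coeff.support.image cs.length, kd d := by
    ext g
    simp only [MonoidAlgebra.coeff_sum, Finsupp.finsetSum_apply, hcoeff, Finset.sum_ite_eq]
    split_ifs with h
    · rfl
    · by_contra h2
      exact h (Finset.mem_image_of_mem _ (Finsupp.mem_support_iff.mpr h2))
  rw [hk', leftRegAlg_eq, map_sum]
  calc _ ≤ ∑ d ∈ k.coeff.support.image cs.length, √A * u d :=
        norm_sum_le_of_le _ fun d _ => by rw [← leftRegAlg_eq]; exact hkd d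
    _ = √A * ∑ d ∈ k.coeff.support.image cs.length, u d := by rw [Finset.mul_sum]
    _ ≤ √A * ((∑' d, u d) + 1) := by
        gcongr
        exact (hsum.sum_le_tsum _ fun d _ => by positivity).trans (by linarith)
    _ = _ := mul_comm _ _

end GroupAlgebraNorm

/-! ### Polynomials in the sum of the generators. -/

section PolynomialElements

open Polynomial MeasureTheory

variable {B Γ : Type*} [Fintype B] [Group Γ] {M : CoxeterMatrix B} {cs : CoxeterSystem M Γ}

variable (cs) in
/-- A real polynomial in the sum of the generators. -/
def polyElt (r : ℝ[X]) : MonoidAlgebra ℂ Γ :=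
  aeval (indicatorElt (generators cs)) (r.map (algebraMap ℝ ℂ))

theorem polyElt_mul (r s : ℝ[X]) : polyElt cs (r * s) = polyElt cs r * polyElt cs s := by
  simp only [polyElt, Polynomial.map_mul, map_mul]

theorem polyElt_add (r s : ℝ[X]) : polyElt cs (r + s) = polyElt cs r + polyElt cs s := by
  simp only [polyElt, Polynomial.map_add, map_add]

theorem polyElt_monomial (n : ℕ) (a : ℝ) :
    polyElt cs (monomial n a) = (a : ℂ) • indicatorElt (generators cs) ^ n := by
  simp only [polyElt, Polynomial.map_monomial, aeval_monomial, Algebra.smul_def]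
  rfl

theorem coeff_polyElt_one {μ : Measure ℝ} [IsFiniteMeasure μ] {R : ℝ}
    (hμ : μ (Set.Icc (-R) R)ᶜ = 0)
    (hmom : ∀ n : ℕ, (indicatorElt (generators cs) ^ n).coeff 1 = ((∫ x, x ^ n ∂μ : ℝ) : ℂ))
    (r : ℝ[X]) : (polyElt cs r).coeff 1 = ((∫ x, r.eval x ∂μ : ℝ) : ℂ) := by
  induction r using Polynomial.induction_on' with
  | add p q hp hq =>
    rw [polyElt_add, MonoidAlgebra.coeff_add, Finsupp.add_apply, hp, hq, ← Complex.ofReal_add]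
    simp only [eval_add]
    rw [integral_add (integrable_of_continuous_of_null hμ p.continuous)
      (integrable_of_continuous_of_null hμ q.continuous)]
  | monomial n a =>
    rw [polyElt_monomial, MonoidAlgebra.coeff_smul, Finsupp.smul_apply, hmom, smul_eq_mul,
      ← Complex.ofReal_mul]
    simp only [eval_monomial]
    rw [integral_const_mul]

theorem isSelfAdjoint_leftRegAlg_polyElt (hM : IsRightAngled M) (r : ℝ[X]) :
    IsSelfAdjoint (leftRegAlg (polyElt cs r)) := by
  induction r using Polynomial.induction_on' with
  | add p q hp hq =>
    rw [polyElt_add, leftRegAlg_eq, map_add, ← leftRegAlg_eq, ← leftRegAlg_eq]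
    exact hp.add hq
  | monomial n a =>
    have h := (isSelfAdjoint_leftRegAlg_sum_genElt (cs := cs) Finset.univ).pow n
    rw [polyElt_monomial, leftRegAlg_eq, map_smul, map_pow, ← leftRegAlg_eq,
      indicatorElt_generators hM]
    exact IsSelfAdjoint.smul (Complex.conj_ofReal a) h

theorem commute_leftRegAlg_polyElt (hM : IsRightAngled M) (r : ℝ[X])
    {C : EllTwo Γ →L[ℂ] EllTwo Γ} (hC : Commute (leftRegAlg (∑ i, genElt cs i)) C) :
    Commute (leftRegAlg (polyElt cs r)) C := by
  induction r using Polynomial.induction_on' with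
  | add p q hp hq =>
    rw [polyElt_add, leftRegAlg_eq, map_add, ← leftRegAlg_eq, ← leftRegAlg_eq]
    exact hp.add_left hq
  | monomial n a =>
    rw [polyElt_monomial, leftRegAlg_eq, map_smul, map_pow, ← leftRegAlg_eq,
      indicatorElt_generators hM]
    exact (hC.pow_left n).smul_left _

theorem norm_leftRegAlg_polyElt_delta_sq (hM : IsRightAngled M) {μ : Measure ℝ}
    [IsFiniteMeasure μ] {R : ℝ} (hμ : μ (Set.Icc (-R) R)ᶜ = 0)
    (hmom : ∀ n : ℕ, (indicatorElt (generators cs) ^ n).coeff 1 = ((∫ x, x ^ n ∂μ : ℝ) : ℂ))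
    (r : ℝ[X]) :
    ‖leftRegAlg (polyElt cs r) (delta 1)‖ ^ 2 = ∫ x, r.eval x ^ 2 ∂μ := by
  rw [norm_sq_eq_of_isSelfAdjoint (isSelfAdjoint_leftRegAlg_polyElt hM r), ← leftRegAlg_mul,
    ← polyElt_mul, inner_delta_left, leftRegAlg_delta_one_apply, coeff_polyElt_one hμ hmom,
    Complex.ofReal_re]
  simp only [eval_mul, pow_two]

/-- The operator of a square is positive with constant diagonal, so the diagonal value bounds all
entries. -/
theorem norm_coeff_polyElt_mul_self_le (hM : IsRightAngled M) {μ : Measure ℝ}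
    [IsFiniteMeasure μ] {R : ℝ} (hμ : μ (Set.Icc (-R) R)ᶜ = 0)
    (hmom : ∀ n : ℕ, (indicatorElt (generators cs) ^ n).coeff 1 = ((∫ x, x ^ n ∂μ : ℝ) : ℂ))
    (r : ℝ[X]) (g : Γ) : ‖(polyElt cs (r * r)).coeff g‖ ≤ ∫ x, r.eval x ^ 2 ∂μ := by
  set Q := leftRegAlg (polyElt cs (r * r)) with hQ
  have hpos : ∀ w, 0 ≤ (inner ℂ w (Q w)).re := fun w => by
    rw [hQ, polyElt_mul, leftRegAlg_mul,
      ← norm_sq_eq_of_isSelfAdjoint (isSelfAdjoint_leftRegAlg_polyElt hM r)]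
    positivity
  have hdiag : ∀ h : Γ, (inner ℂ (delta h) (Q (delta h))).re ≤ ∫ x, r.eval x ^ 2 ∂μ := by
    intro h
    have h1 := kernel_perm (F := Equiv.mulRight h) (commute_leftRegAlg_polyElt hM (r * r)
      (commute_compPerm (cs := cs) fun v => ⟨1, fun s => by simp [mul_assoc]⟩)) 1 1
    simp only [Equiv.coe_mulRight, one_mul] at h1
    rw [← kernel, h1, kernel_eq, leftRegAlg_delta_one_apply, coeff_polyElt_one hμ hmom,
      Complex.ofReal_re]
    simp only [eval_mul, pow_two, le_refl]
  have := norm_inner_le_of_nonneg (isSelfAdjoint_leftRegAlg_polyElt hM (r * r)) hpos (hdiag g)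
    (hdiag 1)
  rwa [inner_delta_left, leftRegAlg_delta_one_apply] at this

theorem norm_coeff_sq_mul_sqrt_le (hM : IsRightAngled M)
    (hflex : SuperFlexible (definingDiagram M)) (r : ℝ[X]) {c : ℝ}
    (h : ∀ g, ‖(polyElt cs r).coeff g‖ ≤ c) (g : Γ) :
    ‖(polyElt cs r).coeff g⁻¹‖ ^ 2 * √(2 ^ (cs.length g / (2 * (Nat.card B + 1)))) ≤
      √(c ^ 2 * ‖leftRegAlg (polyElt cs r) (delta 1)‖ ^ 2) := by
  have h1 := kernel_sq_mul_two_pow_le hM hflex (isSelfAdjoint_leftRegAlg_polyElt (cs := cs) hM r)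
    (fun C hC => commute_leftRegAlg_polyElt hM r hC) g
  rw [kernel_eq, leftRegAlg_delta_apply, one_mul] at h1
  exact sq_mul_le_of_decay (sq_nonneg _) (sq_nonneg c) (by positivity)
    (pow_le_pow_left₀ (norm_nonneg _) (h _) 2) h1

/-- The norm of the twisted product of two polynomial elements. -/
theorem exists_norm_twistElt_le (cs : CoxeterSystem M Γ) (hM : IsRightAngled M)
    (hflex : SuperFlexible (definingDiagram M)) :
    ∃ C : ℝ, 0 < C ∧ ∀ {μ : Measure ℝ} [IsFiniteMeasure μ] {R : ℝ},
    μ (Set.Icc (-R) R)ᶜ = 0 →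
    (∀ n : ℕ, (indicatorElt (generators cs) ^ n).coeff 1 = ((∫ x, x ^ n ∂μ : ℝ) : ℂ)) →
    ∀ (r₁ r₂ : ℝ[X]) (t : Γ) (c S : ℝ), 0 ≤ c → 0 ≤ S → ∫ x, r₁.eval x ^ 2 ∂μ ≤ c →
      ∫ x, (r₁ * r₁).eval x ^ 2 ∂μ ≤ S → ∫ x, (r₂ * r₂).eval x ^ 2 ∂μ ≤ S →
      ‖leftRegAlg (twistElt
        (starElt (polyElt cs r₂ * MonoidAlgebra.single t 1) *
          (polyElt cs r₂ * MonoidAlgebra.single t 1))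
        (polyElt cs r₁ * starElt (polyElt cs r₁)))‖ ≤ C * √(S * √(c ^ 2 * S)) := by
  classical
  obtain ⟨C, hC, h⟩ := exists_norm_leftRegAlg_le_of_decay cs hM (m := 2 * (Nat.card B + 1))
    (by positivity)
  refine ⟨C, hC, fun {μ} _ {R} hμ hmom r₁ r₂ t c S hc hS hr₁ hS₁ hS₂ => h _ _ (by positivity)
    fun d => ?_⟩
  rw [starElt_mul, starElt_single_one,
    starElt_of_isSelfAdjoint (isSelfAdjoint_leftRegAlg_polyElt hM r₂),
    starElt_of_isSelfAdjoint (isSelfAdjoint_leftRegAlg_polyElt hM r₁), ← polyElt_mul,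
    mul_assoc, ← mul_assoc (polyElt cs r₂), ← polyElt_mul]
  set p := MonoidAlgebra.single t⁻¹ 1 * (polyElt cs (r₂ * r₂) * MonoidAlgebra.single t 1) with hp
  have hpc : ∀ g, p.coeff g = (polyElt cs (r₂ * r₂)).coeff (t * g * t⁻¹) := fun g => by
    rw [hp, coeff_single_mul, coeff_mul_single_one, inv_inv]
  have hX : 0 < √((2 : ℝ) ^ (d / (2 * (Nat.card B + 1)))) := by positivity
  have hk := fun g => norm_coeff_sq_mul_sqrt_le (cs := cs) hM hflex (r₁ * r₁)
    (fun g => (norm_coeff_polyElt_mul_self_le hM hμ hmom r₁ g).trans hr₁) g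
  rw [norm_leftRegAlg_polyElt_delta_sq hM hμ hmom] at hk
  have hle : √(c ^ 2 * ∫ x, (r₁ * r₁).eval x ^ 2 ∂μ) ≤ √(c ^ 2 * S) :=
    Real.sqrt_le_sqrt (by gcongr)
  rw [le_div_iff₀ hX, Finset.sum_mul]
  -- Of the two factors of a coefficient, the one from `r₁` supplies the pointwise decay on the
  -- sphere, and the one from `r₂`, a conjugate by `t`, supplies square-summability.
  calc _ ≤ ∑ g ∈ (twistElt p (polyElt cs (r₁ * r₁))).coeff.support.filter
        (fun g => cs.length g = d), ‖p.coeff g‖ ^ 2 * √(c ^ 2 * S) := by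
        refine Finset.sum_le_sum fun g hg => ?_
        have hd := (Finset.mem_filter.mp hg).2
        rw [coeff_twistElt, norm_mul, mul_pow, mul_assoc, ← hd]
        gcongr
        exact (hk g).trans hle
    _ = (∑ g ∈ (twistElt p (polyElt cs (r₁ * r₁))).coeff.support.filter
        (fun g => cs.length g = d), ‖p.coeff g‖ ^ 2) * √(c ^ 2 * S) := by rw [Finset.sum_mul]
    _ ≤ S * √(c ^ 2 * S) := by
        gcongr
        simp only [hpc]
        refine (sum_norm_coeff_comp_le _ ((Equiv.mulLeft t).trans (Equiv.mulRight t⁻¹)) _).trans ?_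
        rw [norm_leftRegAlg_polyElt_delta_sq hM hμ hmom]
        exact hS₂

/-- Polynomials approximating the square root of the Poisson kernel. -/
theorem exists_polynomial_sqrt_poisson (R E : ℝ) {η : ℝ} (hη : 0 < η) :
    ∃ r : ℝ[X], ∀ x ∈ Set.Icc (-R) R, √(poisson E η x) ≤ r.eval x ∧
      r.eval x ≤ √(poisson E η x) + 1 := by
  have hc : Continuous fun x => √(poisson E η x) + 1 / 2 :=
    ((continuous_poisson E hη).sqrt).add continuous_const
  obtain ⟨r, hr⟩ := exists_polynomial_near_of_continuousOn (-R) R _ hc.continuousOn (1 / 2)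
    (by norm_num)
  refine ⟨r, fun x hx => ?_⟩
  have := abs_lt.mp (hr x hx)
  constructor <;> linarith [this.1, this.2]

/-- From `r ≤ √p + 1` follow `r² ≤ 2p + 2` and `r⁴ ≤ 8p² + 8`. The integrals of `p` and `p²` are at
most `6` and `6 / η`; the additive constant is absorbed by `η ≤ 1`. -/
theorem integral_bounds_of_sqrt_poisson {μ : Measure ℝ} [IsProbabilityMeasure μ] {R E η : ℝ}
    (hμ : μ (Set.Icc (-R) R)ᶜ = 0) (hη : 0 < η) (hη1 : η ≤ 1)
    (hup : ∫ x, poisson E η x ∂μ ≤ 6) {r : ℝ[X]}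
    (hr : ∀ x ∈ Set.Icc (-R) R, √(poisson E η x) ≤ r.eval x ∧
      r.eval x ≤ √(poisson E η x) + 1) :
    ∫ x, r.eval x ^ 2 ∂μ ≤ 14 ∧ ∫ x, (r * r).eval x ^ 2 ∂μ ≤ 56 / η := by
  have hcp := continuous_poisson E hη
  have hip := integrable_of_continuous_of_null hμ hcp
  have hsq : ∀ x ∈ Set.Icc (-R) R, r.eval x ^ 2 ≤ 2 * poisson E η x + 2 := by
    intro x hx
    obtain ⟨h1, h2⟩ := hr x hx
    have h0 := Real.sqrt_nonneg (poisson E η x)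
    have hs := Real.sq_sqrt (poisson_pos E x hη).le
    nlinarith [sq_nonneg (√(poisson E η x) - 1), pow_le_pow_left₀ (h0.trans h1) h2 2]
  constructor
  · have h1 := integral_mono_of_null hμ (f := fun x => r.eval x ^ 2)
      (g := fun x => 2 * poisson E η x + 2) (r.continuous.pow 2) (by fun_prop) hsq
    rw [integral_add (hip.const_mul 2) (integrable_const _), integral_const_mul] at h1
    simp only [integral_const, probReal_univ, one_smul] at h1
    linarith
  · have h1 := integral_mono_of_null hμ (f := fun x => (r * r).eval x ^ 2)
      (g := fun x => 8 * poisson E η x ^ 2 + 8) ((r * r).continuous.pow 2) (by fun_prop)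
      fun x hx => by
        have hp := poisson_pos E x hη
        rw [eval_mul, ← pow_two]
        nlinarith [sq_nonneg (poisson E η x - 1), pow_le_pow_left₀ (sq_nonneg _) (hsq x hx) 2]
    have h2 := integral_sq_poisson_le hμ hη hup
    have hip2 : Integrable (fun x => poisson E η x ^ 2) μ :=
      integrable_of_continuous_of_null hμ (hcp.pow 2)
    rw [integral_add (hip2.const_mul 8) (integrable_const _), integral_const_mul] at h1
    simp only [integral_const, probReal_univ, one_smul] at h1
    have h3 : 8 * (6 / η) + 8 ≤ 56 / η := by
      have : 1 ≤ 1 / η := by rw [le_div_iff₀ hη]; linarith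
      have e1 : 6 / η = 6 * (1 / η) := by ring
      have e2 : 56 / η = 56 * (1 / η) := by ring
      rw [e1, e2]; linarith
    linarith

end PolynomialElements

/-! ### Spectral windows in an eigenbasis. -/

section Eigenbasis

open Matrix Polynomial MeasureTheory

variable {B Γ : Type*} [Fintype B] [Group Γ] {M : CoxeterMatrix B} {cs : CoxeterSystem M Γ}
  {N : ℕ} {ρ : Γ →* Equiv.Perm (Fin N)}
  {φ : OrthonormalBasis (Fin N) ℂ (EuclideanSpace ℂ (Fin N))} {ev : Fin N → ℝ}

theorem permAlg_polyElt_apply (h : IsEigenbasis (permAlg ρ (indicatorElt (generators cs))) φ ev)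
    (r : ℝ[X]) (α : Fin N) : toEuclideanLin (permAlg ρ (polyElt cs r)) (φ α) =
      ((r.eval (ev α) : ℝ) : ℂ) • φ α := by
  induction r using Polynomial.induction_on' with
  | add p q hp hq =>
    rw [polyElt_add, permAlg_eq, map_add, ← permAlg_eq, ← permAlg_eq, map_add,
      LinearMap.add_apply, hp, hq, eval_add, Complex.ofReal_add, add_smul]
  | monomial n a =>
    have hp : ∀ n : ℕ, toEuclideanLin (permAlg ρ (indicatorElt (generators cs)) ^ n) (φ α) =
        ((ev α : ℂ) ^ n) • φ α := by
      intro n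
      induction n with
      | zero => simp
      | succ n ih => rw [pow_succ, toEuclideanLin_mul_apply, h α, map_smul, ih, smul_smul, pow_succ']
    rw [polyElt_monomial, permAlg_eq, map_smul, map_pow, ← permAlg_eq, map_smul,
      LinearMap.smul_apply, hp, smul_smul, eval_monomial]
    push_cast; rfl

theorem conjTranspose_permAlg_polyElt (hM : IsRightAngled M) (r : ℝ[X]) :
    (permAlg ρ (polyElt cs r))ᴴ = permAlg ρ (polyElt cs r) := by
  rw [← permAlg_starElt, starElt_of_isSelfAdjoint (isSelfAdjoint_leftRegAlg_polyElt hM r)]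

theorem norm_permMat_apply (g : Γ) (v : EuclideanSpace ℂ (Fin N)) :
    ‖toEuclideanLin (permMat ρ g) v‖ = ‖v‖ := by
  have h : inner ℂ (toEuclideanLin (permMat ρ g) v) (toEuclideanLin (permMat ρ g) v) =
      inner ℂ v v := by
    rw [inner_toEuclideanLin, ← toEuclideanLin_mul_apply, conjTranspose_permMat, ← permMat_mul,
      inv_mul_cancel, permMat_one, toLpLin_one]
    rfl
  rw [inner_self_eq_norm_sq_to_K, inner_self_eq_norm_sq_to_K] at h
  have h2 : ‖toEuclideanLin (permMat ρ g) v‖ ^ 2 = ‖v‖ ^ 2 := by exact_mod_cast h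
  exact (sq_eq_sq₀ (norm_nonneg _) (norm_nonneg _)).mp h2

/-- Keeps the eigenvalues in the interval on which the approximating polynomials are controlled. -/
theorem eigenvalue_mem_Icc (hM : IsRightAngled M)
    (h : IsEigenbasis (permAlg ρ (indicatorElt (generators cs))) φ ev) (α : Fin N) :
    ev α ∈ Set.Icc (-(Nat.card B : ℝ)) (Nat.card B) := by
  have h1 : ‖toEuclideanLin (permAlg ρ (indicatorElt (generators cs))) (φ α)‖ ≤ Nat.card B := by
    rw [indicatorElt_generators hM, permAlg_eq, map_sum, map_sum, LinearMap.sum_apply]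
    refine (norm_sum_le_of_le _ (n := fun _ => (1 : ℝ)) fun s _ => ?_).trans ?_
    · rw [genElt, ← permAlg_eq, permAlg_single, one_smul, norm_permMat_apply, φ.norm_eq_one]
    · simp
  rw [h α, norm_smul, φ.norm_eq_one, mul_one, Complex.norm_real, Real.norm_eq_abs] at h1
  exact abs_le.mp h1

theorem sum_eval_eq_trace (h : IsEigenbasis (permAlg ρ (indicatorElt (generators cs))) φ ev)
    (r : ℝ[X]) : ∑ α, r.eval (ev α) = (permAlg ρ (polyElt cs r)).trace.re := by
  rw [trace_eq_sum_inner_basis φ, Complex.re_sum]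
  refine Finset.sum_congr rfl fun α _ => ?_
  rw [permAlg_polyElt_apply h, inner_smul_right, inner_self_eq_norm_sq_to_K, φ.norm_eq_one]
  simp

theorem inner_polyElt_sandwich (hM : IsRightAngled M)
    (h : IsEigenbasis (permAlg ρ (indicatorElt (generators cs))) φ ev) (r₁ r₂ : ℝ[X])
    (A : Matrix (Fin N) (Fin N) ℂ) (α β : Fin N) :
    inner ℂ (φ β) (toEuclideanLin (permAlg ρ (polyElt cs r₂) * A * permAlg ρ (polyElt cs r₁)) (φ α)) =
      ((r₂.eval (ev β) * r₁.eval (ev α) : ℝ) : ℂ) * inner ℂ (φ β) (toEuclideanLin A (φ α)) := by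
  rw [mul_assoc, toEuclideanLin_mul_apply, inner_toEuclideanLin, conjTranspose_permAlg_polyElt hM,
    permAlg_polyElt_apply h, toEuclideanLin_mul_apply, permAlg_polyElt_apply h, map_smul,
    inner_smul_left, inner_smul_right, Complex.conj_ofReal]
  push_cast; ring

/-- The Hilbert–Schmidt norm of a matrix between spectral windows. -/
theorem sum_window_le (hM : IsRightAngled M)
    (h : IsEigenbasis (permAlg ρ (indicatorElt (generators cs))) φ ev) {r₁ r₂ : ℝ[X]}
    {J₁ J₂ : Set ℝ} {s : ℝ}
    (h₁ : ∀ x ∈ J₁, x ∈ Set.Icc (-(Nat.card B : ℝ)) (Nat.card B) → 1 ≤ s * r₁.eval x ^ 2)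
    (h₂ : ∀ x ∈ J₂, x ∈ Set.Icc (-(Nat.card B : ℝ)) (Nat.card B) → 1 ≤ s * r₂.eval x ^ 2)
    (A : Matrix (Fin N) (Fin N) ℂ) :
    ∑ α ∈ eigIndices ev J₁, ∑ β ∈ eigIndices ev J₂, ‖inner ℂ (φ β) (toEuclideanLin A (φ α))‖ ^ 2 ≤
      s ^ 2 * hsSq (permAlg ρ (polyElt cs r₂) * A * permAlg ρ (polyElt cs r₁)) := by
  rw [← sum_norm_inner_sq φ, Finset.mul_sum]
  simp only [Finset.mul_sum]
  have hmem : ∀ {J : Set ℝ} {α : Fin N}, α ∈ eigIndices ev J → ev α ∈ J := fun hα => by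
    simpa [eigIndices] using hα
  calc _ ≤ ∑ α ∈ eigIndices ev J₁, ∑ β ∈ eigIndices ev J₂, s ^ 2 * ‖inner ℂ (φ β) (toEuclideanLin
        (permAlg ρ (polyElt cs r₂) * A * permAlg ρ (polyElt cs r₁)) (φ α))‖ ^ 2 := by
        refine Finset.sum_le_sum fun α hα => Finset.sum_le_sum fun β hβ => ?_
        have e1 := h₁ _ (hmem hα) (eigenvalue_mem_Icc hM h α)
        have e2 := h₂ _ (hmem hβ) (eigenvalue_mem_Icc hM h β)
        rw [inner_polyElt_sandwich hM h, norm_mul, mul_pow, Complex.norm_real, Real.norm_eq_abs,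
          sq_abs, ← mul_assoc]
        refine le_mul_of_one_le_left (sq_nonneg _) ?_
        calc (1 : ℝ) ≤ (s * r₁.eval (ev α) ^ 2) * (s * r₂.eval (ev β) ^ 2) :=
              one_le_mul_of_one_le_of_one_le e1 e2
          _ = _ := by ring
    _ ≤ ∑ α ∈ eigIndices ev J₁, ∑ β, s ^ 2 * ‖inner ℂ (φ β) (toEuclideanLin
        (permAlg ρ (polyElt cs r₂) * A * permAlg ρ (polyElt cs r₁)) (φ α))‖ ^ 2 :=
        Finset.sum_le_sum fun α _ => Finset.sum_le_sum_of_subset_of_nonneg (Finset.subset_univ _)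
          fun _ _ _ => by positivity
    _ ≤ _ := Finset.sum_le_sum_of_subset_of_nonneg (Finset.subset_univ _)
          fun _ _ _ => Finset.sum_nonneg fun _ _ => by positivity

theorem norm_sum_add_sq_le {ι : Type*} (T : Finset ι) (f : ι → ℂ) (z : ℂ) :
    ‖∑ t ∈ T, f t + z‖ ^ 2 ≤ ((T.card : ℝ) + 1) * (∑ t ∈ T, ‖f t‖ ^ 2 + ‖z‖ ^ 2) := by
  have h1 : ‖∑ t ∈ T, f t + z‖ ≤ ∑ t ∈ T, ‖f t‖ + ‖z‖ :=
    (norm_add_le _ _).trans (add_le_add_left (norm_sum_le _ _) _)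
  have h3 : (∑ t ∈ T, ‖f t‖) ^ 2 ≤ T.card * ∑ t ∈ T, ‖f t‖ ^ 2 := sq_sum_le_card_mul_sum_sq
  set a := ∑ t ∈ T, ‖f t‖ with ha
  set b := ∑ t ∈ T, ‖f t‖ ^ 2 with hb
  have ha0 : 0 ≤ a := Finset.sum_nonneg fun _ _ => norm_nonneg _
  have hb0 : 0 ≤ b := Finset.sum_nonneg fun _ _ => sq_nonneg _
  have hz := norm_nonneg z
  have hn : (0 : ℝ) ≤ T.card := Nat.cast_nonneg _
  have h4 : 2 * a * ‖z‖ ≤ b + T.card * ‖z‖ ^ 2 := by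
    rcases T.card.eq_zero_or_pos with h0 | h0
    · have : a = 0 := by rw [ha, Finset.card_eq_zero.mp h0]; simp
      rw [this]; nlinarith
    · have hn' : (0 : ℝ) < T.card := by exact_mod_cast h0
      have h5 : a ^ 2 / T.card ≤ b := by rw [div_le_iff₀ hn']; linarith
      have h6 : 2 * a * ‖z‖ ≤ a ^ 2 / T.card + T.card * ‖z‖ ^ 2 := by
        have : a ^ 2 / T.card + T.card * ‖z‖ ^ 2 - 2 * a * ‖z‖ =
          (a - T.card * ‖z‖) ^ 2 / T.card := by field_simp; ring
        have : 0 ≤ (a - T.card * ‖z‖) ^ 2 / T.card := by positivity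
        linarith
      linarith
  calc _ ≤ (a + ‖z‖) ^ 2 := pow_le_pow_left₀ (norm_nonneg _) h1 2
    _ ≤ _ := by nlinarith

/-- The centered matrix is a sum of `|T|` terms and one coincidence error, so Cauchy–Schwarz costs
the factor `|T| + 1`. The error needs no spectral localization. -/
theorem sum_centeredCorr_le (T : Finset Γ) (K : Matrix (Fin N) (Fin N) ℂ) (J₁ J₂ : Set ℝ) :
    ∑ α ∈ eigIndices ev J₁, ∑ β ∈ eigIndices ev J₂, centeredCorr ρ T φ K β α ≤
      ((T.card : ℝ) + 1) * (∑ t ∈ T, ∑ α ∈ eigIndices ev J₁, ∑ β ∈ eigIndices ev J₂,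
        ‖inner ℂ (φ β) (toEuclideanLin (permMat ρ t * diagonal (centeredSymbol ρ K t)) (φ α))‖ ^ 2 +
        hsSq (coincidenceErr ρ T K)) := by
  have hpt : ∀ α β, centeredCorr ρ T φ K β α ≤ ((T.card : ℝ) + 1) * (∑ t ∈ T,
      ‖inner ℂ (φ β) (toEuclideanLin (permMat ρ t * diagonal (centeredSymbol ρ K t)) (φ α))‖ ^ 2 +
      ‖inner ℂ (φ β) (toEuclideanLin (coincidenceErr ρ T K) (φ α))‖ ^ 2) := by
    intro α β
    rw [centeredCorr, ← inner_sub_right, ← LinearMap.sub_apply, ← map_sub, sub_average_eq, map_add,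
      LinearMap.add_apply, inner_add_right, map_sum, LinearMap.sum_apply, inner_sum]
    exact norm_sum_add_sq_le T _ _
  have hE : ∑ α ∈ eigIndices ev J₁, ∑ β ∈ eigIndices ev J₂,
      ‖inner ℂ (φ β) (toEuclideanLin (coincidenceErr ρ T K) (φ α))‖ ^ 2 ≤
      hsSq (coincidenceErr ρ T K) := by
    rw [← sum_norm_inner_sq φ]
    refine (Finset.sum_le_sum fun α _ => Finset.sum_le_sum_of_subset_of_nonneg
      (Finset.subset_univ _) fun _ _ _ => by positivity).trans ?_
    exact Finset.sum_le_sum_of_subset_of_nonneg (Finset.subset_univ _)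
      fun _ _ _ => Finset.sum_nonneg fun _ _ => by positivity
  calc _ ≤ _ := Finset.sum_le_sum fun α _ => Finset.sum_le_sum fun β _ => hpt α β
    _ = ((T.card : ℝ) + 1) * (∑ t ∈ T, ∑ α ∈ eigIndices ev J₁, ∑ β ∈ eigIndices ev J₂,
        ‖inner ℂ (φ β) (toEuclideanLin (permMat ρ t * diagonal (centeredSymbol ρ K t)) (φ α))‖ ^ 2 +
        ∑ α ∈ eigIndices ev J₁, ∑ β ∈ eigIndices ev J₂,
        ‖inner ℂ (φ β) (toEuclideanLin (coincidenceErr ρ T K) (φ α))‖ ^ 2) := by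
        simp only [← Finset.mul_sum, Finset.sum_add_distrib]
        congr 2
        rw [Finset.sum_comm' (s := T) (t := fun _ => eigIndices ev J₁)
          (t' := eigIndices ev J₁) (s' := fun _ => T) (by simp)]
        exact Finset.sum_congr rfl fun α _ => Finset.sum_comm
    _ ≤ _ := by gcongr

/-- The removal of the mean. -/
def centering (N : ℕ) : EuclideanSpace ℂ (Fin N) →ₗ[ℂ] EuclideanSpace ℂ (Fin N) where
  toFun v := WithLp.toLp 2 fun x => v x - (∑ y, v y) / (N : ℂ)
  map_add' v w := by
    ext x
    simp only [PiLp.add_apply, Finset.sum_add_distrib]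
    ring
  map_smul' c v := by
    ext x
    simp only [PiLp.smul_apply, smul_eq_mul, ← Finset.mul_sum, RingHom.id_apply]
    ring

theorem inner_centering (v w : EuclideanSpace ℂ (Fin N)) :
    inner ℂ v (centering N w) = inner ℂ (centering N v) w := by
  simp only [PiLp.inner_apply, centering, LinearMap.coe_mk, AddHom.coe_mk, RCLike.inner_apply,
    sub_mul, map_sub, mul_sub, Finset.sum_sub_distrib, map_div₀, map_sum, Complex.conj_natCast]
  congr 1
  rw [← Finset.mul_sum, ← Finset.sum_mul]
  ring

/-- Removal of the mean is self-adjoint, so orthogonality of a centered vector to `W` follows from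
orthogonality of the vector to the centering of `W`. -/
theorem centeredSymbol_mem_orthogonal {K : Matrix (Fin N) (Fin N) ℂ} {t : Γ}
    {W : Submodule ℂ (EuclideanSpace ℂ (Fin N))}
    (h : WithLp.toLp 2 (fun x => K (ρ t x) x) ∈ (W.map (centering N))ᗮ) :
    WithLp.toLp 2 (centeredSymbol ρ K t) ∈ Wᗮ := by
  rw [Submodule.mem_orthogonal] at h ⊢
  intro w hw
  have h1 := h _ (Submodule.mem_map_of_mem hw)
  rw [← inner_centering] at h1
  exact h1

end Eigenbasis

/-! ### Estimates for spectral windows as `N` grows. -/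

section Asymptotics

open Matrix Polynomial MeasureTheory

variable {B Γ : Type*} [Fintype B] [Group Γ] {M : CoxeterMatrix B} {cs : CoxeterSystem M Γ}

variable (cs) in
/-- A probability measure with the moments of the adjacency operator and bounded Poisson
integrals. -/
structure IsRegularSpectralMeasure (μ : Measure ℝ) : Prop where
  isProbabilityMeasure : IsProbabilityMeasure μ
  null : μ (Set.Icc (-(Nat.card B : ℝ)) (Nat.card B))ᶜ = 0
  moments : ∀ n : ℕ, (indicatorElt (generators cs) ^ n).coeff 1 = ((∫ x, x ^ n ∂μ : ℝ) : ℂ)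
  bound : ∀ E η : ℝ, 0 < η → ∫ x, poisson E η x ∂μ ≤ 6

/-- The bound for the norm of a twisted product of approximate Poisson kernels. -/
def windowNorm (C η : ℝ) : ℝ := C * √(56 / η * √(14 ^ 2 * (56 / η)))

theorem windowNorm_pos {C η : ℝ} (hC : 0 < C) (hη : 0 < η) : 0 < windowNorm C η := by
  unfold windowNorm; positivity

theorem windowNorm_anti {C η η' : ℝ} (hC : 0 < C) (hη : 0 < η) (h : η ≤ η') :
    windowNorm C η' ≤ windowNorm C η := by
  unfold windowNorm; gcongr

theorem tendsto_mul_windowNorm {C : ℝ} :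
    Tendsto (fun η => η * windowNorm C η) (𝓝[>] 0) (𝓝 0) := by
  have hc : Continuous fun η : ℝ => C * √(56 * √(10976 * η)) := by fun_prop
  have h := (hc.tendsto 0).mono_left (nhdsWithin_le_nhds (s := Set.Ioi 0))
  simp only [mul_zero, Real.sqrt_zero] at h
  refine h.congr' ?_
  filter_upwards [self_mem_nhdsWithin] with η hη
  have hη' : (0 : ℝ) < η := hη
  have hm : ∀ b : ℝ, η * √b = √(η ^ 2 * b) := fun b => by
    rw [Real.sqrt_mul (sq_nonneg η), Real.sqrt_sq hη'.le]
  have e : √(10976 * η) = η * √(14 ^ 2 * (56 / η)) := by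
    rw [hm]
    congr 1; field_simp; norm_num
  have e2 : √(56 * √(10976 * η)) = η * √(56 / η * √(14 ^ 2 * (56 / η))) := by
    rw [e, hm (56 / η * _)]
    congr 1; field_simp
  rw [e2, windowNorm]; ring

theorem one_le_mul_poisson {E η x : ℝ} (hη : 0 < η) (h : |x - E| ≤ 2 * η) :
    1 ≤ 5 * η * poisson E η x := by
  have h2 : (x - E) ^ 2 ≤ (2 * η) ^ 2 := sq_le_sq' (abs_le.mp h).1 (abs_le.mp h).2
  unfold poisson
  rw [mul_div_assoc', le_div_iff₀ (by positivity)]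
  nlinarith

/-- The admissible sequences of matrices. -/
structure IsAdmissible {N : ℕ → ℕ} (ρ : ∀ k, Γ →* Equiv.Perm (Fin (N k))) (T : Finset Γ)
    (W : ∀ k, Submodule ℂ (EuclideanSpace ℂ (Fin (N k))))
    (K : ∀ k, Matrix (Fin (N k)) (Fin (N k)) ℂ) : Prop where
  isLocal : ∀ k, IsLocal (ρ k) T (K k)
  norm_le : ∀ k x y, ‖K k x y‖ ≤ 1
  mem : ∀ k, ∀ t ∈ T, WithLp.toLp 2 (centeredSymbol (ρ k) (K k) t) ∈ (W k)ᗮ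

/-- The main estimate for pairs of small spectral windows. -/
theorem exists_window_estimate (hM : IsRightAngled M) (hflex : SuperFlexible (definingDiagram M))
    {μ : Measure ℝ} (hμ : IsRegularSpectralMeasure cs μ) (T : Finset Γ) :
    ∃ G : ℝ → ℝ, (∀ η, 0 < η → 0 ≤ G η) ∧ Tendsto (fun η => G η / η) (𝓝[>] 0) (𝓝 0) ∧
    ∀ {N : ℕ → ℕ} {ρ : ∀ k, Γ →* Equiv.Perm (Fin (N k))}, Tendsto N atTop atTop →
      ConvergesInDistribution ρ → ∃ W : ∀ k, Submodule ℂ (EuclideanSpace ℂ (Fin (N k))),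
      Tendsto (fun k => (Module.finrank ℂ (W k) : ℝ) / N k) atTop (𝓝 0) ∧
      ∀ {φ : ∀ k, OrthonormalBasis (Fin (N k)) ℂ (EuclideanSpace ℂ (Fin (N k)))}
        {ev : ∀ k, Fin (N k) → ℝ},
        (∀ k, IsEigenbasis (permAlg (ρ k) (indicatorElt (generators cs))) (φ k) (ev k)) →
      ∀ {K : ∀ k, Matrix (Fin (N k)) (Fin (N k)) ℂ}, IsAdmissible ρ T W K →
      ∀ E₁ E₂ η ε : ℝ, 0 < η → η ≤ 1 / 2 → 0 < ε → ∀ᶠ k in atTop,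
        ∑ α ∈ eigIndices (ev k) (Set.Icc (E₁ - η) (E₁ + η)),
          ∑ β ∈ eigIndices (ev k) (Set.Icc (E₂ - η) (E₂ + η)),
            centeredCorr (ρ k) T (φ k) (K k) β α ≤ (G η + ε) * N k := by
  have := hμ.isProbabilityMeasure
  obtain ⟨C, hC, hnorm⟩ := exists_norm_twistElt_le cs hM hflex
  refine ⟨fun η => ((T.card : ℝ) + 1) * (T.card * (100 * η ^ 2 * (8 * windowNorm C η))),
    fun η hη => by have := windowNorm_pos hC hη; positivity, ?_, ?_⟩
  · have h := (tendsto_mul_windowNorm (C := C)).const_mul (((T.card : ℝ) + 1) * T.card * 800)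
    rw [mul_zero] at h
    refine h.congr' ?_
    filter_upwards [self_mem_nhdsWithin] with η hη
    have hη' : (0 : ℝ) < η := hη
    field_simp
    ring
  intro N ρ hN hρ
  choose! r hr using fun (E η : ℝ) (hη : 0 < η) =>
    exists_polynomial_sqrt_poisson (Nat.card B : ℝ) E hη
  have hint : ∀ E η : ℝ, 0 < η → η ≤ 1 → _ := fun E η hη hη1 =>
    integral_bounds_of_sqrt_poisson hμ.null hη hη1 (hμ.bound E η hη) (hr E η hη)
  let x : Γ → ℝ → ℝ → MonoidAlgebra ℂ Γ := fun t E η =>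
    polyElt cs (r E η) * MonoidAlgebra.single t 1
  let y : ℝ → ℝ → MonoidAlgebra ℂ Γ := fun E η => polyElt cs (r E η)
  -- The final subspaces must serve all energies and widths at once, so only rational parameters are
  -- used and a countable diagonal argument suffices.
  have hV : ∀ i : T × ℚ × ℚ × {q : ℚ // 0 < q ∧ q ≤ 1}, ∃ V : ∀ k, Submodule ℂ (EuclideanSpace ℂ (Fin (N k))),
      Tendsto (fun k => (Module.finrank ℂ (V k) : ℝ) / N k) atTop (𝓝 0) ∧
      ∀ k, ∀ b ∈ (V k)ᗮ, ‖toEuclideanLin (permAlg (ρ k)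
        (twistElt (starElt (x i.1 i.2.2.1 i.2.2.2.1) * x i.1 i.2.2.1 i.2.2.2.1)
          (y i.2.1 i.2.2.2.1 * starElt (y i.2.1 i.2.2.2.1)))) b‖ ≤
        2 * windowNorm C i.2.2.2.1 * ‖b‖ := by
    rintro ⟨t, E₁, E₂, q, hq, hq1⟩
    have hq' : (0 : ℝ) < q := by exact_mod_cast hq
    have hq1' : (q : ℝ) ≤ 1 := by exact_mod_cast hq1
    refine exists_small_subspace hN hρ _ (windowNorm_pos hC hq') ?_
    exact hnorm hμ.null hμ.moments (r E₁ q) (r E₂ q) t 14 (56 / q) (by norm_num) (by positivity)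
      (hint E₁ q hq' hq1').1 (hint E₁ q hq' hq1').2 (hint E₂ q hq' hq1').2
  choose V hV1 hV2 using hV
  obtain ⟨W, hW1, hW2⟩ := exists_small_subspace_of_countable V hV1
  refine ⟨W, hW1, ?_⟩
  intro φ ev hev K hK E₁ E₂ η ε hη hη2 hε
  -- The window of radius `η` about `E` lies within `2η < 2q` of a rational center `F` between `E`
  -- and `E + η`. The assumption `η ≤ 1/2` gives `q ≤ 1`, and `q < 2η` gives `(5q)² ≤ 100 η²`.
  obtain ⟨q, hq1, hq2⟩ := exists_rat_btwn (show η < 2 * η by linarith)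
  obtain ⟨F₁, hF1, hF1'⟩ := exists_rat_btwn (show E₁ < E₁ + η by linarith)
  obtain ⟨F₂, hF2, hF2'⟩ := exists_rat_btwn (show E₂ < E₂ + η by linarith)
  have hq0 : (0 : ℝ) < q := hη.trans hq1
  have hqmem : 0 < q ∧ q ≤ 1 :=
    ⟨by exact_mod_cast hq0, by exact_mod_cast (show (q : ℝ) ≤ 1 by linarith)⟩
  have hwin : ∀ (E F : ℝ), E < F → F < E + η → ∀ z ∈ Set.Icc (E - η) (E + η),
      z ∈ Set.Icc (-(Nat.card B : ℝ)) (Nat.card B) → 1 ≤ 5 * q * (r F q).eval z ^ 2 := by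
    intro E F h1 h2 z hz hzn
    have h3 := one_le_mul_poisson (E := F) (x := z) hq0
      (abs_le.mpr ⟨by linarith [hz.1], by linarith [hz.2]⟩)
    have h4 := (hr F q hq0 z hzn).1
    have h5 : poisson F q z ≤ (r F q).eval z ^ 2 := by
      rw [← Real.sq_sqrt (poisson_pos F z hq0).le]
      exact pow_le_pow_left₀ (Real.sqrt_nonneg _) h4 2
    exact h3.trans (by gcongr)
  have hL := windowNorm_pos hC hq0
  set err : ℕ → ℝ := fun k => ((T.card : ℝ) + 1) * (∑ t ∈ T, 100 * η ^ 2 * (4 *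
    crossErr (ρ k) (starElt (x t F₂ q) * x t F₂ q) (y F₁ q * starElt (y F₁ q))) +
    coincidenceCount (ρ k) T) with herr
  have herr0 : Tendsto (fun k => err k / N k) atTop (𝓝 0) := by
    have h1 : Tendsto (fun k => ((T.card : ℝ) + 1) * (∑ t ∈ T, 100 * η ^ 2 * (4 *
        (crossErr (ρ k) (starElt (x t F₂ q) * x t F₂ q) (y F₁ q * starElt (y F₁ q)) / N k)) +
        coincidenceCount (ρ k) T / N k)) atTop
        (𝓝 (((T.card : ℝ) + 1) * (∑ t ∈ T, 100 * η ^ 2 * (4 * 0) + 0))) :=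
      ((tendsto_finsetSum T fun t _ => ((tendsto_crossErr hρ _ _).const_mul 4).const_mul _).add
        (tendsto_coincidenceCount hρ T)).const_mul _
    simp only [mul_zero, Finset.sum_const_zero, add_zero] at h1
    refine h1.congr fun k => ?_
    rw [herr, mul_div_assoc, add_div, Finset.sum_div]
    simp only [mul_div_assoc]
  have hWall : ∀ᶠ k in atTop, ∀ t : T, V ⟨t, F₁, F₂, q, hqmem⟩ k ≤ W k :=
    eventually_all.mpr fun t => hW2 _
  filter_upwards [hWall, herr0.eventually_le_const hε, hN.eventually_gt_atTop 0] with k hk1 hk2 hk3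
  have hNk : (0 : ℝ) < N k := by exact_mod_cast hk3
  rw [div_le_iff₀ hNk] at hk2
  have hb := fun t => norm_centeredSymbol_le (ρ k) (hK.norm_le k) t
  have hterm : ∀ t ∈ T, ∑ α ∈ eigIndices (ev k) (Set.Icc (E₁ - η) (E₁ + η)),
      ∑ β ∈ eigIndices (ev k) (Set.Icc (E₂ - η) (E₂ + η)), ‖inner ℂ (φ k β) (toEuclideanLin
        (permMat (ρ k) t * diagonal (centeredSymbol (ρ k) (K k) t)) (φ k α))‖ ^ 2 ≤
      100 * η ^ 2 * (8 * windowNorm C η * N k) + 100 * η ^ 2 * (4 *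
        crossErr (ρ k) (starElt (x t F₂ q) * x t F₂ q) (y F₁ q * starElt (y F₁ q))) := by
    intro t ht
    have h1 := sum_window_le hM (hev k) (hwin E₁ F₁ hF1 hF1') (hwin E₂ F₂ hF2 hF2')
      (permMat (ρ k) t * diagonal (centeredSymbol (ρ k) (K k) t))
    have hmem : WithLp.toLp 2 (centeredSymbol (ρ k) (K k) t) ∈
        (V ⟨⟨t, ht⟩, F₁, F₂, q, hqmem⟩ k)ᗮ :=
      Submodule.orthogonal_le (hk1 ⟨t, ht⟩) (hK.mem k t ht)
    have h2 := hsSq_permAlg_diagonal_le (ρ k) (hb t) (x t F₂ q) (y F₁ q)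
      (hV2 ⟨⟨t, ht⟩, F₁, F₂, q, hqmem⟩ k _ hmem) hL.le
    have e : permAlg (ρ k) (x t F₂ q) = permAlg (ρ k) (polyElt cs (r F₂ q)) * permMat (ρ k) t := by
      rw [permAlg_mul, permAlg_single, one_smul]
    rw [e, mul_assoc (permAlg (ρ k) (polyElt cs (r F₂ q)))] at h2
    have h3 := windowNorm_anti hC hη hq1.le
    have h4 : (5 * (q : ℝ)) ^ 2 ≤ 100 * η ^ 2 := by nlinarith
    have h5 : 0 ≤ 8 * windowNorm C q * N k + 4 *
        crossErr (ρ k) (starElt (x t F₂ q) * x t F₂ q) (y F₁ q * starElt (y F₁ q)) := by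
      refine le_trans ?_ h2
      exact Finset.sum_nonneg fun _ _ => Finset.sum_nonneg fun _ _ => sq_nonneg _
    calc _ ≤ _ := h1
      _ ≤ (5 * (q : ℝ)) ^ 2 * _ := mul_le_mul_of_nonneg_left h2 (sq_nonneg _)
      _ ≤ 100 * η ^ 2 * _ := mul_le_mul_of_nonneg_right h4 h5
      _ ≤ 100 * η ^ 2 * (8 * windowNorm C η * N k + 4 *
        crossErr (ρ k) (starElt (x t F₂ q) * x t F₂ q) (y F₁ q * starElt (y F₁ q))) := by gcongr
      _ = _ := by ring
  calc _ ≤ _ := sum_centeredCorr_le T (K k) _ _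
    _ ≤ ((T.card : ℝ) + 1) * (∑ t ∈ T, (100 * η ^ 2 * (8 * windowNorm C η * N k) + 100 * η ^ 2 * (4 *
        crossErr (ρ k) (starElt (x t F₂ q) * x t F₂ q) (y F₁ q * starElt (y F₁ q)))) +
        coincidenceCount (ρ k) T) := by
        gcongr with t ht
        · exact hterm t ht
        · exact hsSq_coincidenceErr_le (ρ k) (hK.isLocal k) (hK.norm_le k)
    _ = ((T.card : ℝ) + 1) * (T.card * (100 * η ^ 2 * (8 * windowNorm C η))) * N k + err k := by
        rw [herr, Finset.sum_add_distrib, Finset.sum_const, nsmul_eq_mul]; ring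
    _ ≤ _ := by
        rw [add_mul _ ε]
        exact add_le_add le_rfl hk2

/-- The narrow kernel is at most `1 / (δη)` inside the window. Outside, the wide kernel with weight
`2δ` dominates it, because there `(x - E)² + η² ≤ 2 (x - E)²`. -/
theorem indicator_ge_poisson {E η δ x : ℝ} (hη : 0 < η) (hδ : 0 < δ) :
    δ * η * (poisson E (δ * η) x - 2 * δ * poisson E η x) ≤
      (Set.Icc (E - η) (E + η)).indicator 1 x := by
  have h1 := poisson_pos E x hη
  have hδη : 0 < δ * η := mul_pos hδ hη
  by_cases hx : x ∈ Set.Icc (E - η) (E + η)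
  · rw [Set.indicator_of_mem hx]
    have h2 := poisson_le_inv E x hδη
    calc _ ≤ δ * η * (1 / (δ * η)) := by
          gcongr
          have : 0 < 2 * δ * poisson E η x := by positivity
          linarith
      _ = 1 := by field_simp
  · rw [Set.indicator_of_notMem hx]
    refine mul_nonpos_of_nonneg_of_nonpos hδη.le (sub_nonpos.mpr ?_)
    have h3 : η < |x - E| := by
      by_contra h
      have := abs_le.mp (not_lt.mp h)
      exact hx ⟨by linarith [this.1], by linarith [this.2]⟩
    have h4 : η ^ 2 ≤ (x - E) ^ 2 := by rw [← sq_abs (x - E)]; gcongr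
    have h5 : 0 < (x - E) ^ 2 := lt_of_lt_of_le (by positivity) h4
    unfold poisson
    rw [mul_div_assoc', div_le_div_iff₀ (by positivity) (by positivity)]
    nlinarith [mul_pos hδ hη, mul_le_mul_of_nonneg_left h4 hδη.le, pow_pos hδη 3]

/-- A lower bound for the number of eigenvalues in a window. -/
theorem exists_card_lower_bound {μ : Measure ℝ} (hM : IsRightAngled M)
    (hμ : IsRegularSpectralMeasure cs μ) {I : Set ℝ} {c : ℝ} (hc : 0 < c)
    (hlow : ∀ E ∈ I, ∀ η : ℝ, 0 < η → η ≤ 1 → c ≤ ∫ x, poisson E η x ∂μ) :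
    ∃ c' > 0, ∀ {N : ℕ → ℕ} {ρ : ∀ k, Γ →* Equiv.Perm (Fin (N k))}, Tendsto N atTop atTop →
      ConvergesInDistribution ρ →
      ∀ {φ : ∀ k, OrthonormalBasis (Fin (N k)) ℂ (EuclideanSpace ℂ (Fin (N k)))}
        {ev : ∀ k, Fin (N k) → ℝ},
        (∀ k, IsEigenbasis (permAlg (ρ k) (indicatorElt (generators cs))) (φ k) (ev k)) →
      ∀ E ∈ I, ∀ η : ℝ, 0 < η → η ≤ 1 → ∀ᶠ k in atTop,
        c' * η * N k ≤ (eigIndices (ev k) (Set.Icc (E - η) (E + η))).card := by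
  have := hμ.isProbabilityMeasure
  -- The wide kernel integrates to at most `6`, so its weight `2δ` removes at most half of the lower
  -- bound `c`.
  set δ := min 1 (c / 24) with hδ
  have hδ0 : 0 < δ := lt_min one_pos (by positivity)
  have hδ1 : δ ≤ 1 := min_le_left _ _
  have hδc : δ ≤ c / 24 := min_le_right _ _
  refine ⟨δ * c / 4, by positivity, ?_⟩
  intro N ρ hN hρ φ ev hev E hE η hη hη1
  have hδη : 0 < δ * η := mul_pos hδ0 hη
  have hδη1 : δ * η ≤ 1 := mul_le_one₀ hδ1 hη.le hη1
  set g : ℝ → ℝ := fun x => δ * η * (poisson E (δ * η) x - 2 * δ * poisson E η x) with hg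
  have hc1 := continuous_poisson E hδη
  have hc2 := continuous_poisson E hη
  have hgc : Continuous g := by fun_prop
  have hgint : δ * η * (c / 2) ≤ ∫ x, g x ∂μ := by
    have h1 := hlow E hE _ hδη hδη1
    have h2 := hμ.bound E η hη
    rw [hg, integral_const_mul, integral_sub (integrable_of_continuous_of_null hμ.null hc1)
      ((integrable_of_continuous_of_null hμ.null hc2).const_mul _), integral_const_mul]
    refine mul_le_mul_of_nonneg_left ?_ hδη.le
    nlinarith
  -- It is lost three times: in the integral of the polynomial, in the limit of traces, and at each
  -- eigenvalue. What remains of `δηc / 2` exceeds `δηc / 4`.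
  set ε := δ * η * c / 16 with hε
  have hε0 : 0 < ε := by positivity
  obtain ⟨p, hp⟩ := exists_polynomial_near_of_continuousOn (-(Nat.card B : ℝ)) (Nat.card B) g
    hgc.continuousOn ε hε0
  have hpint : δ * η * (c / 2) - ε ≤ ∫ x, p.eval x ∂μ := by
    have h1 := abs_integral_sub_le hμ.null p.continuous hgc fun x hx => (hp x hx).le
    linarith [(abs_le.mp h1).1]
  have ht := (Complex.continuous_re.tendsto _).comp (tendsto_trace_permAlg hN hρ (polyElt cs p))
  rw [coeff_polyElt_one hμ.null hμ.moments, Complex.ofReal_re] at ht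
  filter_upwards [ht.eventually_const_le (show (∫ x, p.eval x ∂μ) - ε < _ by linarith),
    hN.eventually_gt_atTop 0] with k hk1 hk2
  have hNk : (0 : ℝ) < N k := by exact_mod_cast hk2
  simp only [Function.comp_apply] at hk1
  rw [← Complex.ofReal_natCast, Complex.div_ofReal_re, ← sum_eval_eq_trace (hev k),
    le_div_iff₀ hNk] at hk1
  have h1 : ∑ α, p.eval (ev k α) ≤
      (eigIndices (ev k) (Set.Icc (E - η) (E + η))).card + ε * N k := by
    calc ∑ α, p.eval (ev k α) ≤
        ∑ α, ((Set.Icc (E - η) (E + η)).indicator 1 (ev k α) + ε) := by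
          refine Finset.sum_le_sum fun α _ => ?_
          have h2 := (abs_lt.mp (hp _ (eigenvalue_mem_Icc hM (hev k) α))).2
          have h3 := indicator_ge_poisson (E := E) (x := ev k α) hη hδ0
          linarith
      _ = _ := by
          rw [Finset.sum_add_distrib, Finset.sum_const, Finset.card_univ, Fintype.card_fin,
            nsmul_eq_mul, mul_comm (N k : ℝ)]
          congr 1
          rw [eigIndices, Finset.card_filter]
          push_cast
          refine Finset.sum_congr rfl fun α _ => ?_
          simp [Set.indicator_apply]
  have h4 : (δ * η * (c / 2) - ε - ε) * N k ≤ (∫ x, p.eval x ∂μ - ε) * N k := by gcongr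
  have h5 : δ * c / 4 * η * N k ≤ (δ * η * (c / 2) - ε - ε - ε) * N k := by
    gcongr
    rw [hε]; nlinarith [mul_pos hδη hc]
  linarith

end Asymptotics

/-! ### Deduction of quantum ergodicity and mixing. -/

section Conclusions

open MeasureTheory

variable {Γ : Type*} [Group Γ] {N : ℕ → ℕ} {ρ : ∀ k, Γ →* Equiv.Perm (Fin (N k))} {T : Finset Γ}
  {φ : ∀ k, OrthonormalBasis (Fin (N k)) ℂ (EuclideanSpace ℂ (Fin (N k)))}
  {ev : ∀ k, Fin (N k) → ℝ} {K : ∀ k, Matrix (Fin (N k)) (Fin (N k)) ℂ}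

theorem centeredCorr_nonneg {n : ℕ} (ρ : Γ →* Equiv.Perm (Fin n)) (T : Finset Γ)
    (φ : OrthonormalBasis (Fin n) ℂ (EuclideanSpace ℂ (Fin n))) (K : Matrix (Fin n) (Fin n) ℂ)
    (β α : Fin n) : 0 ≤ centeredCorr ρ T φ K β α := sq_nonneg _

theorem mem_eigIndices {n : ℕ} {ev : Fin n → ℝ} {J : Set ℝ} {α : Fin n} :
    α ∈ eigIndices ev J ↔ ev α ∈ J := by simp [eigIndices]

/-- Covering an interval by windows. -/
theorem sum_diag_le_sum_windows {n : ℕ} {ev : Fin n → ℝ} {a : Fin n → Fin n → ℝ}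
    (ha : ∀ β α, 0 ≤ a β α) {c d η : ℝ} (hη : 0 < η) :
    ∑ α ∈ eigIndices ev (Set.Icc c d), a α α ≤ ∑ i ∈ Finset.range (⌊(d - c) / (2 * η)⌋₊ + 1),
      ∑ α ∈ eigIndices ev (Set.Icc (c + (2 * i + 1) * η - η) (c + (2 * i + 1) * η + η)),
      ∑ β ∈ eigIndices ev (Set.Icc (c + (2 * i + 1) * η - η) (c + (2 * i + 1) * η + η)), a β α := by
  classical
  set J : ℕ → Set ℝ := fun i => Set.Icc (c + (2 * i + 1) * η - η) (c + (2 * i + 1) * η + η)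
  have h1 : ∀ α ∈ eigIndices ev (Set.Icc c d), a α α ≤
      ∑ i ∈ Finset.range (⌊(d - c) / (2 * η)⌋₊ + 1), if α ∈ eigIndices ev (J i) then a α α else 0 := by
    intro α hα
    rw [mem_eigIndices] at hα
    have h2 : 0 ≤ (ev α - c) / (2 * η) := div_nonneg (by linarith [hα.1]) (by positivity)
    set i := ⌊(ev α - c) / (2 * η)⌋₊ with hi
    have h3 := Nat.floor_le h2
    have h4 := Nat.lt_floor_add_one ((ev α - c) / (2 * η))
    rw [le_div_iff₀ (by positivity)] at h3
    rw [div_lt_iff₀ (by positivity)] at h4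
    have hmem : α ∈ eigIndices ev (J i) :=
      mem_eigIndices.mpr ⟨by rw [← hi] at h3; linarith, by rw [← hi] at h4; linarith⟩
    have hir : i ∈ Finset.range (⌊(d - c) / (2 * η)⌋₊ + 1) := by
      rw [Finset.mem_range, Nat.lt_succ_iff]
      exact Nat.floor_le_floor (by gcongr; exact hα.2)
    calc a α α = if α ∈ eigIndices ev (J i) then a α α else 0 := (if_pos hmem).symm
      _ ≤ _ := Finset.single_le_sum (f := fun i => if α ∈ eigIndices ev (J i) then a α α else 0)
          (fun j _ => by split_ifs <;> simp [ha]) hir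
  calc _ ≤ _ := Finset.sum_le_sum h1
    _ ≤ ∑ α, ∑ i ∈ Finset.range (⌊(d - c) / (2 * η)⌋₊ + 1),
        if α ∈ eigIndices ev (J i) then a α α else 0 :=
        Finset.sum_le_sum_of_subset_of_nonneg (Finset.subset_univ _) fun _ _ _ =>
          Finset.sum_nonneg fun _ _ => by split_ifs <;> simp [ha]
    _ = ∑ i ∈ Finset.range (⌊(d - c) / (2 * η)⌋₊ + 1), ∑ α ∈ eigIndices ev (J i), a α α := by
        rw [Finset.sum_comm]
        refine Finset.sum_congr rfl fun i _ => ?_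
        rw [Finset.sum_ite_mem, Finset.univ_inter]
    _ ≤ _ := Finset.sum_le_sum fun i _ => Finset.sum_le_sum fun α hα =>
        Finset.single_le_sum (f := fun β => a β α) (fun β _ => ha β α) hα

/-- For fixed `η` the quotient is eventually at most `G η / (c η) + η / c`; the choice `ε = η²`
makes the error term vanish with `η`. -/
theorem quantumMixing_of_estimates {G : ℝ → ℝ}
    (hG : Tendsto (fun η => G η / η) (𝓝[>] 0) (𝓝 0)) (hN : Tendsto N atTop atTop)
    (hup : ∀ E₁ E₂ η ε : ℝ, 0 < η → η ≤ 1 / 2 → 0 < ε → ∀ᶠ k in atTop,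
        ∑ α ∈ eigIndices (ev k) (Set.Icc (E₁ - η) (E₁ + η)),
          ∑ β ∈ eigIndices (ev k) (Set.Icc (E₂ - η) (E₂ + η)),
            centeredCorr (ρ k) T (φ k) (K k) β α ≤ (G η + ε) * N k)
    {I : Set ℝ} {c : ℝ} (hc : 0 < c)
    (hlow : ∀ E ∈ interior I, ∀ η : ℝ, 0 < η → η ≤ 1 → ∀ᶠ k in atTop,
      c * η * N k ≤ (eigIndices (ev k) (Set.Icc (E - η) (E + η))).card) :
    QuantumMixing ρ T φ ev K I := by
  intro E₁ hE₁ E₂ _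
  have hlim : Tendsto (fun η : ℝ => ENNReal.ofReal (G η / η / c + η / c)) (𝓝[>] 0) (𝓝 0) := by
    have h1 : Tendsto (fun η : ℝ => G η / η / c + η / c) (𝓝[>] 0) (𝓝 (0 / c + 0 / c)) :=
      (hG.div_const c).add (tendsto_nhdsWithin_of_tendsto_nhds tendsto_id |>.div_const c)
    simpa using ENNReal.tendsto_ofReal h1
  refine tendsto_of_tendsto_of_tendsto_of_le_of_le' tendsto_const_nhds hlim
    (Eventually.of_forall fun _ => zero_le) ?_
  filter_upwards [Ioc_mem_nhdsGT (show (0 : ℝ) < 1 / 2 by norm_num)] with η hη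
  refine limsup_le_of_le (by isBoundedDefault) ?_
  filter_upwards [hup E₁ E₂ η (η ^ 2) hη.1 hη.2 (pow_pos hη.1 2),
    hlow E₁ hE₁ η hη.1 (by linarith [hη.2]), hN.eventually_gt_atTop 0] with k h1 h2 h3
  refine ENNReal.ofReal_le_ofReal ?_
  have hNk : (0 : ℝ) < N k := by exact_mod_cast h3
  have hη0 := hη.1
  have hpos : 0 < c * η * N k := by positivity
  have hnn : 0 ≤ ∑ α ∈ eigIndices (ev k) (Set.Icc (E₁ - η) (E₁ + η)),
      ∑ β ∈ eigIndices (ev k) (Set.Icc (E₂ - η) (E₂ + η)),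
        centeredCorr (ρ k) T (φ k) (K k) β α :=
    Finset.sum_nonneg fun _ _ => Finset.sum_nonneg fun _ _ => centeredCorr_nonneg _ _ _ _ _ _
  calc _ ≤ (∑ α ∈ eigIndices (ev k) (Set.Icc (E₁ - η) (E₁ + η)),
      ∑ β ∈ eigIndices (ev k) (Set.Icc (E₂ - η) (E₂ + η)),
        centeredCorr (ρ k) T (φ k) (K k) β α) / (c * η * N k) :=
        div_le_div_of_nonneg_left hnn hpos h2
    _ ≤ ((G η + η ^ 2) * N k) / (c * η * N k) := by gcongr
    _ = _ := by field_simp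

/-- The diagonal terms are covered by about `(d - c) / (2η)` windows, each contributing at most `(G
η + η²) N`. One fixed window in the middle of the interval shows that the number of eigenvalues is
at least a constant times `N`. -/
theorem quantumErgodic_of_estimates {G : ℝ → ℝ} (hG0 : ∀ η, 0 < η → 0 ≤ G η)
    (hG : Tendsto (fun η => G η / η) (𝓝[>] 0) (𝓝 0)) (hN : Tendsto N atTop atTop)
    (hup : ∀ E₁ E₂ η ε : ℝ, 0 < η → η ≤ 1 / 2 → 0 < ε → ∀ᶠ k in atTop,
        ∑ α ∈ eigIndices (ev k) (Set.Icc (E₁ - η) (E₁ + η)),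
          ∑ β ∈ eigIndices (ev k) (Set.Icc (E₂ - η) (E₂ + η)),
            centeredCorr (ρ k) T (φ k) (K k) β α ≤ (G η + ε) * N k)
    {c d κ : ℝ} (hcd : c < d) (hκ : 0 < κ)
    (hlow : ∀ E ∈ Set.Icc c d, ∀ η : ℝ, 0 < η → η ≤ 1 → ∀ᶠ k in atTop,
      κ * η * N k ≤ (eigIndices (ev k) (Set.Icc (E - η) (E + η))).card) :
    QuantumErgodic ρ T φ ev K (Set.Icc c d) := by
  set η₀ := min 1 ((d - c) / 2) with hη₀
  have hη₀0 : 0 < η₀ := lt_min one_pos (by linarith)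
  have hη₀1 : η₀ ≤ (d - c) / 2 := min_le_right _ _
  have hlim : Tendsto (fun η : ℝ => ((d - c) / 2 + η) * (G η / η + η) / (κ * η₀)) (𝓝[>] 0)
      (𝓝 0) := by
    have hid : Tendsto (fun η : ℝ => η) (𝓝[>] 0) (𝓝 0) :=
      tendsto_nhdsWithin_of_tendsto_nhds tendsto_id
    have h1 := ((hid.const_add ((d - c) / 2)).mul (hG.add hid)).div_const (κ * η₀)
    simpa using h1
  rw [QuantumErgodic, Metric.tendsto_atTop']
  intro δ hδ
  obtain ⟨η, hη1, hη2, hη0⟩ := ((hlim.eventually_lt_const hδ).and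
    (Ioc_mem_nhdsGT (show (0 : ℝ) < 1 / 2 by norm_num))).exists
  have hwin : ∀ᶠ k in atTop, ∀ i ∈ Finset.range (⌊(d - c) / (2 * η)⌋₊ + 1),
      ∑ α ∈ eigIndices (ev k) (Set.Icc (c + (2 * i + 1) * η - η) (c + (2 * i + 1) * η + η)),
      ∑ β ∈ eigIndices (ev k) (Set.Icc (c + (2 * i + 1) * η - η) (c + (2 * i + 1) * η + η)),
        centeredCorr (ρ k) T (φ k) (K k) β α ≤ (G η + η ^ 2) * N k :=
    (Finset.range _).eventually_all.mpr fun i _ => hup _ _ η (η ^ 2) hη2 hη0 (pow_pos hη2 2)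
  obtain ⟨k₀, hk₀⟩ := eventually_atTop.mp (hwin.and ((hlow ((c + d) / 2)
    ⟨by linarith, by linarith⟩ η₀ hη₀0 (min_le_left _ _)).and (hN.eventually_gt_atTop 0)))
  refine ⟨k₀, fun k hk => ?_⟩
  obtain ⟨h1, h2, h3⟩ := hk₀ k hk.le
  have hNk : (0 : ℝ) < N k := by exact_mod_cast h3
  have hsum := sum_diag_le_sum_windows (ev := ev k)
    (fun β α => centeredCorr_nonneg (ρ k) T (φ k) (K k) β α) (c := c) (d := d) hη2
  have hnn : 0 ≤ ∑ α ∈ eigIndices (ev k) (Set.Icc c d), centeredCorr (ρ k) T (φ k) (K k) α α :=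
    Finset.sum_nonneg fun _ _ => centeredCorr_nonneg _ _ _ _ _ _
  have hm : ((⌊(d - c) / (2 * η)⌋₊ + 1 : ℕ) : ℝ) ≤ (d - c) / (2 * η) + 1 := by
    push_cast
    have : 0 ≤ (d - c) / (2 * η) := div_nonneg (by linarith) (by positivity)
    linarith [Nat.floor_le this]
  have hcard : κ * η₀ * N k ≤ (eigIndices (ev k) (Set.Icc c d)).card := by
    refine h2.trans ?_
    have : eigIndices (ev k) (Set.Icc ((c + d) / 2 - η₀) ((c + d) / 2 + η₀)) ⊆
        eigIndices (ev k) (Set.Icc c d) := fun α hα => by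
      rw [mem_eigIndices] at hα ⊢
      exact ⟨by linarith [hα.1], by linarith [hα.2]⟩
    exact_mod_cast Finset.card_le_card this
  have hGη := hG0 η hη2
  have hpos : 0 < κ * η₀ * N k := by positivity
  rw [Real.dist_eq, sub_zero, abs_of_nonneg (div_nonneg hnn (Nat.cast_nonneg _))]
  calc _ ≤ (∑ α ∈ eigIndices (ev k) (Set.Icc c d), centeredCorr (ρ k) T (φ k) (K k) α α) /
        (κ * η₀ * N k) := div_le_div_of_nonneg_left hnn hpos hcard
    _ ≤ (((d - c) / (2 * η) + 1) * ((G η + η ^ 2) * N k)) / (κ * η₀ * N k) := by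
        gcongr
        refine hsum.trans ((Finset.sum_le_sum h1).trans ?_)
        rw [Finset.sum_const, Finset.card_range, nsmul_eq_mul]
        gcongr
    _ = ((d - c) / 2 + η) * (G η / η + η) / (κ * η₀) := by field_simp
    _ < δ := hη1

end Conclusions

/-! ### The central triple as an indexed family. -/

section CentralTriple

variable {B : Type*} {M : CoxeterMatrix B}

theorem exists_triple (htriple : HasCentralTriple (definingDiagram M)) :
    ∃ tri : Fin 3 → B, Function.Injective tri ∧ (∀ i j, M (tri i) (tri j) ≠ 2) ∧
      ∀ s, s ∉ Set.range tri → ∀ i, M s (tri i) = 2 := by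
  obtain ⟨a, b, c, hab, hac, hbc, h1, h2, h3, h⟩ := htriple
  have h1' : M a b ≠ 2 := h1
  have h2' : M a c ≠ 2 := h2
  have h3' : M b c ≠ 2 := h3
  refine ⟨![a, b, c], ?_, ?_, ?_⟩
  · intro i j hij
    fin_cases i <;> fin_cases j <;> simp_all
  · intro i j
    fin_cases i <;> fin_cases j <;> simp [h1', h2', h3', M.symmetric b a, M.symmetric c a,
      M.symmetric c b]
  · intro s hs i
    have hs' : s ≠ a ∧ s ≠ b ∧ s ≠ c :=
      ⟨fun e => hs ⟨0, e.symm⟩, fun e => hs ⟨1, e.symm⟩, fun e => hs ⟨2, e.symm⟩⟩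
    obtain ⟨g1, g2, g3⟩ := h s hs'.1 hs'.2.1 hs'.2.2
    fin_cases i
    · exact g1
    · exact g2
    · exact g3

end CentralTriple

end SchreierQE

end

/-! ### Assembly of the theorem. -/

theorem corollaryt {B Γ : Type*} [Finite B] [Group Γ] {M : CoxeterMatrix B}
    (cs : CoxeterSystem M Γ) (hM : IsRightAngled M)
    (hflex : SuperFlexible (definingDiagram M))
    (htriple : HasCentralTriple (definingDiagram M)) :
    -- the rapid decay property
    (∃ C₁ : ℝ, 0 < C₁ ∧ RapidDecay Γ C₁) ∧
    -- permutation representations of growing dimension converging in distribution exist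
    (∃ (N : ℕ → ℕ) (ρ : ∀ k, Γ →* Equiv.Perm (Fin (N k))),
      StrictMono N ∧ ConvergesInDistribution ρ) ∧
    -- on the spectrum outside a finite set
    ∃ D : Set ℝ, D.Finite ∧
      IsOpen (realSpectrum (leftRegAlg (indicatorElt (generators cs))) \ D) ∧
      ∀ a b : ℝ, a < b →
        Set.Icc a b ⊆ realSpectrum (leftRegAlg (indicatorElt (generators cs))) \ D →
        -- absolute continuity and the fourth-moment condition
        ACCondition (leftRegAlg (indicatorElt (generators cs))) (Set.Icc a b) ∧
        (∀ C₁ : ℝ, 0 < C₁ → RapidDecay Γ C₁ → ∃ C₁' : ℝ, 2 * C₁ + 1 < C₁' ∧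
          FourthMomentCondition (generators cs : Set Γ)
            (leftRegAlg (indicatorElt (generators cs))) (Set.Icc a b) C₁') ∧
        -- quantum ergodicity and quantum mixing outside subspaces of dimension `o(N)`
        ∀ (N : ℕ → ℕ) (ρ : ∀ k, Γ →* Equiv.Perm (Fin (N k))),
          Tendsto N atTop atTop → ConvergesInDistribution ρ →
          ∀ c d : ℝ, c < d → Set.Icc c d ⊆ interior (Set.Icc a b) →
          ∀ (φ : ∀ k, OrthonormalBasis (Fin (N k)) ℂ (EuclideanSpace ℂ (Fin (N k))))
            (ev : ∀ k, Fin (N k) → ℝ),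
            (∀ k, IsEigenbasis (permAlg (ρ k) (indicatorElt (generators cs)))
              (φ k) (ev k)) →
          ∀ T : Finset Γ,
          ∃ H : ∀ k, Submodule ℂ (EuclideanSpace ℂ (Fin (N k))),
            Tendsto (fun k => (Module.finrank ℂ (H k) : ℝ) / (N k : ℝ)) atTop (𝓝 0) ∧
            ∀ K : ∀ k, Matrix (Fin (N k)) (Fin (N k)) ℂ,
              (∀ k, IsLocal (ρ k) T (K k)) →
              (∀ k x y, ‖K k x y‖ ≤ 1) →
              (∀ k, ∀ t ∈ T, WithLp.toLp 2 (fun x => K k (ρ k t x) x) ∈ (H k)ᗮ) →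
              QuantumErgodic ρ T φ ev K (Set.Icc c d) ∧
              QuantumMixing ρ T φ ev K (Set.Icc c d) := by
  have := Fintype.ofFinite B
  refine ⟨rapidDecay_of_isRightAngled cs hM, exists_convergesInDistribution cs hM, ?_⟩
  obtain ⟨tri, hinj, htri, hrest⟩ := exists_triple htriple
  obtain ⟨μ, hμ, hnull, hmom, hR, hup, D, hD, hopen, hlow⟩ :=
    exists_spectral_data (cs := cs) hM hinj htri hrest
  have hspec : IsRegularSpectralMeasure cs μ := ⟨hμ, hnull, hmom, hup⟩
  refine ⟨D, hD, hopen, fun a b _ hIab => ?_⟩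
  obtain ⟨c₀, hc₀, hlow⟩ := hlow a b hIab
  -- The fourth-moment bound holds for every exponent, so any number above `2 * C₁ + 1` serves.
  refine ⟨?_, fun C₁ _ _ => ⟨2 * C₁ + 2, by linarith, ?_⟩, ?_⟩
  · refine acCondition_of_bounds (fun E η hη => ?_) hup hc₀ hlow
    obtain ⟨R, hR1, hR2, -⟩ := hR E η hη
    rw [← hR1, hR2]
  · exact fourthMomentCondition_of_bounds hM hflex hnull hR hup _ _
  · intro N ρ hN hρ c d hcd hsub φ ev hev T
    obtain ⟨G, hG0, hG, hest⟩ := exists_window_estimate hM hflex hspec T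
    obtain ⟨κ, hκ, hcard⟩ := exists_card_lower_bound hM hspec hc₀ hlow
    obtain ⟨W, hW, hest⟩ := hest hN hρ
    have hcd' : Set.Icc c d ⊆ Set.Icc a b := hsub.trans interior_subset
    -- The estimates require the centered symbols to be orthogonal to `W`, while the hypothesis
    -- concerns the symbols themselves; taking the image under centering does not increase
    -- dimension.
    refine ⟨fun k => (W k).map (centering (N k)), ?_, fun K hloc hK hmem => ?_⟩
    · refine squeeze_zero (fun k => by positivity) (fun k => ?_) hW
      gcongr
      exact Submodule.finrank_map_le _ _
    · have hadm : IsAdmissible ρ T W K :=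
        ⟨hloc, hK, fun k t ht => centeredSymbol_mem_orthogonal (hmem k t ht)⟩
      exact ⟨quantumErgodic_of_estimates hG0 hG hN (hest hev hadm) hcd hκ
          fun E hE => hcard hN hρ hev E (hcd' hE),
        quantumMixing_of_estimates hG hN (hest hev hadm) hκ
          fun E hE => hcard hN hρ hev E (hcd' (interior_subset hE))⟩
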